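/- \textbf{Conventions.} Spaces, groups and groupoids are second countable, locally compact and Hausdorff; a groupoid $\mathcal X$ carries a left Haar system $\lambda$. A Fell bundle $p:\mathcal A\to\mathcal X$ is a separable upper semicontinuous Banach bundle (the sections vanishing at infinity form a separable Banach space) with a continuous, bilinear, associative multiplication $(a,b)\mapsto ab$, defined when $s(a)=r(b)$, and a continuous involution $a\mapsto a^*$, where $s(a)=s(p(a))$, $r(a)=r(p(a))$, such that $p(ab)=p(a)p(b)$, $p(a^*)=p(a)^{-1}$, $(ab)^*=b^*a^*$, the fibres $A(u)$ over units are $C^*$-algebras, and each fibre $A(x)$ is an $A(r(x))$–$A(s(x))$ imprimitivity bimodule with inner products $ab^*$ and $a^*b$. A group $G$ acts on (the left of) $\mathcal A$ if it acts continuously by groupoid automorphisms on $\mathcal X$ and continuously by Fell-bundle automorphisms on $\mathcal A$, with $p(t\cdot a)=t\cdot p(a)$; the action is free and proper if the action on the space $\mathcal X$ is. The semidirect product $\mathcal X\rtimes G$ is $\mathcal X\times G$ with $(x,t)(y,u)=(x(t\cdot y),tu)$ and $(x,t)^{-1}=(t^{-1}\cdot x^{-1},t^{-1})$, so that $r(x,t)=(r(x),e)$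 and $s(x,t)=(t^{-1}\cdot s(x),e)$; $\mathcal A\rtimes G=\mathcal A\times G$ is a bundle over it with $(a,t)(b,u)=(a(t\cdot b),tu)$ and $(a,t)^*=(t^{-1}\cdot a^*,t^{-1})$. The orbit groupoid $G\backslash\mathcal X$ and the bundle $G\backslash\mathcal A$ over it have the operations $(G\cdot x)(G\cdot y)=G\cdot xy$ if $s(x)=r(y)$, $(G\cdot a)(G\cdot b)=G\cdot ab$ if $s(a)=r(b)$, $(G\cdot a)^*=G\cdot a^*$, and $\|G\cdot a\|=\|a\|$. Given Fell bundles $\mathcal B\to\mathcal Y$ and $\mathcal C\to\mathcal Z$, a $\mathcal B$–$\mathcal C$ \emph{equivalence} is a separable upper semicontinuous Banach bundle $q:\mathcal E\to\Omega$ over a $\mathcal Y$–$\mathcal Z$ groupoid equivalence $\Omega$ (free and proper commuting actions with continuous open fibring maps $\rho:\Omega\to\mathcal Y^{(0)}$, $\sigma:\Omega\to\mathcal Z^{(0)}$ that induce homeomorphisms $\Omega/\mathcal Z\cong\mathcal Y^{(0)}$ and $\mathcal Y\backslash\Omega\cong\mathcal Z^{(0)}$), with commuting continuous actions of $\mathcal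 B$ on the left and $\mathcal C$ on the right of $\mathcal E$ that cover the actions on $\Omega$, are bilinear and satisfy $\|b\cdot e\|\le\|b\|\|e\|$, $\|e\cdot c\|\le\|e\|\|c\|$, and with continuous sesquilinear maps ${}_L\langle e,f\rangle\in\mathcal B$ (for $\sigma(q(e))=\sigma(q(f))$) and $\langle e,f\rangle_R\in\mathcal C$ (for $\rho(q(e))=\rho(q(f))$) such that ${}_L\langle e,f\rangle$ lies over the unique $y$ with $q(e)=y\cdot q(f)$ and $\langle e,f\rangle_R$ over the unique $z$ with $q(f)=q(e)\cdot z$; ${}_L\langle e,f\rangle^*={}_L\langle f,e\rangle$, $\langle e,f\rangle_R^*=\langle f,e\rangle_R$; ${}_L\langle b\cdot e,f\rangle=b\,{}_L\langle e,f\rangle$, $\langle e,f\cdot c\rangle_R=\langle e,f\rangle_R\,c$; ${}_L\langle e,f\rangle\cdot g=e\cdot\langle f,g\rangle_R$; and every fibre $E(w)$ is with these operations a $B(\rho(w))$–$C(\sigma(w))$ imprimitivity bimodule. \textbf{Theorem.} Let a locally compact group $G$ act freely and properly on the left of a Fell bundle $p:\mathcal A\to\mathcal X$ over a locally compact groupoid.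 Then $\mathcal A\rtimes G\to\mathcal X\rtimes G$ and $G\backslash\mathcal A\to G\backslash\mathcal X$ are Fell bundles, and the Banach bundle $\mathcal A\to\mathcal X$ becomes an $(\mathcal A\rtimes G)$–$(G\backslash\mathcal A)$ equivalence in the following way: \begin{enumerate} \item[(i)] $\mathcal A\rtimes G$ acts on the left of $\mathcal A$ by $(a,t)\cdot b=a(t\cdot b)$ if $s(a)=t\cdot r(b)$; \item[(ii)] the left inner product is ${}_L\langle a,b\rangle=\bigl(a(t\cdot b^*),t\bigr)$ if $G\cdot s(a)=G\cdot s(b)$, where $t$ is the unique element of $G$ with $s(a)=t\cdot s(b)$; \item[(iii)] $G\backslash\mathcal A$ acts on the right of $\mathcal A$ by $a\cdot(G\cdot b)=ab$ if $s(a)=r(b)$; \item[(iv)] the right inner product is $\langle a,b\rangle_R=G\cdot a^*b$ if $r(a)=r(b)$. \end{enumerate} The underlying groupoid equivalence is the space $\mathcal X$ with $\rho(x)=(r(x),e)$, $(x,t)\cdot y=x(t\cdot y)$ if $s(x)=t\cdot r(y)$, $\sigma(x)=G\cdot s(x)$, and $x\cdot(G\cdot y)=xy$ if $s(x)=r(y)$.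 Moreover, if $\lambda$ is $G$-invariant, i.e. $\int f(t\cdot x)\,d\lambda^u(x)=\int f(x)\,d\lambda^{t\cdot u}(x)$ for all $f\in C_c(\mathcal X)$, $t\in G$ and $u\in\mathcal X^{(0)}$, then, for every left Haar measure $\mu$ on $G$, the measures $\lambda^u\times\mu$ at the units $(u,e)$ form a left Haar system on $\mathcal X\rtimes G$, and the images of the $\lambda^u$ under $x\mapsto G\cdot x$ are well defined at the units $G\cdot u$ and form a left Haar system on $G\backslash\mathcal X$. -/

import Mathlib

open Filter MeasureTheory Topology

noncomputable section

namespace FellBundles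

/-! ### Groupoids, given by their space of arrows -/

/-- The operations of a (small) groupoid with set of arrows `X`.  The units are regarded as
arrows, so that range and source are maps `X → X`; the product `x y` is defined exactly when
`s x = r y`. -/
structure GroupoidOps (X : Type*) where
  r : X → X
  s : X → X
  inv : X → X
  mul : (x y : X) → s x = r y → X

namespace GroupoidOps

/-- `u` is a unit (an element of `X⁽⁰⁾`). -/
def IsIdentity {X : Type*} (𝒳 : GroupoidOps X) (u : X) : Prop := 𝒳.r u = u ∧ 𝒳.s u = u

/-- The unit space `X⁽⁰⁾`, with the subspace topology if `X` is a space. -/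
abbrev UnitSpace {X : Type*} (𝒳 : GroupoidOps X) : Type _ := {u : X // 𝒳.IsIdentity u}

/-- `𝒳` is a second countable locally compact Hausdorff groupoid. -/
structure IsLCGroupoid {X : Type*} [TopologicalSpace X] (𝒳 : GroupoidOps X) : Prop where
  locallyCompact : LocallyCompactSpace X
  hausdorff : T2Space X
  secondCountable : SecondCountableTopology X
  isIdentity_r : ∀ x, 𝒳.IsIdentity (𝒳.r x)
  isIdentity_s : ∀ x, 𝒳.IsIdentity (𝒳.s x)
  r_mul : ∀ x y h, 𝒳.r (𝒳.mul x y h) = 𝒳.r x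
  s_mul : ∀ x y h, 𝒳.s (𝒳.mul x y h) = 𝒳.s y
  mul_assoc : ∀ x y z hxy hyz h₁ h₂,
    𝒳.mul (𝒳.mul x y hxy) z h₁ = 𝒳.mul x (𝒳.mul y z hyz) h₂
  r_mul_self : ∀ x h, 𝒳.mul (𝒳.r x) x h = x
  mul_s_self : ∀ x h, 𝒳.mul x (𝒳.s x) h = x
  r_inv : ∀ x, 𝒳.r (𝒳.inv x) = 𝒳.s x
  s_inv : ∀ x, 𝒳.s (𝒳.inv x) = 𝒳.r x
  mul_inv : ∀ x h, 𝒳.mul x (𝒳.inv x) h = 𝒳.r x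
  inv_mul : ∀ x h, 𝒳.mul (𝒳.inv x) x h = 𝒳.s x
  continuous_r : Continuous 𝒳.r
  continuous_s : Continuous 𝒳.s
  continuous_inv : Continuous 𝒳.inv
  continuous_mul : Continuous fun z : {z : X × X // 𝒳.s z.1 = 𝒳.r z.2} =>
    𝒳.mul z.1.1 z.1.2 z.2

theorem mul_congr {X : Type*} (𝒳 : GroupoidOps X) {x x' y y' : X} (hx : x = x') (hy : y = y')
    (h : 𝒳.s x = 𝒳.r y) (h' : 𝒳.s x' = 𝒳.r y') : 𝒳.mul x y h = 𝒳.mul x' y' h' := by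
  subst hx hy
  rfl

open Classical in
/-- `lam` is a left Haar system on the second countable locally compact Hausdorff groupoid `𝒳`:
`lam u` is a Radon measure with support `r⁻¹(u)` for every unit `u` (values of `lam` at arrows
that are not units are irrelevant; on such a space a Borel measure that is finite on compact
sets is Radon), the integrals of functions in `C_c(X)` are continuous in `u`, and the system is
left invariant. -/
structure IsHaarSystem {X : Type*} [TopologicalSpace X] [MeasurableSpace X]
    (𝒳 : GroupoidOps X) (lam : X → Measure X) : Prop where
  finite_of_compact : ∀ u, 𝒳.IsIdentity u → IsFiniteMeasureOnCompacts (lam u)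
  null_compl : ∀ u, 𝒳.IsIdentity u → lam u {x | 𝒳.r x ≠ u} = 0
  pos_of_open : ∀ u, 𝒳.IsIdentity u → ∀ U : Set X, IsOpen U → (∃ x ∈ U, 𝒳.r x = u) →
    0 < lam u U
  continuous_integral : ∀ f : X → ℝ, Continuous f → HasCompactSupport f →
    Continuous fun u : 𝒳.UnitSpace => ∫ x, f x ∂(lam u.1)
  left_invariant : ∀ f : X → ℝ, Continuous f → HasCompactSupport f → ∀ x,
    ∫ y, (if h : 𝒳.s x = 𝒳.r y then f (𝒳.mul x y h) else 0) ∂(lam (𝒳.s x)) =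
      ∫ y, f y ∂(lam (𝒳.r x))

end GroupoidOps

/-! ### Upper semicontinuous Banach bundles -/

/-- The fibre of `p` over `x`.  (A definition of its own, so that it does not carry the subspace
topology as an instance.) -/
def FibreOf {A X : Type*} (p : A → X) (x : X) : Type _ := {a : A // p a = x}

/-- A family of complex Banach spaces indexed by `X`, with total space `A`. -/
structure BanachFamily (A X : Type*) where
  proj : A → X
  normedAddCommGroup : ∀ x, NormedAddCommGroup (FibreOf proj x)
  normedSpace : ∀ x, NormedSpace ℂ (FibreOf proj x)
  completeSpace : ∀ x, CompleteSpace (FibreOf proj x)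

namespace BanachFamily

attribute [instance] normedAddCommGroup normedSpace completeSpace

variable {A X : Type*}

/-- The fibre of the family over `x`. -/
abbrev Fibre (ℰ : BanachFamily A X) (x : X) : Type _ := FibreOf ℰ.proj x

/-- An element of the total space that lies over `x`, as an element of the fibre over `x`. -/
def fib (ℰ : BanachFamily A X) {x : X} (a : A) (h : ℰ.proj a = x) : ℰ.Fibre x := ⟨a, h⟩

/-- An element of the total space, as an element of its fibre. -/
def elt (ℰ : BanachFamily A X) (a : A) : ℰ.Fibre (ℰ.proj a) := ℰ.fib a rfl

/-- The zero vector over `x`. -/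
def zero (ℰ : BanachFamily A X) (x : X) : A := (0 : ℰ.Fibre x).1

/-- The sum of two vectors in the same fibre. -/
def add (ℰ : BanachFamily A X) (a b : A) (h : ℰ.proj a = ℰ.proj b) : A :=
  (ℰ.fib a h + ℰ.elt b).1

/-- A scalar multiple of a vector. -/
def smul (ℰ : BanachFamily A X) (c : ℂ) (a : A) : A := (c • ℰ.elt a).1

/-- The norm of a vector in its fibre. -/
def nrm (ℰ : BanachFamily A X) (a : A) : ℝ := ‖ℰ.elt a‖

theorem add_val (ℰ : BanachFamily A X) {x : X} (a b : ℰ.Fibre x) :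
    (a + b).1 = ℰ.add a.1 b.1 (a.2.trans b.2.symm) := by
  obtain ⟨b, rfl⟩ := b
  rfl

theorem smul_val (ℰ : BanachFamily A X) {x : X} (c : ℂ) (a : ℰ.Fibre x) :
    (c • a).1 = ℰ.smul c a.1 := by
  obtain ⟨a, rfl⟩ := a
  rfl

theorem norm_val (ℰ : BanachFamily A X) {x : X} (a : ℰ.Fibre x) : ‖a‖ = ℰ.nrm a.1 := by
  obtain ⟨a, rfl⟩ := a
  rfl

/-- An upper semicontinuous Banach bundle.  (The projection is automatically surjective.) -/
structure IsBanachBundle [TopologicalSpace A] [TopologicalSpace X] (ℰ : BanachFamily A X) :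
    Prop where
  continuous_proj : Continuous ℰ.proj
  isOpenMap_proj : IsOpenMap ℰ.proj
  upperSemicontinuous_nrm : UpperSemicontinuous ℰ.nrm
  continuous_add : Continuous fun z : {z : A × A // ℰ.proj z.1 = ℰ.proj z.2} =>
    ℰ.add z.1.1 z.1.2 z.2
  continuous_smul : ∀ c : ℂ, Continuous (ℰ.smul c)
  tendsto_zero : ∀ (l : Filter A) (x : X), Tendsto ℰ.proj l (𝓝 x) →
    Tendsto ℰ.nrm l (𝓝 0) → l ≤ 𝓝 (ℰ.zero x)

/-- Continuous sections vanishing at infinity. -/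
structure C0Section [TopologicalSpace A] [TopologicalSpace X] (ℰ : BanachFamily A X) where
  toFun : X → A
  proj_toFun : ∀ x, ℰ.proj (toFun x) = x
  continuous_toFun : Continuous toFun
  vanishing : ∀ ε : ℝ, 0 < ε → ∃ K : Set X, IsCompact K ∧ ∀ x, x ∉ K → ℰ.nrm (toFun x) < ε

/-- The value of a section at `x`, as an element of the fibre over `x`. -/
def C0Section.eval [TopologicalSpace A] [TopologicalSpace X] {ℰ : BanachFamily A X}
    (f : C0Section ℰ) (x : X) : ℰ.Fibre x := ⟨f.toFun x, f.proj_toFun x⟩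

/-- The Banach space of continuous sections vanishing at infinity, with the supremum norm, is
separable. -/
def IsSeparable [TopologicalSpace A] [TopologicalSpace X] (ℰ : BanachFamily A X) : Prop :=
  ∃ D : Set (C0Section ℰ), D.Countable ∧
    ∀ (f : C0Section ℰ) (ε : ℝ), 0 < ε → ∃ d ∈ D, ∀ x, ‖f.eval x - d.eval x‖ < ε

/-- The family with total space `A'` and projection `p'` whose fibre over `x'` carries the Banach
space structure of the fibre of `ℰ` over `φ x'`, transported along the bijection `e x'`. -/
def transport {A' X' : Type*} (ℰ : BanachFamily A X) (p' : A' → X') (φ : X' → X)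
    (e : ∀ x', FibreOf p' x' ≃ ℰ.Fibre (φ x')) : BanachFamily A' X' where
  proj := p'
  normedAddCommGroup x' := (e x').normedAddCommGroup
  normedSpace x' := (e x').normedSpace ℂ
  completeSpace x' := by
    let _ := (e x').normedAddCommGroup
    have hi : Isometry (e x') := fun _ _ => rfl
    exact (completeSpace_congr (e := e x') hi.isUniformInducing.isUniformEmbedding).2
      inferInstance

end BanachFamily

/-! ### Imprimitivity bimodules -/

/-- The Banach space `E`, with left multiplication `l` by `B`, right multiplication `m` by `C`,
and inner products `L` and `R`, is a `B`--`C` imprimitivity bimodule: a full left Hilbert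
`B`-module and a full right Hilbert `C`-module, whose Hilbert-module norms are the norm of `E`,
in which both algebras act by adjointable operators for the inner product of the other one and
`L(e, f) · g = e · R(f, g)`. -/
structure IsImprimitivityBimodule (B E C : Type*) [NonUnitalCStarAlgebra B]
    [NonUnitalCStarAlgebra C] [NormedAddCommGroup E] [NormedSpace ℂ E] [CompleteSpace E]
    (l : B → E → E) (m : E → C → E) (L : E → E → B) (R : E → E → C) : Prop where
  l_add : ∀ b e f, l b (e + f) = l b e + l b f
  add_l : ∀ b b' e, l (b + b') e = l b e + l b' e
  smul_l : ∀ (c : ℂ) b e, l (c • b) e = c • l b e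
  l_smul : ∀ (c : ℂ) b e, l b (c • e) = c • l b e
  mul_l : ∀ b b' e, l (b * b') e = l b (l b' e)
  m_add : ∀ e c c', m e (c + c') = m e c + m e c'
  add_m : ∀ e f c, m (e + f) c = m e c + m f c
  smul_m : ∀ (k : ℂ) e c, m (k • e) c = k • m e c
  m_smul : ∀ (k : ℂ) e c, m e (k • c) = k • m e c
  m_mul : ∀ e c c', m e (c * c') = m (m e c) c'
  L_add : ∀ e f g, L (e + f) g = L e g + L f g
  L_smul : ∀ (c : ℂ) e f, L (c • e) f = c • L e f
  L_mul : ∀ b e f, L (l b e) f = b * L e f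
  L_star : ∀ e f, star (L e f) = L f e
  L_nonneg : ∀ e, ∃ b, L e e = star b * b
  L_norm : ∀ e, ‖L e e‖ = ‖e‖ ^ 2
  L_full : Dense (Submodule.span ℂ (Set.range fun z : E × E => L z.1 z.2) : Set B)
  R_add : ∀ e f g, R e (f + g) = R e f + R e g
  R_smul : ∀ (c : ℂ) e f, R e (c • f) = c • R e f
  R_mul : ∀ e f c, R e (m f c) = R e f * c
  R_star : ∀ e f, star (R e f) = R f e
  R_nonneg : ∀ e, ∃ c, R e e = star c * c
  R_norm : ∀ e, ‖R e e‖ = ‖e‖ ^ 2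
  R_full : Dense (Submodule.span ℂ (Set.range fun z : E × E => R z.1 z.2) : Set C)
  R_adjoint : ∀ b e f, R (l b e) f = R e (l (star b) f)
  L_adjoint : ∀ e f c, L (m e c) f = L e (m f (star c))
  compat : ∀ e f g, l (L e f) g = m e (R f g)

/-! ### Fell bundles -/

/-- The operations of a Fell bundle over the groupoid `𝒳`: a family of Banach spaces with a
product `a b`, defined exactly when `s(a) = r(b)`, and an involution. -/
structure FellOps {X : Type*} (𝒳 : GroupoidOps X) (A : Type*) extends BanachFamily A X where
  mul : (a b : A) → 𝒳.s (proj a) = 𝒳.r (proj b) → A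
  adj : A → A

theorem FellOps.mul_congr {X A : Type*} {𝒳 : GroupoidOps X} (𝒜 : FellOps 𝒳 A) {a a' b b' : A}
    (ha : a = a') (hb : b = b') (h : 𝒳.s (𝒜.proj a) = 𝒳.r (𝒜.proj b))
    (h' : 𝒳.s (𝒜.proj a') = 𝒳.r (𝒜.proj b')) : 𝒜.mul a b h = 𝒜.mul a' b' h' := by
  subst ha hb
  rfl

/-- All axioms of a separable Fell bundle over a second countable locally compact Hausdorff
groupoid, except that the fibres are imprimitivity bimodules.  The last two axioms say that the
fibres over units are C*-algebras. -/
structure IsPreFellBundle {X A : Type*} [TopologicalSpace X] [TopologicalSpace A]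
    {𝒳 : GroupoidOps X} (𝒜 : FellOps 𝒳 A) : Prop where
  isLCGroupoid : 𝒳.IsLCGroupoid
  isBanachBundle : 𝒜.IsBanachBundle
  isSeparable : 𝒜.IsSeparable
  proj_mul : ∀ a b h, 𝒜.proj (𝒜.mul a b h) = 𝒳.mul (𝒜.proj a) (𝒜.proj b) h
  proj_adj : ∀ a, 𝒜.proj (𝒜.adj a) = 𝒳.inv (𝒜.proj a)
  add_mul : ∀ a a' b h h₁ h₂ h₃ h₄,
    𝒜.mul (𝒜.add a a' h) b h₁ = 𝒜.add (𝒜.mul a b h₂) (𝒜.mul a' b h₃) h₄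
  mul_add : ∀ a b b' h h₁ h₂ h₃ h₄,
    𝒜.mul a (𝒜.add b b' h) h₁ = 𝒜.add (𝒜.mul a b h₂) (𝒜.mul a b' h₃) h₄
  smul_mul : ∀ c a b h h₁, 𝒜.mul (𝒜.smul c a) b h₁ = 𝒜.smul c (𝒜.mul a b h)
  mul_smul : ∀ c a b h h₁, 𝒜.mul a (𝒜.smul c b) h₁ = 𝒜.smul c (𝒜.mul a b h)
  mul_assoc : ∀ a b c hab hbc h₁ h₂,
    𝒜.mul (𝒜.mul a b hab) c h₁ = 𝒜.mul a (𝒜.mul b c hbc) h₂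
  adj_adj : ∀ a, 𝒜.adj (𝒜.adj a) = a
  adj_add : ∀ a b h h₁, 𝒜.adj (𝒜.add a b h) = 𝒜.add (𝒜.adj a) (𝒜.adj b) h₁
  adj_smul : ∀ c a, 𝒜.adj (𝒜.smul c a) = 𝒜.smul (star c) (𝒜.adj a)
  adj_mul : ∀ a b h h₁, 𝒜.adj (𝒜.mul a b h) = 𝒜.mul (𝒜.adj b) (𝒜.adj a) h₁
  continuous_mul : Continuous fun z : {z : A × A // 𝒳.s (𝒜.proj z.1) = 𝒳.r (𝒜.proj z.2)} =>
    𝒜.mul z.1.1 z.1.2 z.2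
  continuous_adj : Continuous 𝒜.adj
  nrm_mul_le : ∀ u, 𝒳.IsIdentity u → ∀ a b, 𝒜.proj a = u → 𝒜.proj b = u → ∀ h,
    𝒜.nrm (𝒜.mul a b h) ≤ 𝒜.nrm a * 𝒜.nrm b
  nrm_adj_mul_self : ∀ u, 𝒳.IsIdentity u → ∀ a, 𝒜.proj a = u → ∀ h,
    𝒜.nrm (𝒜.mul (𝒜.adj a) a h) = 𝒜.nrm a * 𝒜.nrm a

namespace IsPreFellBundle

variable {X A : Type*} [TopologicalSpace X] [TopologicalSpace A] {𝒳 : GroupoidOps X}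
  {𝒜 : FellOps 𝒳 A}

/-- The product `A(x) × A(y) → A(z)`, where `z = xy`. -/
def fmul (H : IsPreFellBundle 𝒜) {x y z : X} (h : 𝒳.s x = 𝒳.r y) (hz : 𝒳.mul x y h = z)
    (a : 𝒜.Fibre x) (b : 𝒜.Fibre y) : 𝒜.Fibre z :=
  ⟨𝒜.mul a.1 b.1 (by rw [a.2, b.2, h]),
    (H.proj_mul _ _ _).trans ((𝒳.mul_congr a.2 b.2 _ h).trans hz)⟩

/-- The involution `A(x) → A(y)`, where `y = x⁻¹`. -/
def fadj (H : IsPreFellBundle 𝒜) {x y : X} (hy : 𝒳.inv x = y) (a : 𝒜.Fibre x) : 𝒜.Fibre y :=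
  ⟨𝒜.adj a.1, (H.proj_adj _).trans ((congrArg 𝒳.inv a.2).trans hy)⟩

theorem fmul_add (H : IsPreFellBundle 𝒜) {x y z : X} (h : 𝒳.s x = 𝒳.r y)
    (hz : 𝒳.mul x y h = z) (a : 𝒜.Fibre x) (b b' : 𝒜.Fibre y) :
    H.fmul h hz a (b + b') = H.fmul h hz a b + H.fmul h hz a b' := by
  apply Subtype.ext
  rw [𝒜.add_val]
  have hb : 𝒜.proj b.1 = 𝒜.proj b'.1 := b.2.trans b'.2.symm
  exact (𝒜.mul_congr rfl (𝒜.add_val b b') _ (by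
    rw [← 𝒜.add_val, (b + b').2, a.2, h])).trans (H.mul_add _ _ _ hb _ _ _ _)

theorem add_fmul (H : IsPreFellBundle 𝒜) {x y z : X} (h : 𝒳.s x = 𝒳.r y)
    (hz : 𝒳.mul x y h = z) (a a' : 𝒜.Fibre x) (b : 𝒜.Fibre y) :
    H.fmul h hz (a + a') b = H.fmul h hz a b + H.fmul h hz a' b := by
  apply Subtype.ext
  rw [𝒜.add_val]
  have hb : 𝒜.proj a.1 = 𝒜.proj a'.1 := a.2.trans a'.2.symm
  exact (𝒜.mul_congr (𝒜.add_val a a') rfl _ (by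
    rw [← 𝒜.add_val, (a + a').2, b.2, h])).trans (H.add_mul _ _ _ hb _ _ _ _)

theorem smul_fmul (H : IsPreFellBundle 𝒜) {x y z : X} (h : 𝒳.s x = 𝒳.r y)
    (hz : 𝒳.mul x y h = z) (c : ℂ) (a : 𝒜.Fibre x) (b : 𝒜.Fibre y) :
    H.fmul h hz (c • a) b = c • H.fmul h hz a b := by
  apply Subtype.ext
  rw [𝒜.smul_val]
  exact (𝒜.mul_congr (𝒜.smul_val c a) rfl _ (by
    rw [← 𝒜.smul_val, (c • a).2, b.2, h])).trans (H.smul_mul _ _ _ _ _)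

theorem fmul_smul (H : IsPreFellBundle 𝒜) {x y z : X} (h : 𝒳.s x = 𝒳.r y)
    (hz : 𝒳.mul x y h = z) (c : ℂ) (a : 𝒜.Fibre x) (b : 𝒜.Fibre y) :
    H.fmul h hz a (c • b) = c • H.fmul h hz a b := by
  apply Subtype.ext
  rw [𝒜.smul_val]
  exact (𝒜.mul_congr rfl (𝒜.smul_val c b) _ (by
    rw [← 𝒜.smul_val, (c • b).2, a.2, h])).trans (H.mul_smul _ _ _ _ _)

theorem unit_comp {X : Type*} {𝒳 : GroupoidOps X} {u : X} (hu : 𝒳.IsIdentity u) : 𝒳.s u = 𝒳.r u := hu.2.trans hu.1.symm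

theorem unit_mul (H : IsPreFellBundle 𝒜) {u : X} (hu : 𝒳.IsIdentity u) :
    𝒳.mul u u (unit_comp hu) = u :=
  (𝒳.mul_congr hu.1.symm rfl _ ((congrArg 𝒳.s hu.1).trans (unit_comp hu))).trans
    (H.isLCGroupoid.r_mul_self u _)

theorem unit_inv (H : IsPreFellBundle 𝒜) {u : X} (hu : 𝒳.IsIdentity u) : 𝒳.inv u = u := by
  have h₁ : 𝒳.s u = 𝒳.r (𝒳.inv u) := (H.isLCGroupoid.r_inv u).symm
  have h₂ : 𝒳.s (𝒳.r (𝒳.inv u)) = 𝒳.r (𝒳.inv u) := (H.isLCGroupoid.isIdentity_r _).2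
  have h₃ : u = 𝒳.r (𝒳.inv u) := by rw [← h₁, hu.2]
  calc 𝒳.inv u = 𝒳.mul (𝒳.r (𝒳.inv u)) (𝒳.inv u) h₂ := (H.isLCGroupoid.r_mul_self _ _).symm
    _ = 𝒳.mul u (𝒳.inv u) h₁ := 𝒳.mul_congr h₃.symm rfl _ _
    _ = 𝒳.r u := H.isLCGroupoid.mul_inv u _
    _ = u := hu.1

/-- The C*-algebra `A(u)` over a unit `u`. -/
abbrev cstar (H : IsPreFellBundle 𝒜) {u : X} (hu : 𝒳.IsIdentity u) :
    NonUnitalCStarAlgebra (𝒜.Fibre u) where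
  __ := 𝒜.normedAddCommGroup u
  __ := 𝒜.normedSpace u
  __ := 𝒜.completeSpace u
  mul := H.fmul (unit_comp hu) (H.unit_mul hu)
  star := H.fadj (H.unit_inv hu)
  left_distrib a b c := H.fmul_add _ _ a b c
  right_distrib a b c := H.add_fmul _ _ a b c
  zero_mul a := by
    have h := H.smul_fmul (unit_comp hu) (H.unit_mul hu) 0 0 a
    rwa [zero_smul, zero_smul] at h
  mul_zero a := by
    have h := H.fmul_smul (unit_comp hu) (H.unit_mul hu) 0 a 0
    rwa [zero_smul, zero_smul] at h
  mul_assoc a b c := Subtype.ext (H.mul_assoc _ _ _ _ _ _ _)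
  norm_mul_le a b := by
    rw [𝒜.norm_val, 𝒜.norm_val, 𝒜.norm_val]
    exact H.nrm_mul_le u hu _ _ a.2 b.2 _
  star_involutive a := Subtype.ext (H.adj_adj _)
  star_mul a b := Subtype.ext (H.adj_mul _ _ _ _)
  star_add a b := by
    apply Subtype.ext
    have hab : 𝒜.proj a.1 = 𝒜.proj b.1 := a.2.trans b.2.symm
    refine (congrArg 𝒜.adj (𝒜.add_val a b)).trans ((H.adj_add _ _ hab ?_).trans
      (𝒜.add_val (H.fadj (H.unit_inv hu) a) (H.fadj (H.unit_inv hu) b)).symm)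
    rw [H.proj_adj, H.proj_adj, hab]
  norm_mul_self_le a := by
    rw [𝒜.norm_val, 𝒜.norm_val]
    exact (H.nrm_adj_mul_self u hu _ a.2 _).ge
  smul_assoc c a b := H.smul_fmul _ _ c a b
  smul_comm c a b := (H.fmul_smul _ _ c a b).symm
  star_smul c a := by
    apply Subtype.ext
    exact (congrArg 𝒜.adj (𝒜.smul_val c a)).trans ((H.adj_smul c _).trans
      (𝒜.smul_val (star c) (H.fadj (H.unit_inv hu) a)).symm)

end IsPreFellBundle

/-- The fibre `A(x)` is an `A(r(x))`--`A(s(x))` imprimitivity bimodule, with the module actions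
given by the product of the bundle and inner products `a b*` and `a* b`. -/
def IsPreFellBundle.FibreImprimitivity {X A : Type*} [TopologicalSpace X] [TopologicalSpace A]
    {𝒳 : GroupoidOps X} {𝒜 : FellOps 𝒳 A} (H : IsPreFellBundle 𝒜) (x : X) : Prop :=
  let hr := H.isLCGroupoid.isIdentity_r x
  let hs := H.isLCGroupoid.isIdentity_s x
  letI := H.cstar hr
  letI := H.cstar hs
  IsImprimitivityBimodule (𝒜.Fibre (𝒳.r x)) (𝒜.Fibre x) (𝒜.Fibre (𝒳.s x))
    (fun b e => H.fmul hr.2 (H.isLCGroupoid.r_mul_self x _) b e)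
    (fun e c => H.fmul hs.1.symm (H.isLCGroupoid.mul_s_self x _) e c)
    (fun e f => H.fmul (H.isLCGroupoid.r_inv x).symm (H.isLCGroupoid.mul_inv x _)
      e (H.fadj rfl f))
    (fun e f => H.fmul (H.isLCGroupoid.s_inv x) (H.isLCGroupoid.inv_mul x _)
      (H.fadj rfl e) f)

/-- A separable Fell bundle over a second countable locally compact Hausdorff groupoid. -/
structure IsFellBundle {X A : Type*} [TopologicalSpace X] [TopologicalSpace A]
    {𝒳 : GroupoidOps X} (𝒜 : FellOps 𝒳 A) : Prop extends IsPreFellBundle 𝒜 where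
  fibreImprimitivity : ∀ x, toIsPreFellBundle.FibreImprimitivity x

/-! ### Actions of groups by automorphisms -/

/-- `G` acts on (the left of) the groupoid `𝒳` by automorphisms. -/
structure IsGroupoidAction (G : Type*) {X : Type*} [Group G] [MulAction G X]
    [TopologicalSpace G] [TopologicalSpace X] (𝒳 : GroupoidOps X) : Prop where
  continuous_smul : Continuous fun z : G × X => z.1 • z.2
  r_smul : ∀ (t : G) x, 𝒳.r (t • x) = t • 𝒳.r x
  s_smul : ∀ (t : G) x, 𝒳.s (t • x) = t • 𝒳.s x
  inv_smul : ∀ (t : G) x, 𝒳.inv (t • x) = t • 𝒳.inv x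
  mul_smul : ∀ (t : G) x y h h₁, 𝒳.mul (t • x) (t • y) h₁ = t • 𝒳.mul x y h

/-- `G` acts on (the left of) the Fell bundle `𝒜` by automorphisms. -/
structure IsFellAction (G : Type*) {X A : Type*} [Group G] [MulAction G X] [MulAction G A]
    [TopologicalSpace G] [TopologicalSpace X] [TopologicalSpace A] {𝒳 : GroupoidOps X}
    (𝒜 : FellOps 𝒳 A) : Prop where
  base : IsGroupoidAction G 𝒳
  continuous_smul : Continuous fun z : G × A => z.1 • z.2
  proj_smul : ∀ (t : G) a, 𝒜.proj (t • a) = t • 𝒜.proj a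
  add_smul : ∀ (t : G) a b h h₁, 𝒜.add (t • a) (t • b) h₁ = t • 𝒜.add a b h
  smul_smul : ∀ (t : G) c a, 𝒜.smul c (t • a) = t • 𝒜.smul c a
  nrm_smul : ∀ (t : G) a, 𝒜.nrm (t • a) = 𝒜.nrm a
  mul_smul : ∀ (t : G) a b h h₁, 𝒜.mul (t • a) (t • b) h₁ = t • 𝒜.mul a b h
  adj_smul : ∀ (t : G) a, 𝒜.adj (t • a) = t • 𝒜.adj a

/-! ### Orbit spaces -/

/-- The orbit space `G \ X`. -/
def OrbitSpace (G X : Type*) [Group G] [MulAction G X] : Type _ :=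
  Quotient (MulAction.orbitRel G X)

namespace OrbitSpace

variable {G X : Type*} [Group G] [MulAction G X]

instance [TopologicalSpace X] : TopologicalSpace (OrbitSpace G X) :=
  inferInstanceAs (TopologicalSpace (Quotient (MulAction.orbitRel G X)))

instance [TopologicalSpace X] : MeasurableSpace (OrbitSpace G X) := borel _

instance [TopologicalSpace X] : BorelSpace (OrbitSpace G X) := ⟨rfl⟩

variable (G) in
/-- The orbit `G · x`. -/
def mk (x : X) : OrbitSpace G X := Quotient.mk (MulAction.orbitRel G X) x

/-- A representative of an orbit. -/
def out (P : OrbitSpace G X) : X := Quotient.out P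

theorem mk_out (P : OrbitSpace G X) : mk G P.out = P := Quotient.out_eq P

theorem mk_eq_mk {x y : X} : mk G x = mk G y ↔ ∃ t : G, t • y = x :=
  Quotient.eq (r := MulAction.orbitRel G X)

theorem mk_smul (t : G) (x : X) : mk G (t • x) = mk G x := mk_eq_mk.2 ⟨t, rfl⟩

/-- The map of orbit spaces induced by an equivariant map. -/
def map {Y : Type*} [MulAction G Y] (f : X → Y) (hf : ∀ (t : G) x, f (t • x) = t • f x) :
    OrbitSpace G X → OrbitSpace G Y :=
  Quotient.map f (by rintro _ x ⟨t, rfl⟩; exact ⟨t, (hf t x).symm⟩)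

end OrbitSpace

section Constructions

variable {G X A : Type*} [Group G] [MulAction G X] [MulAction G A]
  [TopologicalSpace G] [TopologicalSpace X] [TopologicalSpace A]
  {𝒳 : GroupoidOps X} {𝒜 : FellOps 𝒳 A}

/-! ### Semidirect products -/

theorem IsGroupoidAction.comp_smul (H : IsGroupoidAction G 𝒳) {t : G} {x y : X}
    (h : ((t⁻¹ • 𝒳.s x, 1) : X × G) = (𝒳.r y, 1)) : 𝒳.s x = 𝒳.r (t • y) := by
  have h₁ : t⁻¹ • 𝒳.s x = 𝒳.r y := congrArg Prod.fst h
  rw [H.r_smul, ← h₁, smul_inv_smul]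

/-- The semidirect-product groupoid `𝒳 ⋊ G`. -/
def semidirectGroupoid (H : IsGroupoidAction G 𝒳) : GroupoidOps (X × G) where
  r z := (𝒳.r z.1, 1)
  s z := (z.2⁻¹ • 𝒳.s z.1, 1)
  inv z := (z.2⁻¹ • 𝒳.inv z.1, z.2⁻¹)
  mul z w h := (𝒳.mul z.1 (z.2 • w.1) (H.comp_smul h), z.2 * w.2)

/-- The fibre of `𝒜 ⋊ G` over `(x, t)` is `A(x) × {t}`. -/
def semidirectFibreEquiv (𝒜 : FellOps 𝒳 A) (w : X × G) :
    FibreOf (fun z : A × G => (𝒜.proj z.1, z.2)) w ≃ 𝒜.Fibre w.1 where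
  toFun z := ⟨z.1.1, congrArg Prod.fst z.2⟩
  invFun a := ⟨(a.1, w.2), Prod.ext a.2 rfl⟩
  left_inv z := Subtype.ext (Prod.ext rfl (congrArg Prod.snd z.2).symm)
  right_inv _ := rfl

/-- The semidirect-product Fell bundle `𝒜 ⋊ G`. -/
def semidirectBundle (H : IsFellAction G 𝒜) : FellOps (semidirectGroupoid H.base) (A × G) where
  toBanachFamily := 𝒜.transport (fun z : A × G => (𝒜.proj z.1, z.2)) Prod.fst
    (semidirectFibreEquiv 𝒜)
  mul z w h := (𝒜.mul z.1 (z.2 • w.1) (by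
    rw [H.proj_smul]; exact H.base.comp_smul h), z.2 * w.2)
  adj z := (z.2⁻¹ • 𝒜.adj z.1, z.2⁻¹)

/-! ### Quotients -/

theorem IsGroupoidAction.exists_rep (H : IsGroupoidAction G 𝒳) (P Q : OrbitSpace G X)
    (h : OrbitSpace.map 𝒳.s H.s_smul P = OrbitSpace.map 𝒳.r H.r_smul Q) :
    ∃ z : {z : X × X // 𝒳.s z.1 = 𝒳.r z.2},
      OrbitSpace.mk G z.1.1 = P ∧ OrbitSpace.mk G z.1.2 = Q := by
  rw [← P.mk_out, ← Q.mk_out] at h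
  obtain ⟨t, ht⟩ := OrbitSpace.mk_eq_mk.1 h
  exact ⟨⟨(P.out, t • Q.out), by rw [H.r_smul, ht]⟩, P.mk_out,
    (OrbitSpace.mk_smul t _).trans Q.mk_out⟩

/-- The orbit groupoid `G \ 𝒳`: the product of two composable orbits is the orbit of `x y`, where
`x` and `y` are any composable representatives. -/
def orbitGroupoid (H : IsGroupoidAction G 𝒳) : GroupoidOps (OrbitSpace G X) where
  r := OrbitSpace.map 𝒳.r H.r_smul
  s := OrbitSpace.map 𝒳.s H.s_smul
  inv := OrbitSpace.map 𝒳.inv H.inv_smul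
  mul P Q h :=
    let z := (H.exists_rep P Q h).choose
    OrbitSpace.mk G (𝒳.mul z.1.1 z.1.2 z.2)

/-- The fibre of `G \ 𝒜` over an orbit is identified with the fibre of `𝒜` over a point `x` of
this orbit by `a ↦ G · a`.  (As `G` acts by isometric linear isomorphisms of the fibres, the
Banach space structure this gives does not depend on `x`.) -/
def orbitFibreEquiv [IsCancelSMul G X] (H : IsFellAction G 𝒜) (P : OrbitSpace G X) :
    𝒜.Fibre P.out ≃ FibreOf (OrbitSpace.map 𝒜.proj H.proj_smul) P :=
  Equiv.ofBijective
    (fun a => ⟨OrbitSpace.mk G a.1, (congrArg (OrbitSpace.mk G) a.2).trans P.mk_out⟩) (by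
      constructor
      · intro a b hab
        obtain ⟨t, ht⟩ := OrbitSpace.mk_eq_mk.1 (congrArg Subtype.val hab)
        have h₁ : t • P.out = (1 : G) • P.out := by
          rw [one_smul]
          calc t • P.out = 𝒜.proj (t • b.1) := by rw [H.proj_smul, b.2]
            _ = P.out := by rw [ht, a.2]
        have h₂ : t = 1 := IsCancelSMul.right_cancel _ _ _ h₁
        rw [h₂, one_smul] at ht
        exact Subtype.ext ht.symm
      · rintro ⟨Q, hQ⟩
        rw [← Q.mk_out, ← P.mk_out] at hQ
        obtain ⟨t, ht⟩ := OrbitSpace.mk_eq_mk.1 hQ.symm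
        refine ⟨⟨t • Q.out, by rw [H.proj_smul, ht]⟩, Subtype.ext ?_⟩
        exact (OrbitSpace.mk_smul t _).trans Q.mk_out)

theorem IsFellAction.exists_rep (H : IsFellAction G 𝒜) (P Q : OrbitSpace G A)
    (h : (orbitGroupoid H.base).s (OrbitSpace.map 𝒜.proj H.proj_smul P) =
      (orbitGroupoid H.base).r (OrbitSpace.map 𝒜.proj H.proj_smul Q)) :
    ∃ z : {z : A × A // 𝒳.s (𝒜.proj z.1) = 𝒳.r (𝒜.proj z.2)},
      OrbitSpace.mk G z.1.1 = P ∧ OrbitSpace.mk G z.1.2 = Q := by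
  rw [← P.mk_out, ← Q.mk_out] at h
  obtain ⟨t, ht⟩ := OrbitSpace.mk_eq_mk.1 h
  exact ⟨⟨(P.out, t • Q.out), by rw [H.proj_smul, H.base.r_smul, ht]⟩, P.mk_out,
    (OrbitSpace.mk_smul t _).trans Q.mk_out⟩

/-- The orbit Fell bundle `G \ 𝒜`: the product of two composable orbits is the orbit of `a b`,
where `a` and `b` are any composable representatives. -/
def orbitBundle [IsCancelSMul G X] (H : IsFellAction G 𝒜) :
    FellOps (orbitGroupoid H.base) (OrbitSpace G A) where
  toBanachFamily := 𝒜.transport (OrbitSpace.map 𝒜.proj H.proj_smul) OrbitSpace.out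
    (fun P => (orbitFibreEquiv H P).symm)
  mul P Q h :=
    let z := (H.exists_rep P Q h).choose
    OrbitSpace.mk G (𝒜.mul z.1.1 z.1.2 z.2)
  adj := OrbitSpace.map 𝒜.adj H.adj_smul

theorem orbitGroupoid_mul_mk [IsCancelSMul G X] (H : IsGroupoidAction G 𝒳) {x y : X}
    (h : 𝒳.s x = 𝒳.r y) (h' : (orbitGroupoid H).s (OrbitSpace.mk G x) =
      (orbitGroupoid H).r (OrbitSpace.mk G y)) :
    (orbitGroupoid H).mul (OrbitSpace.mk G x) (OrbitSpace.mk G y) h' =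
      OrbitSpace.mk G (𝒳.mul x y h) := by
  have hex := H.exists_rep (OrbitSpace.mk G x) (OrbitSpace.mk G y) h'
  obtain ⟨hx, hy⟩ := hex.choose_spec
  change OrbitSpace.mk G (𝒳.mul hex.choose.1.1 hex.choose.1.2 hex.choose.2) = _
  generalize hex.choose = z at hx hy ⊢
  obtain ⟨⟨x', y'⟩, hz⟩ := z
  obtain ⟨t, rfl⟩ := OrbitSpace.mk_eq_mk.1 hx
  obtain ⟨u, rfl⟩ := OrbitSpace.mk_eq_mk.1 hy
  have htu : t = u := by
    have hz' : 𝒳.s (t • x) = 𝒳.r (u • y) := hz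
    rw [H.s_smul, H.r_smul, h] at hz'
    exact IsCancelSMul.right_cancel _ _ _ hz'
  subst htu
  exact (congrArg _ (H.mul_smul t x y h hz)).trans (OrbitSpace.mk_smul t _)

theorem orbitBundle_mul_mk [IsCancelSMul G X] (H : IsFellAction G 𝒜) {a b : A}
    (h : 𝒳.s (𝒜.proj a) = 𝒳.r (𝒜.proj b))
    (h' : (orbitGroupoid H.base).s ((orbitBundle H).proj (OrbitSpace.mk G a)) =
      (orbitGroupoid H.base).r ((orbitBundle H).proj (OrbitSpace.mk G b))) :
    (orbitBundle H).mul (OrbitSpace.mk G a) (OrbitSpace.mk G b) h' =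
      OrbitSpace.mk G (𝒜.mul a b h) := by
  have hex := H.exists_rep (OrbitSpace.mk G a) (OrbitSpace.mk G b) h'
  obtain ⟨ha, hb⟩ := hex.choose_spec
  change OrbitSpace.mk G (𝒜.mul hex.choose.1.1 hex.choose.1.2 hex.choose.2) = _
  generalize hex.choose = z at ha hb ⊢
  obtain ⟨⟨a', b'⟩, hz⟩ := z
  obtain ⟨t, rfl⟩ := OrbitSpace.mk_eq_mk.1 ha
  obtain ⟨u, rfl⟩ := OrbitSpace.mk_eq_mk.1 hb
  have htu : t = u := by
    have hz' : 𝒳.s (𝒜.proj (t • a)) = 𝒳.r (𝒜.proj (u • b)) := hz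
    rw [H.proj_smul, H.proj_smul, H.base.s_smul, H.base.r_smul, h] at hz'
    exact IsCancelSMul.right_cancel _ _ _ hz'
  subst htu
  exact (congrArg _ (H.mul_smul t a b h hz)).trans (OrbitSpace.mk_smul t _)

theorem exists_smul_mem_fibre (H : IsFellAction G 𝒜) (a : A) :
    ∃ t : G, 𝒜.proj (t • a) = (OrbitSpace.mk G (𝒜.proj a)).out := by
  obtain ⟨t, ht⟩ := OrbitSpace.mk_eq_mk.1 (OrbitSpace.mk_out (OrbitSpace.mk G (𝒜.proj a)))
  exact ⟨t, (H.proj_smul t a).trans ht⟩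

theorem orbitFibreEquiv_symm_mk [IsCancelSMul G X] (H : IsFellAction G 𝒜) {P : OrbitSpace G X}
    (Q : FibreOf (OrbitSpace.map 𝒜.proj H.proj_smul) P) (a : A) (h : OrbitSpace.mk G a = Q.1)
    (hp : 𝒜.proj a = P.out) : (orbitFibreEquiv H P).symm Q = ⟨a, hp⟩ :=
  (Equiv.symm_apply_eq _).2 (Subtype.ext h.symm)

theorem orbitBundle_nrm_mk [IsCancelSMul G X] (H : IsFellAction G 𝒜) (a : A) :
    (orbitBundle H).nrm (OrbitSpace.mk G a) = 𝒜.nrm a := by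
  obtain ⟨t, ht⟩ := exists_smul_mem_fibre H a
  rw [← H.nrm_smul t a]
  have h := orbitFibreEquiv_symm_mk H ((orbitBundle H).elt (OrbitSpace.mk G a)) (t • a)
    (OrbitSpace.mk_smul t a) ht
  exact (congrArg norm h).trans (𝒜.norm_val _)

theorem orbitBundle_smul_mk [IsCancelSMul G X] (H : IsFellAction G 𝒜) (c : ℂ) (a : A) :
    (orbitBundle H).smul c (OrbitSpace.mk G a) = OrbitSpace.mk G (𝒜.smul c a) := by
  obtain ⟨t, ht⟩ := exists_smul_mem_fibre H a
  have h := orbitFibreEquiv_symm_mk H ((orbitBundle H).elt (OrbitSpace.mk G a)) (t • a)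
    (OrbitSpace.mk_smul t a) ht
  rw [← OrbitSpace.mk_smul t (𝒜.smul c a), ← H.smul_smul]
  exact (congrArg (fun z => OrbitSpace.mk G (c • z).1) h).trans
    (congrArg (OrbitSpace.mk G) (𝒜.smul_val _ _))

theorem orbitBundle_add_mk [IsCancelSMul G X] (H : IsFellAction G 𝒜) (a b : A)
    (h : 𝒜.proj a = 𝒜.proj b)
    (h' : (orbitBundle H).proj (OrbitSpace.mk G a) = (orbitBundle H).proj (OrbitSpace.mk G b)) :
    (orbitBundle H).add (OrbitSpace.mk G a) (OrbitSpace.mk G b) h' =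
      OrbitSpace.mk G (𝒜.add a b h) := by
  obtain ⟨t, ht⟩ := exists_smul_mem_fibre H b
  have ht' : 𝒜.proj (t • a) = (OrbitSpace.mk G (𝒜.proj b)).out := by
    rw [← ht, H.proj_smul, H.proj_smul, h]
  have h₁ := orbitFibreEquiv_symm_mk H ((orbitBundle H).fib (OrbitSpace.mk G a) h') (t • a)
    (OrbitSpace.mk_smul t a) ht'
  have h₂ := orbitFibreEquiv_symm_mk H ((orbitBundle H).elt (OrbitSpace.mk G b)) (t • b)
    (OrbitSpace.mk_smul t b) ht
  rw [← OrbitSpace.mk_smul t (𝒜.add a b h), ← H.add_smul t a b h (ht'.trans ht.symm)]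
  exact (congrArg₂ (fun z w => OrbitSpace.mk G (z + w).1) h₁ h₂).trans
    (congrArg (OrbitSpace.mk G) (𝒜.add_val _ _))

end Constructions

/-! ### Actions of groupoids on spaces, and equivalence of groupoids -/

/-- The operations of a left action of a groupoid on `Ω`: the fibring map `ρ`, and `y · w`, which
is defined exactly when `s(y) = ρ(w)`. -/
structure LeftActionOps {Y : Type*} (𝒴 : GroupoidOps Y) (Ω : Type*) where
  ρ : Ω → Y
  act : (y : Y) → (w : Ω) → 𝒴.s y = ρ w → Ω

/-- The operations of a right action of a groupoid on `Ω`: the fibring map `σ`, and `w · z`, which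
is defined exactly when `σ(w) = r(z)`. -/
structure RightActionOps {Z : Type*} (𝒵 : GroupoidOps Z) (Ω : Type*) where
  σ : Ω → Z
  act : (w : Ω) → (z : Z) → σ w = 𝒵.r z → Ω

section

variable {Y Z Ω : Type*} [TopologicalSpace Y] [TopologicalSpace Z] [TopologicalSpace Ω]
  {𝒴 : GroupoidOps Y} {𝒵 : GroupoidOps Z}

/-- A free and proper continuous left action, with continuous and open fibring map. -/
structure LeftActionOps.IsFreeProper (𝓁 : LeftActionOps 𝒴 Ω) : Prop where
  isIdentity_ρ : ∀ w, 𝒴.IsIdentity (𝓁.ρ w)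
  continuous_ρ : Continuous 𝓁.ρ
  isOpenMap_ρ : IsOpenMap fun w => (⟨𝓁.ρ w, isIdentity_ρ w⟩ : 𝒴.UnitSpace)
  ρ_act : ∀ y w h, 𝓁.ρ (𝓁.act y w h) = 𝒴.r y
  unit_act : ∀ w h, 𝓁.act (𝓁.ρ w) w h = w
  mul_act : ∀ x y w hxy h h₁ h₂, 𝓁.act (𝒴.mul x y hxy) w h₁ = 𝓁.act x (𝓁.act y w h) h₂
  continuous_act : Continuous fun p : {p : Y × Ω // 𝒴.s p.1 = 𝓁.ρ p.2} =>
    𝓁.act p.1.1 p.1.2 p.2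
  free : ∀ y w h, 𝓁.act y w h = w → y = 𝓁.ρ w
  proper : IsProperMap fun p : {p : Y × Ω // 𝒴.s p.1 = 𝓁.ρ p.2} =>
    (𝓁.act p.1.1 p.1.2 p.2, p.1.2)

/-- A free and proper continuous right action, with continuous and open fibring map. -/
structure RightActionOps.IsFreeProper (𝓇 : RightActionOps 𝒵 Ω) : Prop where
  isIdentity_σ : ∀ w, 𝒵.IsIdentity (𝓇.σ w)
  continuous_σ : Continuous 𝓇.σ
  isOpenMap_σ : IsOpenMap fun w => (⟨𝓇.σ w, isIdentity_σ w⟩ : 𝒵.UnitSpace)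
  σ_act : ∀ w z h, 𝓇.σ (𝓇.act w z h) = 𝒵.s z
  act_unit : ∀ w h, 𝓇.act w (𝓇.σ w) h = w
  act_mul : ∀ w y z hyz h h₁ h₂, 𝓇.act w (𝒵.mul y z hyz) h₁ = 𝓇.act (𝓇.act w y h) z h₂
  continuous_act : Continuous fun p : {p : Ω × Z // 𝓇.σ p.1 = 𝒵.r p.2} =>
    𝓇.act p.1.1 p.1.2 p.2
  free : ∀ w z h, 𝓇.act w z h = w → z = 𝓇.σ w
  proper : IsProperMap fun p : {p : Ω × Z // 𝓇.σ p.1 = 𝒵.r p.2} =>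
    (p.1.1, 𝓇.act p.1.1 p.1.2 p.2)

/-- The orbit space of a left groupoid action, with the quotient topology. -/
abbrev LeftActionOps.Orbits (𝓁 : LeftActionOps 𝒴 Ω) : Type _ :=
  Quot fun w w' : Ω => ∃ y h, 𝓁.act y w h = w'

/-- The orbit space of a right groupoid action, with the quotient topology. -/
abbrev RightActionOps.Orbits (𝓇 : RightActionOps 𝒵 Ω) : Type _ :=
  Quot fun w w' : Ω => ∃ z h, 𝓇.act w z h = w'

/-- With the given actions, the space `Ω` is a `𝒴`--`𝒵` equivalence of groupoids. -/
structure IsGroupoidEquivalence (𝓁 : LeftActionOps 𝒴 Ω) (𝓇 : RightActionOps 𝒵 Ω) : Prop where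
  locallyCompact : LocallyCompactSpace Ω
  hausdorff : T2Space Ω
  secondCountable : SecondCountableTopology Ω
  left : 𝓁.IsFreeProper
  right : 𝓇.IsFreeProper
  ρ_act : ∀ w z h, 𝓁.ρ (𝓇.act w z h) = 𝓁.ρ w
  σ_act : ∀ y w h, 𝓇.σ (𝓁.act y w h) = 𝓇.σ w
  commute : ∀ y w z hl hr h₁ h₂, 𝓇.act (𝓁.act y w hl) z h₁ = 𝓁.act y (𝓇.act w z hr) h₂
  homeo_ρ : ∃ e : 𝓇.Orbits ≃ₜ 𝒴.UnitSpace, ∀ w, (e (Quot.mk _ w)).1 = 𝓁.ρ w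
  homeo_σ : ∃ e : 𝓁.Orbits ≃ₜ 𝒵.UnitSpace, ∀ w, (e (Quot.mk _ w)).1 = 𝓇.σ w

end

/-! ### Equivalence of Fell bundles -/

/-- The operations of an equivalence between Fell bundles `ℬ` over `𝒴` and `𝒞` over `𝒵`: a
Banach bundle `ℰ` over a space `Ω` on which `𝒴` and `𝒵` act, a left action of `ℬ` and a right
action of `𝒞` on `ℰ`, and a left and a right inner product, defined on `ℰ *_σ ℰ` and `ℰ *_ρ ℰ`
respectively. -/
structure FellEquivOps {Y Z Ω B C E : Type*} {𝒴 : GroupoidOps Y} {𝒵 : GroupoidOps Z}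
    (ℬ : FellOps 𝒴 B) (𝒞 : FellOps 𝒵 C) (ℰ : BanachFamily E Ω) where
  left : LeftActionOps 𝒴 Ω
  right : RightActionOps 𝒵 Ω
  smulL : (b : B) → (e : E) → 𝒴.s (ℬ.proj b) = left.ρ (ℰ.proj e) → E
  smulR : (e : E) → (c : C) → right.σ (ℰ.proj e) = 𝒵.r (𝒞.proj c) → E
  innerL : (e f : E) → right.σ (ℰ.proj e) = right.σ (ℰ.proj f) → B
  innerR : (e f : E) → left.ρ (ℰ.proj e) = left.ρ (ℰ.proj f) → C

namespace FellEquivOps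

variable {Y Z Ω B C E : Type*} [TopologicalSpace Y] [TopologicalSpace Z] [TopologicalSpace Ω]
  [TopologicalSpace B] [TopologicalSpace C] [TopologicalSpace E]
  {𝒴 : GroupoidOps Y} {𝒵 : GroupoidOps Z} {ℬ : FellOps 𝒴 B} {𝒞 : FellOps 𝒵 C}
  {ℰ : BanachFamily E Ω}

/-- The left action is a continuous action of the Fell bundle `ℬ` on the Banach bundle `ℰ`. -/
structure IsLeftAction (W : FellEquivOps ℬ 𝒞 ℰ) : Prop where
  proj_smul : ∀ b e h, ℰ.proj (W.smulL b e h) = W.left.act (ℬ.proj b) (ℰ.proj e) h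
  mul_smul : ∀ a b e hab h h₁ h₂,
    W.smulL (ℬ.mul a b hab) e h₁ = W.smulL a (W.smulL b e h) h₂
  nrm_smul_le : ∀ b e h, ℰ.nrm (W.smulL b e h) ≤ ℬ.nrm b * ℰ.nrm e
  add_smul : ∀ b b' e h h₁ h₂ h₃ h₄,
    W.smulL (ℬ.add b b' h) e h₁ = ℰ.add (W.smulL b e h₂) (W.smulL b' e h₃) h₄
  smul_add : ∀ b e e' h h₁ h₂ h₃ h₄,
    W.smulL b (ℰ.add e e' h) h₁ = ℰ.add (W.smulL b e h₂) (W.smulL b e' h₃) h₄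
  smul_smulL : ∀ k b e h h₁, W.smulL (ℬ.smul k b) e h₁ = ℰ.smul k (W.smulL b e h)
  smulL_smul : ∀ k b e h h₁, W.smulL b (ℰ.smul k e) h₁ = ℰ.smul k (W.smulL b e h)
  continuous_smul : Continuous
    fun p : {p : B × E // 𝒴.s (ℬ.proj p.1) = W.left.ρ (ℰ.proj p.2)} =>
      W.smulL p.1.1 p.1.2 p.2

/-- The right action is a continuous action of the Fell bundle `𝒞` on the Banach bundle `ℰ`. -/
structure IsRightAction (W : FellEquivOps ℬ 𝒞 ℰ) : Prop where
  proj_smul : ∀ e c h, ℰ.proj (W.smulR e c h) = W.right.act (ℰ.proj e) (𝒞.proj c) h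
  smul_mul : ∀ e c d hcd h h₁ h₂,
    W.smulR e (𝒞.mul c d hcd) h₁ = W.smulR (W.smulR e c h) d h₂
  nrm_smul_le : ∀ e c h, ℰ.nrm (W.smulR e c h) ≤ ℰ.nrm e * 𝒞.nrm c
  smul_add : ∀ e c c' h h₁ h₂ h₃ h₄,
    W.smulR e (𝒞.add c c' h) h₁ = ℰ.add (W.smulR e c h₂) (W.smulR e c' h₃) h₄
  add_smul : ∀ e e' c h h₁ h₂ h₃ h₄,
    W.smulR (ℰ.add e e' h) c h₁ = ℰ.add (W.smulR e c h₂) (W.smulR e' c h₃) h₄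
  smulR_smul : ∀ k e c h h₁, W.smulR e (𝒞.smul k c) h₁ = ℰ.smul k (W.smulR e c h)
  smul_smulR : ∀ k e c h h₁, W.smulR (ℰ.smul k e) c h₁ = ℰ.smul k (W.smulR e c h)
  continuous_smul : Continuous
    fun p : {p : E × C // W.right.σ (ℰ.proj p.1) = 𝒵.r (𝒞.proj p.2)} =>
      W.smulR p.1.1 p.1.2 p.2

/-- All axioms of an equivalence of Fell bundles except that the fibres are imprimitivity
bimodules.  The fields `act_proj_innerL` and `act_proj_innerR` say that the inner product of
`e` and `f` lies over the unique `y` with `q(e) = y · q(f)`, respectively over the unique `z`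
with `q(e) · z = q(f)`, where `q : ℰ → Ω` is the projection. -/
structure IsPreEquivalence (W : FellEquivOps ℬ 𝒞 ℰ) : Prop where
  left_isFellBundle : IsFellBundle ℬ
  right_isFellBundle : IsFellBundle 𝒞
  isBanachBundle : ℰ.IsBanachBundle
  isSeparable : ℰ.IsSeparable
  base : IsGroupoidEquivalence W.left W.right
  isLeftAction : W.IsLeftAction
  isRightAction : W.IsRightAction
  commute : ∀ b e c hl hr h₁ h₂,
    W.smulR (W.smulL b e hl) c h₁ = W.smulL b (W.smulR e c hr) h₂
  add_innerL : ∀ e e' f h h₁ h₂ h₃ h₄,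
    W.innerL (ℰ.add e e' h) f h₁ = ℬ.add (W.innerL e f h₂) (W.innerL e' f h₃) h₄
  innerL_add : ∀ e f f' h h₁ h₂ h₃ h₄,
    W.innerL e (ℰ.add f f' h) h₁ = ℬ.add (W.innerL e f h₂) (W.innerL e f' h₃) h₄
  smul_innerL : ∀ k e f h h₁, W.innerL (ℰ.smul k e) f h₁ = ℬ.smul k (W.innerL e f h)
  innerL_smul : ∀ k e f h h₁, W.innerL e (ℰ.smul k f) h₁ = ℬ.smul (star k) (W.innerL e f h)
  add_innerR : ∀ e e' f h h₁ h₂ h₃ h₄,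
    W.innerR (ℰ.add e e' h) f h₁ = 𝒞.add (W.innerR e f h₂) (W.innerR e' f h₃) h₄
  innerR_add : ∀ e f f' h h₁ h₂ h₃ h₄,
    W.innerR e (ℰ.add f f' h) h₁ = 𝒞.add (W.innerR e f h₂) (W.innerR e f' h₃) h₄
  smul_innerR : ∀ k e f h h₁, W.innerR (ℰ.smul k e) f h₁ = 𝒞.smul (star k) (W.innerR e f h)
  innerR_smul : ∀ k e f h h₁, W.innerR e (ℰ.smul k f) h₁ = 𝒞.smul k (W.innerR e f h)
  continuous_innerL : Continuous
    fun p : {p : E × E // W.right.σ (ℰ.proj p.1) = W.right.σ (ℰ.proj p.2)} =>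
      W.innerL p.1.1 p.1.2 p.2
  continuous_innerR : Continuous
    fun p : {p : E × E // W.left.ρ (ℰ.proj p.1) = W.left.ρ (ℰ.proj p.2)} =>
      W.innerR p.1.1 p.1.2 p.2
  act_proj_innerL : ∀ e f h, ∃ h₁,
    W.left.act (ℬ.proj (W.innerL e f h)) (ℰ.proj f) h₁ = ℰ.proj e
  act_proj_innerR : ∀ e f h, ∃ h₁,
    W.right.act (ℰ.proj e) (𝒞.proj (W.innerR e f h)) h₁ = ℰ.proj f
  adj_innerL : ∀ e f h, ℬ.adj (W.innerL e f h) = W.innerL f e h.symm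
  adj_innerR : ∀ e f h, 𝒞.adj (W.innerR e f h) = W.innerR f e h.symm
  mul_innerL : ∀ b e f hb hef, ∃ h₁ h₂,
    W.innerL (W.smulL b e hb) f h₁ = ℬ.mul b (W.innerL e f hef) h₂
  innerR_mul : ∀ e f c hc hef, ∃ h₁ h₂,
    W.innerR e (W.smulR f c hc) h₁ = 𝒞.mul (W.innerR e f hef) c h₂
  compat : ∀ e f g hef hfg, ∃ h₁ h₂,
    W.smulL (W.innerL e f hef) g h₁ = W.smulR e (W.innerR f g hfg) h₂

namespace IsPreEquivalence

variable {W : FellEquivOps ℬ 𝒞 ℰ}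

/-- The left action `B(ρ(w)) × E(w) → E(w)`. -/
def fsmulL (H : W.IsPreEquivalence) (w : Ω) (b : ℬ.Fibre (W.left.ρ w)) (e : ℰ.Fibre w) :
    ℰ.Fibre w :=
  ⟨W.smulL b.1 e.1 (by rw [b.2, e.2]; exact (H.base.left.isIdentity_ρ w).2), by
    rw [H.isLeftAction.proj_smul]
    obtain ⟨e, rfl⟩ := e
    obtain ⟨b, hb⟩ := b
    have h : ∀ y (hy : y = W.left.ρ (ℰ.proj e)) h, W.left.act y (ℰ.proj e) h = ℰ.proj e := by
      rintro _ rfl h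
      exact H.base.left.unit_act _ _
    exact h _ hb _⟩

/-- The right action `E(w) × C(σ(w)) → E(w)`. -/
def fsmulR (H : W.IsPreEquivalence) (w : Ω) (e : ℰ.Fibre w) (c : 𝒞.Fibre (W.right.σ w)) :
    ℰ.Fibre w :=
  ⟨W.smulR e.1 c.1 (by rw [c.2, e.2]; exact (H.base.right.isIdentity_σ w).1.symm), by
    rw [H.isRightAction.proj_smul]
    obtain ⟨e, rfl⟩ := e
    obtain ⟨c, hc⟩ := c
    have h : ∀ z (hz : z = W.right.σ (ℰ.proj e)) h, W.right.act (ℰ.proj e) z h = ℰ.proj e := by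
      rintro _ rfl h
      exact H.base.right.act_unit _ _
    exact h _ hc _⟩

/-- The left inner product `E(w) × E(w) → B(ρ(w))`. -/
def finnerL (H : W.IsPreEquivalence) (w : Ω) (e f : ℰ.Fibre w) : ℬ.Fibre (W.left.ρ w) :=
  ⟨W.innerL e.1 f.1 (by rw [e.2, f.2]), by
    obtain ⟨h, h'⟩ := H.act_proj_innerL e.1 f.1 (by rw [e.2, f.2])
    have := H.base.left.free _ _ h (h'.trans (e.2.trans f.2.symm))
    rw [this, f.2]⟩

/-- The right inner product `E(w) × E(w) → C(σ(w))`. -/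
def finnerR (H : W.IsPreEquivalence) (w : Ω) (e f : ℰ.Fibre w) : 𝒞.Fibre (W.right.σ w) :=
  ⟨W.innerR e.1 f.1 (by rw [e.2, f.2]), by
    obtain ⟨h, h'⟩ := H.act_proj_innerR e.1 f.1 (by rw [e.2, f.2])
    have := H.base.right.free _ _ h (h'.trans (f.2.trans e.2.symm))
    rw [this, e.2]⟩

/-- The fibre `E(w)` is a `B(ρ(w))`--`C(σ(w))` imprimitivity bimodule. -/
def FibreImprimitivity (H : W.IsPreEquivalence) (w : Ω) : Prop :=
  letI := H.left_isFellBundle.cstar (H.base.left.isIdentity_ρ w)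
  letI := H.right_isFellBundle.cstar (H.base.right.isIdentity_σ w)
  IsImprimitivityBimodule (ℬ.Fibre (W.left.ρ w)) (ℰ.Fibre w) (𝒞.Fibre (W.right.σ w))
    (H.fsmulL w) (H.fsmulR w) (H.finnerL w) (H.finnerR w)

end IsPreEquivalence

/-- With the given operations, the Banach bundle `ℰ` is a `ℬ`--`𝒞` equivalence of Fell
bundles. -/
structure IsFellEquivalence (W : FellEquivOps ℬ 𝒞 ℰ) : Prop extends W.IsPreEquivalence where
  fibreImprimitivity : ∀ w, toIsPreEquivalence.FibreImprimitivity w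

end FellEquivOps

end FellBundles

end

namespace FellBundles

/-! ### Topology of orbit spaces and of continuous lifting along orbits. -/

section

/-! For a free and proper action the map (t, x) ↦ (t·x, x) is a closed embedding, and the topology
of the construction rests on this. The element t with x = t·y is a continuous function of the pair
(x, y) in one orbit (`continuous_orbitDiv`). Hence, for an equivariant map π : Y → X, an orbit Q in
Y and a point x whose orbit is the image of Q determine exactly one representative of Q above x, and
it depends continuously on (x, Q) (`continuous_orbitLift`). Composable orbits therefore have
composable representatives, unique up to a common translation, and every algebraic identity in G\𝒳
or G\𝒜 is the image of the same identity in 𝒳 or 𝒜.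

The formulas of the equivalence are products in disguise: a(t·b) is the first component of (a, t)(b,
1) in 𝒜 ⋊ G, the left inner product is (a, t)(b, 1)*, and the right inner product is the orbit of
a*b. The required identities thus come down to associativity, the laws of the involution, and the
fact that G acts by automorphisms. On the base, (z, w) ↦ (z·w, w) is a homeomorphism onto the closed
set of pairs with sources in one G-orbit, and (w, z) ↦ (w, w·z) is one onto the closed set of pairs
with equal range; this gives properness. The fibring maps are open because a Haar system forces the
range map to be open (`isOpenMap_rUnit`), which is all that the equivalence needs from the Haar
system.

Fibrewise nothing new occurs. Each fibre of the three bundles is a fibre A(x) whose coefficient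
algebras are renamed along isometric *-isomorphisms, so `IsImprimitivityBimodule.transport` carries
the bimodule structure over. The inequality ‖ab‖ ≤ ‖a‖‖b‖ for arbitrary composable a and b is
deduced from these bimodules (`nrm_mul_le_mul`). Separability is obtained by sorting sections into
countably many classes of small diameter, through their slices at elements of G in one case and
through cut-off equivariant lifts in the other.

For Haar systems, left invariance is rephrased as an equality of image measures (`map_leftMul`).
Left translation by (x, t) is the product of y ↦ x(t·y) and u ↦ tu, while translation by G·x is
induced by translation by x. Local finiteness and continuity on the orbit groupoid come from a
compactness statement: arrows with range in a compact set and orbit in a compact set lie in a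
compact set (`exists_isCompact_of_apply_mem_of_mk_mem`). -/

theorem _root_.IsOpenQuotientMap.continuous_of_comp_subtype {X Y W : Type*} [TopologicalSpace X]
    [TopologicalSpace Y] [TopologicalSpace W] {q : X → Y} (hq : IsOpenQuotientMap q)
    {S : Y → Prop} {f : {y // S y} → W}
    (hf : Continuous fun x : {x // S (q x)} => f ⟨q x.1, x.2⟩) : Continuous f :=
  -- Openness matters here: an open quotient map restricts to a quotient map over any subset of the
  -- target, which a general quotient map need not do.
  (hq.restrictPreimage {y | S y}).continuous_comp_iff.1 hf

namespace OrbitSpace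

variable {G X Y : Type*} [Group G] [MulAction G X] [MulAction G Y]

theorem mk_surjective : Function.Surjective (mk G : X → _) := fun P => ⟨P.out, P.mk_out⟩

variable [TopologicalSpace X] [TopologicalSpace Y]

theorem isOpenQuotientMap_mk [ContinuousConstSMul G X] : IsOpenQuotientMap (mk G : X → _) :=
  MulAction.isOpenQuotientMap_quotientMk

theorem continuous_mk : Continuous (mk G : X → _) := continuous_quotient_mk'

theorem continuous_map {f : X → Y} (hf : ∀ (t : G) x, f (t • x) = t • f x)
    (hc : Continuous f) : Continuous (map f hf) :=
  continuous_quot_lift _ (continuous_mk.comp hc)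

theorem isOpenMap_map [ContinuousConstSMul G Y] {f : X → Y} (hf : ∀ (t : G) x, f (t • x) = t • f x)
    (ho : IsOpenMap f) : IsOpenMap (map f hf) := by
  intro U hU
  have h : map f hf '' U = mk G '' (f '' (mk G ⁻¹' U)) := by
    ext P
    constructor
    · rintro ⟨Q, hQ, rfl⟩
      obtain ⟨x, rfl⟩ := mk_surjective Q
      exact ⟨f x, ⟨x, hQ, rfl⟩, rfl⟩
    · rintro ⟨_, ⟨x, hx, rfl⟩, rfl⟩
      exact ⟨mk G x, hx, rfl⟩
  rw [h]
  exact isOpenQuotientMap_mk.isOpenMap _ (ho _ (hU.preimage continuous_mk))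

/-- The orbit map is open, so images of compact neighbourhoods are neighbourhoods in the orbit
space, and finitely many of them cover K. -/
theorem exists_isCompact_image [ContinuousConstSMul G X] [LocallyCompactSpace X]
    {K : Set (OrbitSpace G X)} (hK : IsCompact K) :
    ∃ L : Set X, IsCompact L ∧ K ⊆ mk G '' L := by
  choose N hN hN' using fun x : X => exists_compact_mem_nhds x
  obtain ⟨s, -, hs⟩ := hK.elim_nhds_subcover (fun P => mk G '' N P.out) fun P _ => by
    have h := isOpenQuotientMap_mk (G := G).isOpenMap.image_mem_nhds (hN' P.out)
    rwa [P.mk_out] at h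
  refine ⟨⋃ P ∈ s, N P.out, s.isCompact_biUnion fun P _ => hN _, hs.trans ?_⟩
  simp only [Set.image_iUnion]
  exact subset_rfl

variable [TopologicalSpace G] [ProperSMul G X]

instance [LocallyCompactSpace X] : LocallyCompactSpace (OrbitSpace G X) :=
  (isOpenQuotientMap_mk (G := G) (X := X)).locallyCompactSpace

instance : T2Space (OrbitSpace G X) :=
  inferInstanceAs (T2Space (Quotient (MulAction.orbitRel G X)))

instance [SecondCountableTopology X] : SecondCountableTopology (OrbitSpace G X) :=
  (isOpenQuotientMap_mk (G := G) (X := X)).isQuotientMap.secondCountableTopology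
    isOpenQuotientMap_mk.isOpenMap

end OrbitSpace

/-! ### The group element that moves one point of an orbit to another -/

section OrbitDiv

variable {G X : Type*} [Group G] [MulAction G X]

/-- An element `t` of `G` with `x = t • y`. -/
noncomputable def orbitDiv (x y : X) (h : OrbitSpace.mk G x = OrbitSpace.mk G y) : G :=
  (OrbitSpace.mk_eq_mk.1 h).choose

theorem orbitDiv_smul (x y : X) (h : OrbitSpace.mk G x = OrbitSpace.mk G y) :
    orbitDiv x y h • y = x :=
  (OrbitSpace.mk_eq_mk.1 h).choose_spec

variable [IsCancelSMul G X]

theorem orbitDiv_eq {x y : X} (h : OrbitSpace.mk G x = OrbitSpace.mk G y) {t : G}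
    (ht : t • y = x) : orbitDiv x y h = t :=
  IsCancelSMul.right_cancel _ _ _ ((orbitDiv_smul x y h).trans ht.symm)

variable [TopologicalSpace G] [TopologicalSpace X] [ProperSMul G X]

/-- Properness of the action makes the map closed, and freeness makes it injective. -/
theorem isClosedEmbedding_smul_pair :
    IsClosedEmbedding fun z : G × X => (z.1 • z.2, z.2) := by
  have h : IsProperMap fun z : G × X => (z.1 • z.2, z.2) := ProperSMul.isProperMap_smul_pair
  refine .of_continuous_injective_isClosedMap h.continuous ?_ h.isClosedMap
  rintro ⟨t, x⟩ ⟨u, y⟩ hz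
  obtain ⟨h₁, rfl⟩ := Prod.ext_iff.1 hz
  exact Prod.ext (IsCancelSMul.right_cancel _ _ _ h₁) rfl

/-- The pair (t, y) with x = t·y is the unique preimage of (x, y) under the closed embedding (t, y)
↦ (t·y, y), so it inherits continuity from (x, y). -/
theorem continuous_orbitDiv {Z : Type*} [TopologicalSpace Z] {f g : Z → X} (hf : Continuous f)
    (hg : Continuous g) (h : ∀ z, OrbitSpace.mk G (f z) = OrbitSpace.mk G (g z)) :
    Continuous fun z => orbitDiv (f z) (g z) (h z) := by
  have hc : Continuous fun z => (orbitDiv (f z) (g z) (h z), g z) := by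
    rw [isClosedEmbedding_smul_pair.isInducing.continuous_iff]
    exact (hf.prodMk hg).congr fun z => by simp [orbitDiv_smul]
  exact hc.fst

end OrbitDiv

/-! ### Lifting orbits along equivariant maps -/

section OrbitLift

variable {G X Y : Type*} [Group G] [MulAction G X] [MulAction G Y] {π : Y → X}
  (hπ : ∀ (t : G) y, π (t • y) = t • π y)

include hπ in
theorem exists_orbitLift {x : X} {Q : OrbitSpace G Y}
    (h : OrbitSpace.mk G x = OrbitSpace.map π hπ Q) : ∃ y, π y = x ∧ OrbitSpace.mk G y = Q := by
  obtain ⟨y, rfl⟩ := OrbitSpace.mk_surjective Q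
  obtain ⟨t, ht⟩ := OrbitSpace.mk_eq_mk.1 h
  exact ⟨t • y, by rw [hπ, ht], OrbitSpace.mk_smul t y⟩

/-- A representative of an orbit in `Y` that lies over a given point of `X`. -/
noncomputable def orbitLift (x : X) (Q : OrbitSpace G Y)
    (h : OrbitSpace.mk G x = OrbitSpace.map π hπ Q) : Y :=
  (exists_orbitLift hπ h).choose

variable {x : X} {Q : OrbitSpace G Y} (h : OrbitSpace.mk G x = OrbitSpace.map π hπ Q)

theorem apply_orbitLift : π (orbitLift hπ x Q h) = x := (exists_orbitLift hπ h).choose_spec.1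

theorem mk_orbitLift : OrbitSpace.mk G (orbitLift hπ x Q h) = Q :=
  (exists_orbitLift hπ h).choose_spec.2

variable [IsCancelSMul G X]

include hπ in
-- A group element relating the two points fixes their common image in X, so it is trivial by
-- freeness. The action on Y itself is not assumed free.
theorem eq_of_mk_eq_of_apply_eq {y y' : Y} (h : OrbitSpace.mk G y = OrbitSpace.mk G y')
    (hy : π y = π y') : y = y' := by
  obtain ⟨t, rfl⟩ := OrbitSpace.mk_eq_mk.1 h
  have ht : t = 1 := IsCancelSMul.right_cancel _ _ (π y') (by rw [← hπ, hy, one_smul])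
  rw [ht, one_smul]

theorem orbitLift_eq {y : Y} (hQ : OrbitSpace.mk G y = Q) (hy : π y = x) :
    orbitLift hπ x Q h = y :=
  eq_of_mk_eq_of_apply_eq hπ ((mk_orbitLift hπ h).trans hQ.symm)
    ((apply_orbitLift hπ h).trans hy.symm)

theorem continuous_orbitLift [TopologicalSpace G] [TopologicalSpace X] [TopologicalSpace Y]
    [ProperSMul G X] [ContinuousSMul G Y] (hc : Continuous π) {Z : Type*} [TopologicalSpace Z]
    {f : Z → X} {q : Z → OrbitSpace G Y} (hf : Continuous f) (hq : Continuous q)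
    (h : ∀ z, OrbitSpace.mk G (f z) = OrbitSpace.map π hπ (q z)) :
    Continuous fun z => orbitLift hπ (f z) (q z) (h z) := by
  suffices hu : Continuous fun p : {p : X × OrbitSpace G Y //
      OrbitSpace.mk G p.1 = OrbitSpace.map π hπ p.2} => orbitLift hπ p.1.1 p.1.2 p.2 from
    hu.comp ((hf.prodMk hq).subtype_mk h)
  -- After replacing the orbit by a point y in it, the lift has an explicit formula: translate y by
  -- the element that carries π(y) to x.
  refine (IsOpenQuotientMap.id.prodMap (OrbitSpace.isOpenQuotientMap_mk (G := G)
    (X := Y))).continuous_of_comp_subtype (S := fun p => OrbitSpace.mk G p.1 =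
      OrbitSpace.map π hπ p.2) ?_
  set Z' := {z : X × Y // OrbitSpace.mk G z.1 = OrbitSpace.mk G (π z.2)}
  have h₁ : Continuous fun z : Z' => z.1.1 := continuous_fst.comp continuous_subtype_val
  have h₂ : Continuous fun z : Z' => z.1.2 := continuous_snd.comp continuous_subtype_val
  exact ((continuous_orbitDiv h₁ (hc.comp h₂) fun z => z.2).smul h₂).congr fun z =>
    (orbitLift_eq hπ z.2 (OrbitSpace.mk_smul _ _) (by rw [hπ]; exact orbitDiv_smul _ _ _)).symm

end OrbitLift

end

/-! ### Cancellation in groupoids and openness of the range map. -/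

section

namespace GroupoidOps.IsLCGroupoid

variable {X : Type*} [TopologicalSpace X] {𝒳 : GroupoidOps X} (h : 𝒳.IsLCGroupoid)
include h

theorem s_r (x : X) : 𝒳.s (𝒳.r x) = 𝒳.r x := (h.isIdentity_r x).2
theorem r_s (x : X) : 𝒳.r (𝒳.s x) = 𝒳.s x := (h.isIdentity_s x).1
theorem s_s (x : X) : 𝒳.s (𝒳.s x) = 𝒳.s x := (h.isIdentity_s x).2

theorem unit_mul {u x : X} (hu : 𝒳.r x = u) (hx : 𝒳.s u = 𝒳.r x) : 𝒳.mul u x hx = x := by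
  subst hu
  exact h.r_mul_self x _

theorem mul_unit {u x : X} (hu : 𝒳.s x = u) (hx : 𝒳.s x = 𝒳.r u) : 𝒳.mul x u hx = x := by
  subst hu
  exact h.mul_s_self x _

theorem inv_mul_cancel_left {x y : X} (hxy : 𝒳.s x = 𝒳.r y)
    (h' : 𝒳.s (𝒳.inv x) = 𝒳.r (𝒳.mul x y hxy)) :
    𝒳.mul (𝒳.inv x) (𝒳.mul x y hxy) h' = y := by
  have h₁ : 𝒳.s (𝒳.inv x) = 𝒳.r x := h.s_inv x
  have h₂ : 𝒳.s (𝒳.mul (𝒳.inv x) x h₁) = 𝒳.r y := by rw [h.s_mul, hxy]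
  rw [← h.mul_assoc _ _ _ h₁ hxy h₂ h']
  exact h.unit_mul (by rw [h.inv_mul, hxy]) _

theorem mul_inv_cancel_left {x y : X} (hxy : 𝒳.s (𝒳.inv x) = 𝒳.r y)
    (h' : 𝒳.s x = 𝒳.r (𝒳.mul (𝒳.inv x) y hxy)) :
    𝒳.mul x (𝒳.mul (𝒳.inv x) y hxy) h' = y := by
  have h₁ : 𝒳.s x = 𝒳.r (𝒳.inv x) := (h.r_inv x).symm
  have h₂ : 𝒳.s (𝒳.mul x (𝒳.inv x) h₁) = 𝒳.r y := by rw [h.s_mul, hxy]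
  rw [← h.mul_assoc _ _ _ h₁ hxy h₂ h']
  exact h.unit_mul (by rw [h.mul_inv, ← hxy, h.s_inv]) _

theorem mul_inv_cancel_right {x y : X} (hxy : 𝒳.s x = 𝒳.r y)
    (h' : 𝒳.s (𝒳.mul x y hxy) = 𝒳.r (𝒳.inv y)) :
    𝒳.mul (𝒳.mul x y hxy) (𝒳.inv y) h' = x := by
  have h₁ : 𝒳.s y = 𝒳.r (𝒳.inv y) := (h.r_inv y).symm
  have h₂ : 𝒳.s x = 𝒳.r (𝒳.mul y (𝒳.inv y) h₁) := by rw [h.r_mul, hxy]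
  rw [h.mul_assoc _ _ _ hxy h₁ h' h₂]
  exact h.mul_unit (by rw [h.mul_inv, hxy]) _

theorem inv_mul_cancel_right {x y : X} (hxy : 𝒳.s x = 𝒳.r (𝒳.inv y))
    (h' : 𝒳.s (𝒳.mul x (𝒳.inv y) hxy) = 𝒳.r y) :
    𝒳.mul (𝒳.mul x (𝒳.inv y) hxy) y h' = x := by
  have h₁ : 𝒳.s (𝒳.inv y) = 𝒳.r y := h.s_inv y
  have h₂ : 𝒳.s x = 𝒳.r (𝒳.mul (𝒳.inv y) y h₁) := by rw [h.r_mul, hxy]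
  rw [h.mul_assoc _ _ _ hxy h₁ h' h₂]
  exact h.mul_unit (by rw [h.inv_mul, hxy, h.r_inv]) _

theorem inv_inv (x : X) : 𝒳.inv (𝒳.inv x) = x := by
  have h₁ : 𝒳.s x = 𝒳.r (𝒳.inv x) := (h.r_inv x).symm
  have h₂ : 𝒳.s (𝒳.mul x (𝒳.inv x) h₁) = 𝒳.r (𝒳.inv (𝒳.inv x)) := by rw [h.s_mul, h.r_inv]
  exact (h.unit_mul (by rw [h.mul_inv, h.r_inv, h.s_inv]) h₂).symm.trans
    (h.mul_inv_cancel_right h₁ h₂)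

theorem eq_unit_of_mul_eq {x y : X} (hxy : 𝒳.s x = 𝒳.r y) (hm : 𝒳.mul x y hxy = y) :
    x = 𝒳.r y := by
  have h₂ : 𝒳.s (𝒳.mul x y hxy) = 𝒳.r (𝒳.inv y) := by rw [h.s_mul, h.r_inv]
  rw [← h.mul_inv_cancel_right hxy h₂, ← h.mul_inv y (h.r_inv y).symm]
  exact 𝒳.mul_congr hm rfl _ _

theorem eq_unit_of_mul_eq' {x y : X} (hxy : 𝒳.s x = 𝒳.r y) (hm : 𝒳.mul x y hxy = x) :
    y = 𝒳.s x := by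
  have h₂ : 𝒳.s (𝒳.inv x) = 𝒳.r (𝒳.mul x y hxy) := by rw [h.s_inv, h.r_mul]
  rw [← h.inv_mul_cancel_left hxy h₂, ← h.inv_mul x (h.s_inv x)]
  exact 𝒳.mul_congr rfl hm _ _

theorem continuous_mul' {Z : Type*} [TopologicalSpace Z] {f g : Z → X} (hf : Continuous f)
    (hg : Continuous g) (hfg : ∀ z, 𝒳.s (f z) = 𝒳.r (g z)) :
    Continuous fun z => 𝒳.mul (f z) (g z) (hfg z) :=
  h.continuous_mul.comp ((hf.prodMk hg).subtype_mk hfg)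

/-- The range map onto the unit space. -/
def rUnit (x : X) : 𝒳.UnitSpace := ⟨𝒳.r x, h.isIdentity_r x⟩

/-- The source map onto the unit space. -/
def sUnit (x : X) : 𝒳.UnitSpace := ⟨𝒳.s x, h.isIdentity_s x⟩

theorem continuous_rUnit : Continuous h.rUnit := h.continuous_r.subtype_mk _

theorem rUnit_surjective : Function.Surjective h.rUnit := fun u => ⟨u.1, Subtype.ext u.2.1⟩

/-- The inverse, as a homeomorphism. -/
def invHomeomorph : X ≃ₜ X where
  toFun := 𝒳.inv
  invFun := 𝒳.inv
  left_inv := h.inv_inv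
  right_inv := h.inv_inv
  continuous_toFun := h.continuous_inv
  continuous_invFun := h.continuous_inv

/-- Take a bump function f at x supported in a small open set V. Its integral is positive at r(x),
hence at all nearby units v by continuity, and a positive integral at v forces V to meet the fibre
of r over v. -/
theorem isOpenMap_rUnit [MeasurableSpace X] [BorelSpace X] {lam : X → Measure X}
    (hlam : 𝒳.IsHaarSystem lam) : IsOpenMap h.rUnit := by
  have := h.locallyCompact
  have := h.hausdorff
  rw [isOpenMap_iff_nhds_le]
  intro x U hU
  obtain ⟨V, hVU, hV, hxV⟩ := mem_nhds_iff.1 (mem_map.1 hU)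
  obtain ⟨f, hf₁, hfK, hfV, hf₀⟩ := exists_continuousMap_one_of_isCompact_subset_isOpen
    (isCompact_singleton (x := x)) hV (Set.singleton_subset_iff.2 hxV)
  have := hlam.finite_of_compact _ (h.rUnit x).2
  have hpos : 0 < ∫ y, f y ∂(lam (h.rUnit x).1) := by
    refine (integral_pos_iff_support_of_nonneg (fun y => (hf₀ y).1)
      (f.continuous.integrable_of_hasCompactSupport hfK)).2 ?_
    refine hlam.pos_of_open _ (h.rUnit x).2 _ f.continuous.isOpen_support ⟨x, ?_, rfl⟩
    simp [hf₁ rfl]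
  filter_upwards [(hlam.continuous_integral f f.continuous hfK).continuousAt.eventually
    (lt_mem_nhds hpos)] with v hv
  by_contra hvU
  -- If v is not in U, no arrow with range v lies in V, so f vanishes almost everywhere for the
  -- measure at v.
  refine hv.ne' (integral_eq_zero_of_ae ?_)
  have hnull := hlam.null_compl _ v.2
  filter_upwards [compl_mem_ae_iff.2 hnull] with y hy
  have hy' : 𝒳.r y = v.1 := not_not.1 hy
  refine image_eq_zero_of_notMem_tsupport fun hyf => hvU ?_
  have hyU : h.rUnit y ∈ U := hVU (hfV hyf)
  rwa [show h.rUnit y = v from Subtype.ext hy'] at hyU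

theorem isOpenMap_sUnit (hr : IsOpenMap h.rUnit) : IsOpenMap h.sUnit := by
  have : h.sUnit = h.rUnit ∘ h.invHomeomorph := funext fun x => Subtype.ext (h.r_inv x).symm
  rw [this]
  exact hr.comp h.invHomeomorph.isOpenMap

end GroupoidOps.IsLCGroupoid

end

/-! ### The semidirect-product groupoid and the orbit groupoid. -/

section

section Semidirect

variable {G X : Type*} [Group G] [MulAction G X] [TopologicalSpace G] [TopologicalSpace X]
  {𝒳 : GroupoidOps X}

theorem IsGroupoidAction.isIdentity_smul (H : IsGroupoidAction G 𝒳) (t : G) {u : X}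
    (hu : 𝒳.IsIdentity u) : 𝒳.IsIdentity (t • u) :=
  ⟨by rw [H.r_smul, hu.1], by rw [H.s_smul, hu.2]⟩

theorem semidirectGroupoid_isIdentity (H : IsGroupoidAction G 𝒳) {z : X × G} :
    (semidirectGroupoid H).IsIdentity z ↔ 𝒳.IsIdentity z.1 ∧ z.2 = 1 := by
  obtain ⟨x, t⟩ := z
  constructor
  · rintro ⟨h₁, h₂⟩
    obtain rfl : 1 = t := congrArg Prod.snd h₁
    have h₃ : 𝒳.r x = x := congrArg Prod.fst h₁
    have h₄ : (1 : G)⁻¹ • 𝒳.s x = x := congrArg Prod.fst h₂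
    exact ⟨⟨h₃, by simpa using h₄⟩, rfl⟩
  · rintro ⟨h, rfl⟩
    exact ⟨Prod.ext h.1 rfl, Prod.ext (by simpa [semidirectGroupoid] using h.2) rfl⟩

variable [IsTopologicalGroup G] [LocallyCompactSpace G] [T2Space G] [SecondCountableTopology G]

theorem semidirectGroupoid_isLCGroupoid (H : IsGroupoidAction G 𝒳) (h : 𝒳.IsLCGroupoid) :
    (semidirectGroupoid H).IsLCGroupoid where
  locallyCompact := have := h.locallyCompact; inferInstance
  hausdorff := have := h.hausdorff; inferInstance
  secondCountable := have := h.secondCountable; inferInstance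
  isIdentity_r z := (semidirectGroupoid_isIdentity H).2 ⟨h.isIdentity_r _, rfl⟩
  isIdentity_s z := (semidirectGroupoid_isIdentity H).2
    ⟨H.isIdentity_smul _ (h.isIdentity_s _), rfl⟩
  r_mul z w hzw := Prod.ext (h.r_mul _ _ _) rfl
  s_mul z w hzw := Prod.ext (by
    change (z.2 * w.2)⁻¹ • 𝒳.s (𝒳.mul z.1 (z.2 • w.1) _) = w.2⁻¹ • 𝒳.s w.1
    rw [h.s_mul, H.s_smul, mul_inv_rev, mul_smul, inv_smul_smul]) rfl
  mul_assoc x y z hxy hyz h₁ h₂ := by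
    refine Prod.ext ?_ (mul_assoc _ _ _)
    change 𝒳.mul (𝒳.mul x.1 (x.2 • y.1) _) ((x.2 * y.2) • z.1) _ =
      𝒳.mul x.1 (x.2 • 𝒳.mul y.1 (y.2 • z.1) _) _
    have h₃ := H.comp_smul hyz
    have h₄ : 𝒳.s (x.2 • y.1) = 𝒳.r (x.2 • y.2 • z.1) := by rw [H.s_smul, h₃, H.r_smul x.2]
    simp only [← H.mul_smul x.2 _ _ h₃ h₄, mul_smul]
    exact h.mul_assoc _ _ _ _ _ _ _
  r_mul_self z hz := Prod.ext (by
    change 𝒳.mul (𝒳.r z.1) ((1 : G) • z.1) _ = z.1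
    simp only [one_smul]
    exact h.r_mul_self _ _) (one_mul _)
  mul_s_self z hz := Prod.ext (by
    change 𝒳.mul z.1 (z.2 • z.2⁻¹ • 𝒳.s z.1) _ = z.1
    simp only [smul_inv_smul]
    exact h.mul_s_self _ _) (mul_one _)
  r_inv z := Prod.ext (by
    change 𝒳.r (z.2⁻¹ • 𝒳.inv z.1) = z.2⁻¹ • 𝒳.s z.1
    rw [H.r_smul, h.r_inv]) rfl
  s_inv z := Prod.ext (by
    change z.2⁻¹⁻¹ • 𝒳.s (z.2⁻¹ • 𝒳.inv z.1) = 𝒳.r z.1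
    rw [H.s_smul, h.s_inv, inv_inv, smul_inv_smul]) rfl
  mul_inv z hz := Prod.ext (by
    change 𝒳.mul z.1 (z.2 • z.2⁻¹ • 𝒳.inv z.1) _ = 𝒳.r z.1
    simp only [smul_inv_smul]
    exact h.mul_inv _ _) (mul_inv_cancel _)
  inv_mul z hz := Prod.ext (by
    -- The first component of the product is (t⁻¹·x⁻¹)(t⁻¹·x), and the automorphism t⁻¹ can be
    -- pulled out.
    refine (H.mul_smul z.2⁻¹ (𝒳.inv z.1) z.1 (h.s_inv _) (H.comp_smul hz)).trans ?_
    rw [h.inv_mul]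
    rfl) (inv_mul_cancel _)
  continuous_r := (h.continuous_r.comp continuous_fst).prodMk continuous_const
  continuous_s := (H.continuous_smul.comp (continuous_snd.inv.prodMk
    (h.continuous_s.comp continuous_fst))).prodMk continuous_const
  continuous_inv := (H.continuous_smul.comp (continuous_snd.inv.prodMk
    (h.continuous_inv.comp continuous_fst))).prodMk continuous_snd.inv
  continuous_mul := by
    have h₁ : Continuous fun z : {z : (X × G) × (X × G) //
        (semidirectGroupoid H).s z.1 = (semidirectGroupoid H).r z.2} => z.1.1 :=
      continuous_fst.comp continuous_subtype_val
    have h₂ : Continuous fun z : {z : (X × G) × (X × G) //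
        (semidirectGroupoid H).s z.1 = (semidirectGroupoid H).r z.2} => z.1.2 :=
      continuous_snd.comp continuous_subtype_val
    exact (h.continuous_mul' h₁.fst (H.continuous_smul.comp (h₁.snd.prodMk h₂.fst)) _).prodMk
      (h₁.snd.mul h₂.snd)

end Semidirect

section Orbit

variable {G X : Type*} [Group G] [MulAction G X] [TopologicalSpace G] [TopologicalSpace X]
  {𝒳 : GroupoidOps X}

theorem orbitGroupoid_isIdentity_mk (H : IsGroupoidAction G 𝒳) (h : 𝒳.IsLCGroupoid) {x : X} :
    (orbitGroupoid H).IsIdentity (OrbitSpace.mk G x) ↔ 𝒳.IsIdentity x := by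
  constructor
  · rintro ⟨h₁, -⟩
    obtain ⟨t, ht⟩ := OrbitSpace.mk_eq_mk.1 h₁
    -- If x and r(x) lie in one orbit, then x is a translate of a unit, and automorphisms preserve
    -- units.
    have h₂ : x = t⁻¹ • 𝒳.r x := by rw [← ht, inv_smul_smul]
    rw [h₂]
    exact H.isIdentity_smul _ (h.isIdentity_r x)
  · intro hx
    exact ⟨congrArg (OrbitSpace.mk G) hx.1, congrArg (OrbitSpace.mk G) hx.2⟩

/-- With this a chain of composable orbits is represented by a chain of composable arrows, starting
from any representative of the first orbit; the groupoid laws then descend one by one. -/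
theorem IsGroupoidAction.exists_rep_right (H : IsGroupoidAction G 𝒳) {x : X}
    {Q : OrbitSpace G X}
    (h : OrbitSpace.mk G (𝒳.s x) = OrbitSpace.map 𝒳.r H.r_smul Q) :
    ∃ y, 𝒳.s x = 𝒳.r y ∧ OrbitSpace.mk G y = Q := by
  obtain ⟨y, hy, rfl⟩ := exists_orbitLift H.r_smul h
  exact ⟨y, hy.symm, rfl⟩

/-- The right action of the orbit groupoid on arrows of `𝒳`, that is `(x, G · y) ↦ x y` when
`s(x) = r(y)`. -/
noncomputable def orbitAct (H : IsGroupoidAction G 𝒳) (x : X) (Q : OrbitSpace G X)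
    (h : OrbitSpace.mk G (𝒳.s x) = OrbitSpace.map 𝒳.r H.r_smul Q) : X :=
  𝒳.mul x (orbitLift H.r_smul (𝒳.s x) Q h) (apply_orbitLift H.r_smul h).symm

variable [IsCancelSMul G X]

theorem orbitAct_eq (H : IsGroupoidAction G 𝒳) {x y : X} {Q : OrbitSpace G X}
    (hy : OrbitSpace.mk G y = Q) (hxy : 𝒳.s x = 𝒳.r y)
    (h : OrbitSpace.mk G (𝒳.s x) = OrbitSpace.map 𝒳.r H.r_smul Q) :
    orbitAct H x Q h = 𝒳.mul x y hxy :=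
  𝒳.mul_congr rfl (orbitLift_eq H.r_smul h hy hxy.symm) _ _

theorem mk_orbitAct (H : IsGroupoidAction G 𝒳) {x : X} {Q : OrbitSpace G X}
    (h : OrbitSpace.mk G (𝒳.s x) = OrbitSpace.map 𝒳.r H.r_smul Q) :
    OrbitSpace.mk G (orbitAct H x Q h) = (orbitGroupoid H).mul (OrbitSpace.mk G x) Q h := by
  obtain ⟨y, hy, rfl⟩ := H.exists_rep_right h
  exact (congrArg _ (orbitAct_eq H rfl hy h)).trans (orbitGroupoid_mul_mk H hy h).symm

variable [ProperSMul G X]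

theorem continuous_orbitAct (H : IsGroupoidAction G 𝒳) (h : 𝒳.IsLCGroupoid) :
    Continuous fun p : {p : X × OrbitSpace G X //
      OrbitSpace.mk G (𝒳.s p.1) = OrbitSpace.map 𝒳.r H.r_smul p.2} =>
        orbitAct H p.1.1 p.1.2 p.2 := by
  have h₁ : Continuous fun p : {p : X × OrbitSpace G X //
      OrbitSpace.mk G (𝒳.s p.1) = OrbitSpace.map 𝒳.r H.r_smul p.2} => p.1.1 :=
    continuous_fst.comp continuous_subtype_val
  exact h.continuous_mul' h₁ (continuous_orbitLift H.r_smul h.continuous_r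
    (h.continuous_s.comp h₁) (continuous_snd.comp continuous_subtype_val) fun p => p.2) _

theorem orbitGroupoid_isLCGroupoid (H : IsGroupoidAction G 𝒳) (h : 𝒳.IsLCGroupoid) :
    (orbitGroupoid H).IsLCGroupoid where
  locallyCompact := have := h.locallyCompact; inferInstance
  hausdorff := inferInstance
  secondCountable := have := h.secondCountable; inferInstance
  isIdentity_r P := by
    obtain ⟨x, rfl⟩ := OrbitSpace.mk_surjective P
    exact (orbitGroupoid_isIdentity_mk H h).2 (h.isIdentity_r x)
  isIdentity_s P := by
    obtain ⟨x, rfl⟩ := OrbitSpace.mk_surjective P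
    exact (orbitGroupoid_isIdentity_mk H h).2 (h.isIdentity_s x)
  r_mul P Q hPQ := by
    obtain ⟨x, rfl⟩ := OrbitSpace.mk_surjective P
    obtain ⟨y, hxy, rfl⟩ := H.exists_rep_right hPQ
    rw [orbitGroupoid_mul_mk H hxy]
    exact congrArg (OrbitSpace.mk G) (h.r_mul _ _ _)
  s_mul P Q hPQ := by
    obtain ⟨x, rfl⟩ := OrbitSpace.mk_surjective P
    obtain ⟨y, hxy, rfl⟩ := H.exists_rep_right hPQ
    rw [orbitGroupoid_mul_mk H hxy]
    exact congrArg (OrbitSpace.mk G) (h.s_mul _ _ _)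
  mul_assoc P Q R hPQ hQR h₁ h₂ := by
    obtain ⟨x, rfl⟩ := OrbitSpace.mk_surjective P
    obtain ⟨y, hxy, rfl⟩ := H.exists_rep_right hPQ
    obtain ⟨z, hyz, rfl⟩ := H.exists_rep_right hQR
    have h₃ : 𝒳.s (𝒳.mul x y hxy) = 𝒳.r z := by rw [h.s_mul, hyz]
    have h₄ : 𝒳.s x = 𝒳.r (𝒳.mul y z hyz) := by rw [h.r_mul, hxy]
    simp only [orbitGroupoid_mul_mk H hxy, orbitGroupoid_mul_mk H hyz, orbitGroupoid_mul_mk H h₃,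
      orbitGroupoid_mul_mk H h₄, h.mul_assoc x y z hxy hyz h₃ h₄]
  r_mul_self P hP := by
    obtain ⟨x, rfl⟩ := OrbitSpace.mk_surjective P
    have h₁ : 𝒳.s (𝒳.r x) = 𝒳.r x := h.s_r x
    exact (orbitGroupoid_mul_mk H h₁ hP).trans (congrArg _ (h.r_mul_self x _))
  mul_s_self P hP := by
    obtain ⟨x, rfl⟩ := OrbitSpace.mk_surjective P
    have h₁ : 𝒳.s x = 𝒳.r (𝒳.s x) := (h.r_s x).symm
    exact (orbitGroupoid_mul_mk H h₁ hP).trans (congrArg _ (h.mul_s_self x _))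
  r_inv P := by
    obtain ⟨x, rfl⟩ := OrbitSpace.mk_surjective P
    exact congrArg (OrbitSpace.mk G) (h.r_inv x)
  s_inv P := by
    obtain ⟨x, rfl⟩ := OrbitSpace.mk_surjective P
    exact congrArg (OrbitSpace.mk G) (h.s_inv x)
  mul_inv P hP := by
    obtain ⟨x, rfl⟩ := OrbitSpace.mk_surjective P
    exact (orbitGroupoid_mul_mk H (h.r_inv x).symm hP).trans (congrArg _ (h.mul_inv x _))
  inv_mul P hP := by
    obtain ⟨x, rfl⟩ := OrbitSpace.mk_surjective P
    exact (orbitGroupoid_mul_mk H (h.s_inv x) hP).trans (congrArg _ (h.inv_mul x _))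
  continuous_r := OrbitSpace.continuous_map H.r_smul h.continuous_r
  continuous_s := OrbitSpace.continuous_map H.s_smul h.continuous_s
  continuous_inv := OrbitSpace.continuous_map H.inv_smul h.continuous_inv
  continuous_mul := by
    -- Only the first factor is replaced by a point. The second stays an orbit and is lifted to the
    -- composable representative by `orbitAct`, whose continuity is already known.
    refine ((OrbitSpace.isOpenQuotientMap_mk (G := G) (X := X)).prodMap
      IsOpenQuotientMap.id).continuous_of_comp_subtype (S := fun p =>
        (orbitGroupoid H).s p.1 = (orbitGroupoid H).r p.2) ?_
    exact (OrbitSpace.continuous_mk.comp (continuous_orbitAct H h)).congr fun z =>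
      mk_orbitAct H z.2

end Orbit

end

/-! ### The space of arrows as an equivalence of groupoids. -/

section

/-- Such a map is a homeomorphism onto a closed subspace, hence a closed embedding. Both properness
axioms are verified by writing down the inverse. -/
theorem _root_.Continuous.isProperMap_of_inverse_on_isClosed {P Q : Type*} [TopologicalSpace P]
    [TopologicalSpace Q] {f : P → Q} (hf : Continuous f) {C : Set Q} (hC : IsClosed C)
    (hfC : ∀ p, f p ∈ C) {g : C → P} (hg : Continuous g) (hgf : ∀ p, g ⟨f p, hfC p⟩ = p)
    (hfg : ∀ c, f (g c) = c) : IsProperMap f := by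
  let e : P ≃ₜ C :=
    { toFun := fun p => ⟨f p, hfC p⟩
      invFun := g
      left_inv := hgf
      right_inv := fun c => Subtype.ext (hfg c)
      continuous_toFun := hf.subtype_mk hfC
      continuous_invFun := hg }
  exact (hC.isClosedEmbedding_subtypeVal.comp e.isClosedEmbedding).isProperMap

/-- This reduces the homeomorphisms of orbit spaces with unit spaces to the algebraic fact that the
orbits of one action are the fibres of the fibring map of the other. The relation need not be known
beforehand to be an equivalence relation. -/
theorem _root_.IsOpenQuotientMap.exists_quot_homeomorph {Ω U : Type*} [TopologicalSpace Ω]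
    [TopologicalSpace U] {f : Ω → U} (hf : IsOpenQuotientMap f) {R : Ω → Ω → Prop}
    (hR : ∀ w w', R w w' ↔ f w = f w') :
    ∃ e : Quot R ≃ₜ U, ∀ w, e (Quot.mk _ w) = f w := by
  let F : Quot R → U := Quot.lift f fun w w' h => (hR w w').1 h
  have hF : Function.Bijective F := by
    constructor
    · rintro ⟨w⟩ ⟨w'⟩ h
      exact Quot.sound ((hR w w').2 h)
    · intro u
      obtain ⟨w, rfl⟩ := hf.surjective u
      exact ⟨Quot.mk _ w, rfl⟩
  refine ⟨(Equiv.ofBijective F hF).toHomeomorphOfContinuousOpen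
    (continuous_quot_lift _ hf.continuous) fun V hV => ?_, fun w => rfl⟩
  have h : F '' V = f '' (Quot.mk _ ⁻¹' V) := by
    ext u
    constructor
    · rintro ⟨⟨w⟩, hw, rfl⟩
      exact ⟨w, hw, rfl⟩
    · rintro ⟨w, hw, rfl⟩
      exact ⟨Quot.mk _ w, hw, rfl⟩
  change IsOpen (F '' V)
  rw [h]
  exact hf.isOpenMap _ (hV.preimage continuous_quot_mk)

variable {G X : Type*} [Group G] [MulAction G X] [TopologicalSpace G] [TopologicalSpace X]
  {𝒳 : GroupoidOps X}

/-- The left action of the semidirect product on the arrows of `𝒳`. -/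
def semidirectActionOps (H : IsGroupoidAction G 𝒳) :
    LeftActionOps (semidirectGroupoid H) X where
  ρ x := (𝒳.r x, 1)
  act z w h := 𝒳.mul z.1 (z.2 • w) (H.comp_smul h)

/-- The right action of the orbit groupoid on the arrows of `𝒳`. -/
noncomputable def orbitActionOps (H : IsGroupoidAction G 𝒳) :
    RightActionOps (orbitGroupoid H) X where
  σ x := OrbitSpace.mk G (𝒳.s x)
  act x Q h := orbitAct H x Q h

/-- The unit space of the semidirect product is that of `𝒳`. -/
def semidirectUnitHomeomorph (H : IsGroupoidAction G 𝒳) :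
    𝒳.UnitSpace ≃ₜ (semidirectGroupoid H).UnitSpace where
  toFun u := ⟨(u.1, 1), (semidirectGroupoid_isIdentity H).2 ⟨u.2, rfl⟩⟩
  invFun z := ⟨z.1.1, ((semidirectGroupoid_isIdentity H).1 z.2).1⟩
  left_inv _ := rfl
  right_inv z := Subtype.ext (Prod.ext rfl ((semidirectGroupoid_isIdentity H).1 z.2).2.symm)
  continuous_toFun := (continuous_subtype_val.prodMk continuous_const).subtype_mk _
  continuous_invFun := (continuous_fst.comp continuous_subtype_val).subtype_mk _

/-- The orbit map on units. -/
def orbitUnit (H : IsGroupoidAction G 𝒳) (h : 𝒳.IsLCGroupoid) (u : 𝒳.UnitSpace) :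
    (orbitGroupoid H).UnitSpace :=
  ⟨OrbitSpace.mk G u.1, (orbitGroupoid_isIdentity_mk H h).2 u.2⟩

theorem isOpenQuotientMap_orbitUnit [ContinuousConstSMul G X] (H : IsGroupoidAction G 𝒳)
    (h : 𝒳.IsLCGroupoid) : IsOpenQuotientMap (orbitUnit H h) := by
  have hq := (OrbitSpace.isOpenQuotientMap_mk (G := G) (X := X)).restrictPreimage
    {P | (orbitGroupoid H).IsIdentity P}
  -- The units of 𝒳 form the full preimage of the units of the orbit groupoid, so the open quotient
  -- map restricts to them.
  have hs : {x | 𝒳.IsIdentity x} = OrbitSpace.mk G ⁻¹' {P | (orbitGroupoid H).IsIdentity P} :=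
    Set.ext fun x => (orbitGroupoid_isIdentity_mk H h).symm
  exact hq.comp (Homeomorph.setCongr hs).isOpenQuotientMap

theorem isOpenQuotientMap_rUnit (h : 𝒳.IsLCGroupoid) (hr : IsOpenMap h.rUnit) :
    IsOpenQuotientMap h.rUnit :=
  ⟨h.rUnit_surjective, h.continuous_rUnit, hr⟩

theorem isOpenQuotientMap_sUnit (h : 𝒳.IsLCGroupoid) (hr : IsOpenMap h.rUnit) :
    IsOpenQuotientMap h.sUnit :=
  ⟨fun u => ⟨u.1, Subtype.ext u.2.2⟩, h.continuous_s.subtype_mk _, h.isOpenMap_sUnit hr⟩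

variable [IsCancelSMul G X] [ProperSMul G X]

theorem isFreeProper_semidirectActionOps (H : IsGroupoidAction G 𝒳) (h : 𝒳.IsLCGroupoid)
    (hr : IsOpenMap h.rUnit) : (semidirectActionOps H).IsFreeProper where
  isIdentity_ρ w := (semidirectGroupoid_isIdentity H).2 ⟨h.isIdentity_r _, rfl⟩
  continuous_ρ := h.continuous_r.prodMk continuous_const
  isOpenMap_ρ := (semidirectUnitHomeomorph H).isOpenMap.comp hr
  ρ_act y w hyw := Prod.ext (h.r_mul _ _ _) rfl
  unit_act w hw := by
    change 𝒳.mul (𝒳.r w) ((1 : G) • w) _ = w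
    simp only [one_smul]
    exact h.r_mul_self _ _
  mul_act x y w hxy hyw h₁ h₂ := by
    change 𝒳.mul (𝒳.mul x.1 (x.2 • y.1) _) ((x.2 * y.2) • w) _ =
      𝒳.mul x.1 (x.2 • 𝒳.mul y.1 (y.2 • w) _) _
    have h₃ := H.comp_smul hyw
    have h₄ : 𝒳.s (x.2 • y.1) = 𝒳.r (x.2 • y.2 • w) := by rw [H.s_smul, h₃, H.r_smul x.2]
    simp only [← H.mul_smul x.2 _ _ h₃ h₄, mul_smul]
    exact h.mul_assoc _ _ _ _ _ _ _
  continuous_act := by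
    have h₁ : Continuous fun p : {p : (X × G) × X //
        (semidirectGroupoid H).s p.1 = (semidirectActionOps H).ρ p.2} => p.1.1 :=
      continuous_fst.comp continuous_subtype_val
    have h₂ : Continuous fun p : {p : (X × G) × X //
        (semidirectGroupoid H).s p.1 = (semidirectActionOps H).ρ p.2} => p.1.2 :=
      continuous_snd.comp continuous_subtype_val
    exact h.continuous_mul' h₁.fst (H.continuous_smul.comp (h₁.snd.prodMk h₂)) _
  free y w hyw hw := by
    have h₁ := H.comp_smul hyw
    have h₂ : 𝒳.mul y.1 (y.2 • w) h₁ = w := hw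
    -- Comparing sources isolates the group component: t fixes s(w), so t = 1 by freeness, and what
    -- remains is cancellation in 𝒳.
    have h₃ : y.2 • 𝒳.s w = 𝒳.s w := by
      rw [← H.s_smul, ← h.s_mul _ _ h₁, h₂]
    have h₄ : y.2 = 1 := IsCancelSMul.right_cancel _ _ _ (h₃.trans (one_smul _ _).symm)
    refine Prod.ext ?_ h₄
    have h₅ : y.2 • w = w := by rw [h₄, one_smul]
    have h₆ := h.eq_unit_of_mul_eq h₁ (h₂.trans h₅.symm)
    rw [h₆, h₅]
    rfl
  proper := by
    have hc : Continuous fun z : {z : X × X | OrbitSpace.mk G (𝒳.s z.1) =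
        OrbitSpace.mk G (𝒳.s z.2)} => orbitDiv (𝒳.s z.1.1) (𝒳.s z.1.2) z.2 :=
      continuous_orbitDiv (h.continuous_s.comp (continuous_fst.comp continuous_subtype_val))
        (h.continuous_s.comp (continuous_snd.comp continuous_subtype_val)) _
    have h₁ (z : {z : X × X | OrbitSpace.mk G (𝒳.s z.1) = OrbitSpace.mk G (𝒳.s z.2)}) :
        𝒳.s z.1.1 = 𝒳.r (𝒳.inv (orbitDiv (𝒳.s z.1.1) (𝒳.s z.1.2) z.2 • z.1.2)) := by
      rw [h.r_inv, H.s_smul, orbitDiv_smul]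
    have h₁' : Continuous fun p : {p : (X × G) × X //
        (semidirectGroupoid H).s p.1 = (semidirectActionOps H).ρ p.2} => p.1.1 :=
      continuous_fst.comp continuous_subtype_val
    have h₂' : Continuous fun p : {p : (X × G) × X //
        (semidirectGroupoid H).s p.1 = (semidirectActionOps H).ρ p.2} => p.1.2 :=
      continuous_snd.comp continuous_subtype_val
    have h₂ (p : {p : (X × G) × X //
        (semidirectGroupoid H).s p.1 = (semidirectActionOps H).ρ p.2}) :
        p.1.1.2 • 𝒳.s p.1.2 = 𝒳.s ((semidirectActionOps H).act p.1.1 p.1.2 p.2) :=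
      (H.s_smul _ _).symm.trans (h.s_mul _ _ (H.comp_smul p.2)).symm
    -- The inverse sends (w', w) to the arrow (w'(t·w)⁻¹, t), paired with w, where t carries s(w) to
    -- s(w'). The set C is closed because the orbit space of a proper action is Hausdorff.
    refine Continuous.isProperMap_of_inverse_on_isClosed
      (C := {z | OrbitSpace.mk G (𝒳.s z.1) = OrbitSpace.mk G (𝒳.s z.2)})
      (g := fun z => ⟨((𝒳.mul z.1.1 (𝒳.inv (orbitDiv (𝒳.s z.1.1) (𝒳.s z.1.2) z.2 • z.1.2))
        (h₁ z), orbitDiv (𝒳.s z.1.1) (𝒳.s z.1.2) z.2), z.1.2), ?_⟩) ?_ ?_ ?_ ?_ ?_ ?_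
    · exact (h.continuous_mul' h₁'.fst (H.continuous_smul.comp (h₁'.snd.prodMk h₂')) _).prodMk h₂'
    · exact isClosed_eq (OrbitSpace.continuous_mk.comp (h.continuous_s.comp continuous_fst))
        (OrbitSpace.continuous_mk.comp (h.continuous_s.comp continuous_snd))
    · intro p
      exact OrbitSpace.mk_eq_mk.2 ⟨p.1.1.2, h₂ p⟩
    · refine Prod.ext ?_ rfl
      change (orbitDiv (𝒳.s z.1.1) (𝒳.s z.1.2) z.2)⁻¹ • 𝒳.s (𝒳.mul _ _ _) = 𝒳.r z.1.2
      rw [h.s_mul, h.s_inv, H.r_smul, inv_smul_smul]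
    · refine Continuous.subtype_mk (.prodMk (.prodMk (h.continuous_mul' ?_ ?_ _) hc) ?_) _
      · exact continuous_fst.comp continuous_subtype_val
      · exact h.continuous_inv.comp (H.continuous_smul.comp (hc.prodMk
          (continuous_snd.comp continuous_subtype_val)))
      · exact continuous_snd.comp continuous_subtype_val
    · intro p
      have h₃ (hp) : orbitDiv (𝒳.s ((semidirectActionOps H).act p.1.1 p.1.2 p.2)) (𝒳.s p.1.2) hp =
          p.1.1.2 := orbitDiv_eq _ (h₂ p)
      refine Subtype.ext (Prod.ext (Prod.ext ?_ (h₃ (OrbitSpace.mk_eq_mk.2 ⟨p.1.1.2, h₂ p⟩))) rfl)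
      simp only [h₃]
      exact h.mul_inv_cancel_right (H.comp_smul p.2) _
    · intro z
      refine Prod.ext ?_ rfl
      exact h.inv_mul_cancel_right (h₁ z) _

theorem isFreeProper_orbitActionOps (H : IsGroupoidAction G 𝒳) (h : 𝒳.IsLCGroupoid)
    (hr : IsOpenMap h.rUnit) : (orbitActionOps H).IsFreeProper where
  isIdentity_σ w := (orbitGroupoid_isIdentity_mk H h).2 (h.isIdentity_s w)
  continuous_σ := OrbitSpace.continuous_mk.comp h.continuous_s
  isOpenMap_σ := (isOpenQuotientMap_orbitUnit H h).isOpenMap.comp (h.isOpenMap_sUnit hr)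
  σ_act w Q hwQ := by
    obtain ⟨y, hy, rfl⟩ := H.exists_rep_right hwQ
    exact congrArg (OrbitSpace.mk G)
      ((congrArg 𝒳.s (orbitAct_eq H rfl hy hwQ)).trans (h.s_mul _ _ _))
  act_unit w hw := (orbitAct_eq H rfl (h.r_s w).symm hw).trans (h.mul_s_self _ _)
  act_mul w P Q hPQ hw h₁ h₂ := by
    obtain ⟨y, hy, rfl⟩ := H.exists_rep_right hw
    obtain ⟨z, hz, rfl⟩ := H.exists_rep_right hPQ
    have h₃ : 𝒳.s w = 𝒳.r (𝒳.mul y z hz) := by rw [h.r_mul, hy]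
    have h₄ : 𝒳.s (𝒳.mul w y hy) = 𝒳.r z := by rw [h.s_mul, hz]
    have h₅ : (orbitActionOps H).act w _ hw = 𝒳.mul w y hy := orbitAct_eq H rfl hy hw
    have h₆ : 𝒳.s ((orbitActionOps H).act w _ hw) = 𝒳.r z := by rw [h₅, h₄]
    exact (orbitAct_eq H (orbitGroupoid_mul_mk H hz hPQ).symm h₃ h₁).trans
      ((h.mul_assoc _ _ _ hy hz h₄ h₃).symm.trans ((𝒳.mul_congr h₅.symm rfl h₄ h₆).trans
        (orbitAct_eq H rfl h₆ h₂).symm))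
  continuous_act := continuous_orbitAct H h
  free w Q hQ hw := by
    obtain ⟨y, hy, rfl⟩ := H.exists_rep_right hQ
    exact congrArg (OrbitSpace.mk G)
      (h.eq_unit_of_mul_eq' hy ((orbitAct_eq H rfl hy hQ).symm.trans hw))
  proper := by
    have h₁ (z : {z : X × X | 𝒳.r z.1 = 𝒳.r z.2}) : 𝒳.s (𝒳.inv z.1.1) = 𝒳.r z.1.2 := by
      rw [h.s_inv, z.2]
    have h₂ (z : {z : X × X | 𝒳.r z.1 = 𝒳.r z.2}) :
        𝒳.s z.1.1 = 𝒳.r (𝒳.mul (𝒳.inv z.1.1) z.1.2 (h₁ z)) := by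
      rw [h.r_mul, h.r_inv]
    -- The inverse sends (w, w') to w paired with the orbit of w⁻¹w'.
    refine Continuous.isProperMap_of_inverse_on_isClosed (C := {z : X × X | 𝒳.r z.1 = 𝒳.r z.2})
      (g := fun z => ⟨(z.1.1, OrbitSpace.mk G (𝒳.mul (𝒳.inv z.1.1) z.1.2 (h₁ z))),
        congrArg (OrbitSpace.mk G) (h₂ z)⟩) ?_ ?_ ?_ ?_ ?_ ?_
    · exact (continuous_fst.comp continuous_subtype_val).prodMk (continuous_orbitAct H h)
    · have := h.hausdorff
      exact isClosed_eq (h.continuous_r.comp continuous_fst) (h.continuous_r.comp continuous_snd)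
    · rintro ⟨⟨w, Q⟩, hQ⟩
      obtain ⟨y, hy, rfl⟩ := H.exists_rep_right hQ
      exact ((congrArg 𝒳.r (orbitAct_eq H rfl hy hQ)).trans (h.r_mul _ _ _)).symm
    · refine (Continuous.prodMk (continuous_fst.comp continuous_subtype_val)
        (OrbitSpace.continuous_mk.comp (h.continuous_mul' ?_ ?_ _))).subtype_mk _
      · exact h.continuous_inv.comp (continuous_fst.comp continuous_subtype_val)
      · exact continuous_snd.comp continuous_subtype_val
    · rintro ⟨⟨w, Q⟩, hQ⟩
      obtain ⟨y, hy, rfl⟩ := H.exists_rep_right hQ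
      refine Subtype.ext (Prod.ext rfl (congrArg (OrbitSpace.mk G) ?_))
      exact (𝒳.mul_congr rfl (orbitAct_eq H rfl hy hQ) _ (by rw [h.s_inv, h.r_mul])).trans
        (h.inv_mul_cancel_left hy _)
    · intro z
      refine Prod.ext rfl ?_
      exact (orbitAct_eq H rfl (h₂ z) (congrArg _ (h₂ z))).trans (h.mul_inv_cancel_left _ _)

theorem isGroupoidEquivalence_semidirect_orbit (H : IsGroupoidAction G 𝒳) (h : 𝒳.IsLCGroupoid)
    (hr : IsOpenMap h.rUnit) :
    IsGroupoidEquivalence (semidirectActionOps H) (orbitActionOps H) where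
  locallyCompact := h.locallyCompact
  hausdorff := h.hausdorff
  secondCountable := h.secondCountable
  left := isFreeProper_semidirectActionOps H h hr
  right := isFreeProper_orbitActionOps H h hr
  ρ_act w Q hQ := by
    obtain ⟨y, hy, rfl⟩ := H.exists_rep_right hQ
    exact Prod.ext ((congrArg 𝒳.r (orbitAct_eq H rfl hy hQ)).trans (h.r_mul _ _ _)) rfl
  σ_act z w hz := by
    refine (congrArg (OrbitSpace.mk G) ((h.s_mul _ _ (H.comp_smul hz)).trans ?_)).trans
      (OrbitSpace.mk_smul z.2 (𝒳.s w))
    exact H.s_smul _ _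
  commute z w Q hz hQ h₁ h₂ := by
    obtain ⟨y, hy, rfl⟩ := H.exists_rep_right hQ
    have h₃ := H.comp_smul hz
    have h₄ : 𝒳.s (z.2 • w) = 𝒳.r (z.2 • y) := by rw [H.s_smul, H.r_smul, hy]
    have h₅ : 𝒳.s (𝒳.mul z.1 (z.2 • w) h₃) = 𝒳.r (z.2 • y) := by rw [h.s_mul, h₄]
    have h₆ : 𝒳.s z.1 = 𝒳.r (𝒳.mul (z.2 • w) (z.2 • y) h₄) := by rw [h.r_mul, h₃]
    -- On the translated side the orbit of y is represented by z.2·y, which is composable with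
    -- z.2·w.
    refine (orbitAct_eq H (OrbitSpace.mk_smul z.2 y) h₅ h₁).trans
      ((h.mul_assoc _ _ _ h₃ h₄ h₅ h₆).trans (𝒳.mul_congr rfl ?_ _ _))
    rw [H.mul_smul _ _ _ hy]
    exact congrArg _ (orbitAct_eq H rfl hy hQ).symm
  homeo_ρ := by
    obtain ⟨e, he⟩ := ((semidirectUnitHomeomorph H).isOpenQuotientMap.comp
      (isOpenQuotientMap_rUnit h hr)).exists_quot_homeomorph
      (R := fun w w' : X => ∃ z h, (orbitActionOps H).act w z h = w') fun w w' => by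
        constructor
        · rintro ⟨Q, hQ, rfl⟩
          obtain ⟨y, hy, rfl⟩ := H.exists_rep_right hQ
          refine congrArg (semidirectUnitHomeomorph H) (Subtype.ext ?_)
          exact ((congrArg 𝒳.r (orbitAct_eq H rfl hy hQ)).trans (h.r_mul _ _ _)).symm
        · intro hw
          have h₀ : 𝒳.r w = 𝒳.r w' :=
            congrArg Subtype.val ((semidirectUnitHomeomorph H).injective hw)
          have h₁ : 𝒳.s (𝒳.inv w) = 𝒳.r w' := by rw [h.s_inv, h₀]
          have h₂ : 𝒳.s w = 𝒳.r (𝒳.mul (𝒳.inv w) w' h₁) := by rw [h.r_mul, h.r_inv]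
          exact ⟨OrbitSpace.mk G (𝒳.mul (𝒳.inv w) w' h₁), congrArg _ h₂,
            (orbitAct_eq H rfl h₂ (congrArg _ h₂)).trans (h.mul_inv_cancel_left _ _)⟩
    exact ⟨e, fun w => congrArg Subtype.val (he w)⟩
  homeo_σ := by
    obtain ⟨e, he⟩ := ((isOpenQuotientMap_orbitUnit H h).comp
      (isOpenQuotientMap_sUnit h hr)).exists_quot_homeomorph
      (R := fun w w' : X => ∃ z h, (semidirectActionOps H).act z w h = w') fun w w' => by
        constructor
        · rintro ⟨z, hz, rfl⟩
          refine Subtype.ext (OrbitSpace.mk_eq_mk.2 ⟨z.2⁻¹, inv_smul_eq_iff.2 ?_⟩)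
          exact (h.s_mul _ _ (H.comp_smul hz)).trans (H.s_smul _ _)
        · intro hw
          obtain ⟨t, ht⟩ := OrbitSpace.mk_eq_mk.1 (congrArg Subtype.val hw).symm
          have ht' : t • 𝒳.s w = 𝒳.s w' := ht
          have h₁ : 𝒳.s w' = 𝒳.r (𝒳.inv (t • w)) := by rw [h.r_inv, H.s_smul, ht']
          -- The arrow (w'(t·w)⁻¹, t) carries w to w'.
          refine ⟨(𝒳.mul w' (𝒳.inv (t • w)) h₁, t), Prod.ext ?_ rfl, ?_⟩
          · change t⁻¹ • 𝒳.s (𝒳.mul w' (𝒳.inv (t • w)) h₁) = 𝒳.r w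
            rw [h.s_mul, h.s_inv, H.r_smul, inv_smul_smul]
          · exact h.inv_mul_cancel_right h₁ _
    exact ⟨e, fun w => congrArg Subtype.val (he w)⟩

end

/-! ### Transport of imprimitivity bimodules and norm estimates in Fell bundles. -/

section

/-- `φ` is an isomorphism of C*-algebras. -/
structure IsCStarIso {B B' : Type*} [NonUnitalCStarAlgebra B] [NonUnitalCStarAlgebra B']
    (φ : B → B') : Prop where
  surjective : Function.Surjective φ
  map_add : ∀ a b, φ (a + b) = φ a + φ b
  map_smul : ∀ (c : ℂ) a, φ (c • a) = c • φ a
  map_mul : ∀ a b, φ (a * b) = φ a * φ b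
  map_star : ∀ a, φ (star a) = star (φ a)
  norm_map : ∀ a, ‖φ a‖ = ‖a‖

/-- A continuous surjection carries dense sets to dense sets, and the image of the first span lies
in the second. Fullness of the inner products is transported this way. -/
theorem IsCStarIso.dense_span {B B' : Type*} [NonUnitalCStarAlgebra B] [NonUnitalCStarAlgebra B']
    {φ : B → B'} (hφ : IsCStarIso φ) {s : Set B} {s' : Set B'} (hs : ∀ b ∈ s, φ b ∈ s')
    (hd : Dense (Submodule.span ℂ s : Set B)) : Dense (Submodule.span ℂ s' : Set B') := by
  let f : B →ₗ[ℂ] B' :=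
    { toFun := φ
      map_add' := hφ.map_add
      map_smul' := hφ.map_smul }
  have hf : Continuous f := AddMonoidHomClass.continuous_of_bound f 1 fun x => by
    rw [one_mul]; exact (hφ.norm_map x).le
  refine (hφ.surjective.denseRange.dense_image hf hd).mono (Set.image_subset_iff.2 ?_)
  change Submodule.span ℂ s ≤ (Submodule.span ℂ s').comap f
  exact Submodule.span_le.2 fun b hb => Submodule.subset_span (hs b hb)

namespace IsImprimitivityBimodule

variable {B E C : Type*} [NonUnitalCStarAlgebra B] [NonUnitalCStarAlgebra C]
  [NormedAddCommGroup E] [NormedSpace ℂ E] [CompleteSpace E] {l : B → E → E} {m : E → C → E}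
  {L : E → E → B} {R : E → E → C}

/-- The inner product of be with itself is b L(e, e) b*, so ‖be‖² ≤ ‖b‖²‖e‖² by the norm axiom for
L. -/
theorem norm_l_le (h : IsImprimitivityBimodule B E C l m L R) (b : B) (e : E) :
    ‖l b e‖ ≤ ‖b‖ * ‖e‖ := by
  have h₁ : L (l b e) (l b e) = b * L e e * star b := by
    rw [h.L_mul, ← h.L_star, h.L_mul, star_mul, h.L_star, mul_assoc]
  refine le_of_sq_le_sq ?_ (by positivity)
  rw [← h.L_norm, h₁]
  calc ‖b * L e e * star b‖ ≤ ‖b‖ * ‖L e e‖ * ‖star b‖ :=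
        (norm_mul_le _ _).trans (by gcongr; exact norm_mul_le _ _)
    _ = (‖b‖ * ‖e‖) ^ 2 := by rw [norm_star, h.L_norm]; ring

/-- All three maps are surjective and intertwine the operations, so each axiom for the new bimodule
is the image of the old one. It serves the fibres of both new Fell bundles and those of the
equivalence. -/
theorem transport {B' E' C' : Type*} [NonUnitalCStarAlgebra B'] [NonUnitalCStarAlgebra C']
    [NormedAddCommGroup E'] [NormedSpace ℂ E'] [CompleteSpace E'] {l' : B' → E' → E'}
    {m' : E' → C' → E'} {L' : E' → E' → B'} {R' : E' → E' → C'}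
    (h : IsImprimitivityBimodule B E C l m L R) {φ : B → B'} {ψ : E → E'} {χ : C → C'}
    (hφ : IsCStarIso φ) (hχ : IsCStarIso χ) (hψ : Function.Surjective ψ)
    (ψ_add : ∀ e f, ψ (e + f) = ψ e + ψ f) (ψ_smul : ∀ (c : ℂ) e, ψ (c • e) = c • ψ e)
    (ψ_norm : ∀ e, ‖ψ e‖ = ‖e‖) (hl : ∀ b e, l' (φ b) (ψ e) = ψ (l b e))
    (hm : ∀ e c, m' (ψ e) (χ c) = ψ (m e c)) (hL : ∀ e f, L' (ψ e) (ψ f) = φ (L e f))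
    (hR : ∀ e f, R' (ψ e) (ψ f) = χ (R e f)) :
    IsImprimitivityBimodule B' E' C' l' m' L' R' where
  l_add := by
    simp only [hφ.surjective.forall, hψ.forall, ← ψ_add, hl, h.l_add, implies_true]
  add_l := by
    simp only [hφ.surjective.forall, hψ.forall, ← ψ_add, ← hφ.map_add, hl, h.add_l, implies_true]
  smul_l := by
    simp only [hφ.surjective.forall, hψ.forall, ← ψ_smul, ← hφ.map_smul, hl, h.smul_l,
      implies_true]
  l_smul := by
    simp only [hφ.surjective.forall, hψ.forall, ← ψ_smul, hl, h.l_smul, implies_true]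
  mul_l := by
    simp only [hφ.surjective.forall, hψ.forall, ← hφ.map_mul, hl, h.mul_l, implies_true]
  m_add := by
    simp only [hχ.surjective.forall, hψ.forall, ← ψ_add, ← hχ.map_add, hm, h.m_add, implies_true]
  add_m := by
    simp only [hχ.surjective.forall, hψ.forall, ← ψ_add, hm, h.add_m, implies_true]
  smul_m := by
    simp only [hχ.surjective.forall, hψ.forall, ← ψ_smul, hm, h.smul_m, implies_true]
  m_smul := by
    simp only [hχ.surjective.forall, hψ.forall, ← ψ_smul, ← hχ.map_smul, hm, h.m_smul,
      implies_true]
  m_mul := by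
    simp only [hχ.surjective.forall, hψ.forall, ← hχ.map_mul, hm, h.m_mul, implies_true]
  L_add := by simp only [hψ.forall, ← ψ_add, ← hφ.map_add, hL, h.L_add, implies_true]
  L_smul := by simp only [hψ.forall, ← ψ_smul, ← hφ.map_smul, hL, h.L_smul, implies_true]
  L_mul := by
    simp only [hφ.surjective.forall, hψ.forall, ← hφ.map_mul, hl, hL, h.L_mul, implies_true]
  L_star := by simp only [hψ.forall, ← hφ.map_star, hL, h.L_star, implies_true]
  L_nonneg := by
    simp only [hψ.forall, hL]
    intro e
    obtain ⟨b, hb⟩ := h.L_nonneg e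
    exact ⟨φ b, by rw [hb, hφ.map_mul, hφ.map_star]⟩
  L_norm := by simp only [hψ.forall, hL, hφ.norm_map, h.L_norm, ψ_norm, implies_true]
  L_full := by
    refine hφ.dense_span ?_ h.L_full
    rintro _ ⟨z, rfl⟩
    exact ⟨(ψ z.1, ψ z.2), hL _ _⟩
  R_add := by simp only [hψ.forall, ← ψ_add, ← hχ.map_add, hR, h.R_add, implies_true]
  R_smul := by simp only [hψ.forall, ← ψ_smul, ← hχ.map_smul, hR, h.R_smul, implies_true]
  R_mul := by
    simp only [hχ.surjective.forall, hψ.forall, ← hχ.map_mul, hm, hR, h.R_mul, implies_true]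
  R_star := by simp only [hψ.forall, ← hχ.map_star, hR, h.R_star, implies_true]
  R_nonneg := by
    simp only [hψ.forall, hR]
    intro e
    obtain ⟨b, hb⟩ := h.R_nonneg e
    exact ⟨χ b, by rw [hb, hχ.map_mul, hχ.map_star]⟩
  R_norm := by simp only [hψ.forall, hR, hχ.norm_map, h.R_norm, ψ_norm, implies_true]
  R_full := by
    refine hχ.dense_span ?_ h.R_full
    rintro _ ⟨z, rfl⟩
    exact ⟨(ψ z.1, ψ z.2), hR _ _⟩
  R_adjoint := by
    simp only [hφ.surjective.forall, hψ.forall, ← hφ.map_star, hl, hR]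
    exact fun b e f => congrArg χ (h.R_adjoint b e f)
  L_adjoint := by
    simp only [hχ.surjective.forall, hψ.forall, ← hχ.map_star, hm, hL]
    exact fun e f c => congrArg φ (h.L_adjoint e f c)
  compat := by
    simp only [hψ.forall, hL, hR, hl, hm, h.compat, implies_true]

end IsImprimitivityBimodule

namespace IsFellBundle

variable {X A : Type*} [TopologicalSpace X] [TopologicalSpace A] {𝒳 : GroupoidOps X}
  {𝒜 : FellOps 𝒳 A}

theorem nrm_adj_mul (H : IsFellBundle 𝒜) (a : A)
    (h : 𝒳.s (𝒜.proj (𝒜.adj a)) = 𝒳.r (𝒜.proj a)) :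
    𝒜.nrm (𝒜.mul (𝒜.adj a) a h) = 𝒜.nrm a ^ 2 := by
  let := H.cstar (H.isLCGroupoid.isIdentity_r (𝒜.proj a))
  let := H.cstar (H.isLCGroupoid.isIdentity_s (𝒜.proj a))
  have h₁ := (H.fibreImprimitivity (𝒜.proj a)).R_norm (𝒜.elt a)
  rw [𝒜.norm_val] at h₁
  exact h₁

theorem nrm_unit_mul_le (H : IsFellBundle 𝒜) (d b : A) (hd : 𝒜.proj d = 𝒳.r (𝒜.proj b))
    (h : 𝒳.s (𝒜.proj d) = 𝒳.r (𝒜.proj b)) :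
    𝒜.nrm (𝒜.mul d b h) ≤ 𝒜.nrm d * 𝒜.nrm b := by
  let := H.cstar (H.isLCGroupoid.isIdentity_r (𝒜.proj b))
  let := H.cstar (H.isLCGroupoid.isIdentity_s (𝒜.proj b))
  have h₁ := (H.fibreImprimitivity (𝒜.proj b)).norm_l_le (𝒜.fib d hd) (𝒜.elt b)
  rw [𝒜.norm_val] at h₁
  refine h₁.trans_eq (congrArg (· * 𝒜.nrm b) (𝒜.norm_val _))

theorem exists_adj_mul_self (H : IsFellBundle 𝒜) (a : A)
    (h : 𝒳.s (𝒜.proj (𝒜.adj a)) = 𝒳.r (𝒜.proj a)) :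
    ∃ d, 𝒜.proj d = 𝒳.s (𝒜.proj a) ∧ ∃ h', 𝒜.mul (𝒜.adj a) a h = 𝒜.mul (𝒜.adj d) d h' := by
  let := H.cstar (H.isLCGroupoid.isIdentity_r (𝒜.proj a))
  let := H.cstar (H.isLCGroupoid.isIdentity_s (𝒜.proj a))
  obtain ⟨c, hc⟩ := (H.fibreImprimitivity (𝒜.proj a)).R_nonneg (𝒜.elt a)
  exact ⟨c.1, c.2, _, congrArg Subtype.val hc⟩

/-- The axioms bound ‖ab‖ only within a fibre over a unit. In general, positivity gives a*a = d*d
with d in the C*-algebra over s(a). Then ‖d‖ = ‖a‖ and ‖ab‖² = ‖b*(a*a)b‖ = ‖b*(d*d)b‖ = ‖db‖², and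
‖db‖ ≤ ‖d‖‖b‖ because d acts on a Hilbert module. -/
theorem nrm_mul_le_mul (H : IsFellBundle 𝒜) (a b : A) (h : 𝒳.s (𝒜.proj a) = 𝒳.r (𝒜.proj b)) :
    𝒜.nrm (𝒜.mul a b h) ≤ 𝒜.nrm a * 𝒜.nrm b := by
  have hX := H.isLCGroupoid
  have hs (c : A) : 𝒳.s (𝒜.proj (𝒜.adj c)) = 𝒳.r (𝒜.proj c) := by rw [H.proj_adj, hX.s_inv]
  have hr (c : A) : 𝒳.r (𝒜.proj (𝒜.adj c)) = 𝒳.s (𝒜.proj c) := by rw [H.proj_adj, hX.r_inv]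
  have key (c : A) (hc : 𝒳.s (𝒜.proj c) = 𝒳.r (𝒜.proj b)) (h₀ h₁ h₂) :
      𝒜.mul (𝒜.adj (𝒜.mul c b hc)) (𝒜.mul c b hc) h₀ =
        𝒜.mul (𝒜.adj b) (𝒜.mul (𝒜.mul (𝒜.adj c) c (hs c)) b h₁) h₂ := by
    have h₃ : 𝒳.s (𝒜.proj (𝒜.adj b)) = 𝒳.r (𝒜.proj (𝒜.adj c)) := by rw [hs, hr, hc]
    have h₄ : 𝒳.s (𝒜.proj (𝒜.adj c)) = 𝒳.r (𝒜.proj (𝒜.mul c b hc)) := by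
      rw [hs, H.proj_mul, hX.r_mul]
    have h₅ : 𝒳.s (𝒜.proj (𝒜.mul (𝒜.adj b) (𝒜.adj c) h₃)) = 𝒳.r (𝒜.proj (𝒜.mul c b hc)) := by
      rw [H.proj_mul, hX.s_mul, h₄]
    have h₆ : 𝒳.s (𝒜.proj (𝒜.adj b)) = 𝒳.r (𝒜.proj (𝒜.mul (𝒜.adj c) (𝒜.mul c b hc) h₄)) := by
      rw [H.proj_mul, hX.r_mul, h₃]
    rw [𝒜.mul_congr (H.adj_mul c b hc h₃) rfl _ h₅, H.mul_assoc _ _ _ h₃ h₄ h₅ h₆]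
    exact 𝒜.mul_congr rfl (H.mul_assoc _ _ _ _ hc _ _).symm _ _
  obtain ⟨d, hd, h', hda⟩ := H.exists_adj_mul_self a (hs a)
  have hdb : 𝒜.proj d = 𝒳.r (𝒜.proj b) := hd.trans h
  have hdb' : 𝒳.s (𝒜.proj d) = 𝒳.r (𝒜.proj b) := by rw [hd, hX.s_s, h]
  have hn : 𝒜.nrm d = 𝒜.nrm a := by
    refine (sq_eq_sq₀ (norm_nonneg _) (norm_nonneg _)).1 ?_
    exact (H.nrm_adj_mul d h').symm.trans ((congrArg 𝒜.nrm hda.symm).trans (H.nrm_adj_mul a (hs a)))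
  refine le_trans (le_of_eq ?_) ((H.nrm_unit_mul_le d b hdb hdb').trans_eq (by rw [hn]))
  refine (sq_eq_sq₀ (norm_nonneg _) (norm_nonneg _)).1 ?_
  change 𝒜.nrm _ ^ 2 = 𝒜.nrm _ ^ 2
  have h₁ (c : A) (hc : 𝒳.s (𝒜.proj c) = 𝒳.r (𝒜.proj b)) :
      𝒳.s (𝒜.proj (𝒜.mul (𝒜.adj c) c (hs c))) = 𝒳.r (𝒜.proj b) := by
    rw [H.proj_mul, hX.s_mul, hc]
  have h₂ (c : A) (hc : 𝒳.s (𝒜.proj c) = 𝒳.r (𝒜.proj b)) : 𝒳.s (𝒜.proj (𝒜.adj b)) =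
      𝒳.r (𝒜.proj (𝒜.mul (𝒜.mul (𝒜.adj c) c (hs c)) b (h₁ c hc))) := by
    rw [H.proj_mul, hX.r_mul, H.proj_mul, hX.r_mul, hs, hr, hc]
  rw [← H.nrm_adj_mul _ (hs _), ← H.nrm_adj_mul _ (hs _), key a h _ (h₁ a h) (h₂ a h),
    key d hdb' _ (h₁ d hdb') (h₂ d hdb')]
  congr 1
  exact 𝒜.mul_congr rfl (𝒜.mul_congr hda rfl _ _) _ _

end IsFellBundle

end

/-! ### Banach bundles: joint continuity of scalars and a criterion for separability. -/

section

namespace BanachFamily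

variable {A X : Type*} (ℰ : BanachFamily A X)

theorem add_congr {a a' b b' : A} (ha : a = a') (hb : b = b') (h : ℰ.proj a = ℰ.proj b)
    (h' : ℰ.proj a' = ℰ.proj b') : ℰ.add a b h = ℰ.add a' b' h' := by
  subst ha hb
  rfl

theorem proj_add (a b : A) (h : ℰ.proj a = ℰ.proj b) : ℰ.proj (ℰ.add a b h) = ℰ.proj b :=
  (ℰ.fib a h + ℰ.elt b).2

theorem proj_smul (c : ℂ) (a : A) : ℰ.proj (ℰ.smul c a) = ℰ.proj a := (c • ℰ.elt a).2

theorem proj_zero (x : X) : ℰ.proj (ℰ.zero x) = x := (0 : ℰ.Fibre x).2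

theorem nrm_nonneg (a : A) : 0 ≤ ℰ.nrm a := norm_nonneg (ℰ.elt a)

theorem nrm_smul (c : ℂ) (a : A) : ℰ.nrm (ℰ.smul c a) = ‖c‖ * ℰ.nrm a :=
  (ℰ.norm_val (c • ℰ.elt a)).symm.trans (norm_smul c (ℰ.elt a))

theorem add_zero (a : A) {x : X} (h : ℰ.proj a = ℰ.proj (ℰ.zero x)) :
    ℰ.add a (ℰ.zero x) h = a := by
  obtain rfl : ℰ.proj a = x := h.trans (ℰ.proj_zero x)
  exact (ℰ.add_val (ℰ.elt a) 0).symm.trans (congrArg Subtype.val (_root_.add_zero (ℰ.elt a)))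

theorem add_smul_smul (c d : ℂ) (a : A) (h : ℰ.proj (ℰ.smul c a) = ℰ.proj (ℰ.smul d a)) :
    ℰ.add (ℰ.smul c a) (ℰ.smul d a) h = ℰ.smul (c + d) a :=
  (ℰ.add_val (c • ℰ.elt a) (d • ℰ.elt a)).symm.trans
    (congrArg Subtype.val (_root_.add_smul c d (ℰ.elt a)).symm)

theorem norm_fib_sub_fib {x : X} {a b : A} (ha : ℰ.proj a = x) (hb : ℰ.proj b = x)
    (h : ℰ.proj a = ℰ.proj (ℰ.smul (-1) b)) :
    ‖ℰ.fib a ha - ℰ.fib b hb‖ = ℰ.nrm (ℰ.add a (ℰ.smul (-1) b) h) := by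
  subst hb
  have h₁ : ℰ.fib a ha - ℰ.fib b rfl = ℰ.fib a ha + (-1 : ℂ) • ℰ.elt b := by
    rw [neg_one_smul, sub_eq_add_neg]; rfl
  rw [h₁, ℰ.norm_val, ℰ.add_val]
  rfl

variable [TopologicalSpace A] [TopologicalSpace X] {ℰ}

theorem IsBanachBundle.continuous_add' (h : ℰ.IsBanachBundle) {Z : Type*} [TopologicalSpace Z]
    {f g : Z → A} (hf : Continuous f) (hg : Continuous g)
    (hfg : ∀ z, ℰ.proj (f z) = ℰ.proj (g z)) :
    Continuous fun z => ℰ.add (f z) (g z) (hfg z) :=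
  h.continuous_add.comp ((hf.prodMk hg).subtype_mk hfg)

/-- The norm is only upper semicontinuous, but strict upper bounds are open conditions, and no more
is needed for uniform estimates over compact sets. -/
theorem IsBanachBundle.isOpen_norm_sub_lt (h : ℰ.IsBanachBundle) {Z : Type*} [TopologicalSpace Z]
    {f g : Z → A} {q : Z → X} (hf : Continuous f) (hg : Continuous g)
    (hfq : ∀ z, ℰ.proj (f z) = q z) (hgq : ∀ z, ℰ.proj (g z) = q z) (ε : ℝ) :
    IsOpen {z | ‖ℰ.fib (f z) (hfq z) - ℰ.fib (g z) (hgq z)‖ < ε} := by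
  have h₁ (z : Z) : ℰ.proj (f z) = ℰ.proj (ℰ.smul (-1) (g z)) := by
    rw [proj_smul, hfq, hgq]
  simp only [ℰ.norm_fib_sub_fib _ _ (h₁ _)]
  exact (upperSemicontinuous_iff_isOpen_preimage.1 h.upperSemicontinuous_nrm ε).preimage
    (h.continuous_add' hf ((h.continuous_smul _).comp hg) h₁)

/-- Continuity is assumed for each fixed scalar only. Write ca = c₀a + (c − c₀)a; the second term
tends to zero by the zero axiom, since the norm of a is locally bounded by upper semicontinuity. -/
theorem IsBanachBundle.continuous_smul' (h : ℰ.IsBanachBundle) :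
    Continuous fun z : ℂ × A => ℰ.smul z.1 z.2 := by
  rw [continuous_iff_continuousAt]
  rintro ⟨c₀, a₀⟩
  have h₁ : Tendsto (fun z : ℂ × A => ℰ.smul (z.1 - c₀) z.2) (𝓝 (c₀, a₀))
      (𝓝 (ℰ.zero (ℰ.proj a₀))) := by
    refine h.tendsto_zero (map _ _) _ (tendsto_map'_iff.2 ?_) (tendsto_map'_iff.2 ?_)
    · refine ((h.continuous_proj.comp continuous_snd).tendsto (c₀, a₀)).congr fun z => ?_
      exact (ℰ.proj_smul _ _).symm
    · have h₂ : Tendsto (fun z : ℂ × A => ‖z.1 - c₀‖ * (ℰ.nrm a₀ + 1)) (𝓝 (c₀, a₀)) (𝓝 0) := by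
        have : Continuous fun z : ℂ × A => ‖z.1 - c₀‖ * (ℰ.nrm a₀ + 1) := by fun_prop
        simpa using this.tendsto (c₀, a₀)
      refine squeeze_zero' (Eventually.of_forall fun z => ℰ.nrm_nonneg _) ?_ h₂
      have h₃ := (continuous_snd.tendsto (c₀, a₀)).eventually
        (h.upperSemicontinuous_nrm a₀ _ (lt_add_one (ℰ.nrm a₀)))
      filter_upwards [h₃] with z hz
      change ℰ.nrm _ ≤ _
      rw [nrm_smul]
      exact mul_le_mul_of_nonneg_left hz.le (norm_nonneg _)
  have h₂ (z : ℂ × A) : ℰ.proj (ℰ.smul c₀ z.2) = ℰ.proj (ℰ.smul (z.1 - c₀) z.2) := by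
    rw [proj_smul, proj_smul]
  have h₃ : ℰ.proj (ℰ.smul c₀ a₀) = ℰ.proj (ℰ.zero (ℰ.proj a₀)) := by
    rw [proj_smul, proj_zero]
  have h₄ : Tendsto (fun z : ℂ × A => (⟨(ℰ.smul c₀ z.2, ℰ.smul (z.1 - c₀) z.2), h₂ z⟩ :
      {z : A × A // ℰ.proj z.1 = ℰ.proj z.2})) (𝓝 (c₀, a₀))
      (𝓝 ⟨(ℰ.smul c₀ a₀, ℰ.zero (ℰ.proj a₀)), h₃⟩) :=
    tendsto_subtype_rng.2 ((((h.continuous_smul c₀).comp continuous_snd).tendsto _).prodMk_nhds h₁)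
  have h₅ := (h.continuous_add.tendsto _).comp h₄
  have h₆ : ℰ.add (ℰ.smul c₀ a₀) (ℰ.zero (ℰ.proj a₀)) h₃ = ℰ.smul c₀ a₀ := ℰ.add_zero _ _
  change Tendsto _ _ (𝓝 (ℰ.smul c₀ a₀))
  rw [← h₆]
  refine h₅.congr fun z => ?_
  exact (ℰ.add_smul_smul _ _ _ (h₂ z)).trans (by rw [add_sub_cancel])

/-- A Banach bundle is separable if, for every `ε > 0`, its sections can be sorted into countably
many (possibly overlapping) classes of diameter less than `ε`. -/
theorem isSeparable_of_countable_classes {ι : Type*} [Countable ι]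
    (R : ℝ → C0Section ℰ → ι → Prop) (hR : ∀ ε, 0 < ε → ∀ f, ∃ i, R ε f i)
    (hd : ∀ ε, 0 < ε → ∀ f g i, R ε f i → R ε g i → ∀ x, ‖f.eval x - g.eval x‖ < ε) :
    ℰ.IsSeparable := by
  -- One section is picked from each nonempty class at each scale 1/(n + 1), so no dense family has
  -- to be constructed by hand.
  let S : Set (ℕ × ι) := {p | ∃ f, R (1 / (p.1 + 1)) f p.2}
  refine ⟨Set.range fun p : S => p.2.choose, Set.countable_range _, fun f ε hε => ?_⟩
  obtain ⟨n, hn⟩ := exists_nat_one_div_lt hε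
  have hn' : (0 : ℝ) < 1 / (n + 1) := by positivity
  obtain ⟨i, hi⟩ := hR _ hn' f
  have hp : (n, i) ∈ S := ⟨f, hi⟩
  exact ⟨_, ⟨⟨_, hp⟩, rfl⟩, fun x => (hd _ hn' _ _ _ hi hp.choose_spec x).trans hn⟩

end BanachFamily

end

/-! ### The semidirect-product Fell bundle. -/

section

namespace IsPreFellBundle

variable {X A : Type*} [TopologicalSpace X] [TopologicalSpace A] {𝒳 : GroupoidOps X}
  {𝒜 : FellOps 𝒳 A}

theorem continuous_mul' (h : IsPreFellBundle 𝒜) {Z : Type*} [TopologicalSpace Z] {f g : Z → A}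
    (hf : Continuous f) (hg : Continuous g)
    (hfg : ∀ z, 𝒳.s (𝒜.proj (f z)) = 𝒳.r (𝒜.proj (g z))) :
    Continuous fun z => 𝒜.mul (f z) (g z) (hfg z) :=
  h.continuous_mul.comp ((hf.prodMk hg).subtype_mk hfg)

end IsPreFellBundle

variable {G X A : Type*} [Group G] [MulAction G X] [MulAction G A] [TopologicalSpace G]
  [TopologicalSpace X] [TopologicalSpace A] {𝒳 : GroupoidOps X} {𝒜 : FellOps 𝒳 A}

theorem IsFellAction.comp_smul (H : IsFellAction G 𝒜) {z w : A × G}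
    (h : (semidirectGroupoid H.base).s ((semidirectBundle H).proj z) =
      (semidirectGroupoid H.base).r ((semidirectBundle H).proj w)) :
    𝒳.s (𝒜.proj z.1) = 𝒳.r (𝒜.proj (z.2 • w.1)) := by
  rw [H.proj_smul]
  exact H.base.comp_smul h

theorem semidirectBundle_adj (H : IsFellAction G 𝒜) (z : A × G) :
    (semidirectBundle H).adj z = (z.2⁻¹ • 𝒜.adj z.1, z.2⁻¹) := rfl

theorem isBanachBundle_semidirectBundle (H : IsFellAction G 𝒜) (h : 𝒜.IsBanachBundle) :
    (semidirectBundle H).IsBanachBundle where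
  continuous_proj := h.continuous_proj.prodMap continuous_id
  isOpenMap_proj := h.isOpenMap_proj.prodMap IsOpenMap.id
  upperSemicontinuous_nrm := h.upperSemicontinuous_nrm.comp continuous_fst
  continuous_add := by
    have h₁ : Continuous fun z : {z : (A × G) × (A × G) //
        (semidirectBundle H).proj z.1 = (semidirectBundle H).proj z.2} => z.1.1 :=
      continuous_fst.comp continuous_subtype_val
    have h₂ : Continuous fun z : {z : (A × G) × (A × G) //
        (semidirectBundle H).proj z.1 = (semidirectBundle H).proj z.2} => z.1.2 :=
      continuous_snd.comp continuous_subtype_val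
    exact (h.continuous_add' h₁.fst h₂.fst _).prodMk h₂.snd
  continuous_smul c := ((h.continuous_smul c).comp continuous_fst).prodMk continuous_snd
  tendsto_zero l w hl hn := by
    rw [nhds_prod_eq] at hl
    have h₁ := h.tendsto_zero (map Prod.fst l) w.1 (tendsto_map'_iff.2 (tendsto_fst.comp hl))
      (tendsto_map'_iff.2 hn)
    change l ≤ 𝓝 (𝒜.zero w.1, w.2)
    rw [nhds_prod_eq]
    have h₂ : Tendsto Prod.snd l (𝓝 w.2) :=
      (tendsto_snd (f := 𝓝 w.1)).comp (f := (semidirectBundle H).proj) hl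
    have h₃ : Tendsto Prod.fst l (𝓝 (𝒜.zero w.1)) := h₁
    exact h₃.prodMk h₂

section Separable

/-- The restriction of a section of the semidirect-product bundle to `X × {t}`. -/
def semidirectSlice (H : IsFellAction G 𝒜) (F : BanachFamily.C0Section
    (semidirectBundle H).toBanachFamily) (t : G) : BanachFamily.C0Section 𝒜.toBanachFamily where
  toFun x := (F.toFun (x, t)).1
  proj_toFun x := congrArg Prod.fst (F.proj_toFun (x, t))
  continuous_toFun := continuous_fst.comp
    (F.continuous_toFun.comp (continuous_id.prodMk continuous_const))
  vanishing ε hε := by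
    obtain ⟨K, hK, hF⟩ := F.vanishing ε hε
    exact ⟨Prod.fst '' K, hK.image continuous_fst, fun x hx =>
      hF (x, t) fun h => hx ⟨_, h, rfl⟩⟩

theorem norm_eval_sub_semidirect (H : IsFellAction G 𝒜) (F F' : BanachFamily.C0Section
    (semidirectBundle H).toBanachFamily) (x : X) (t : G) :
    ‖F.eval (x, t) - F'.eval (x, t)‖ =
      ‖(semidirectSlice H F t).eval x - (semidirectSlice H F' t).eval x‖ := rfl

/-- The slices of a section vary continuously in the supremum norm. Over the projection of a compact
set off which the section is small this is the tube lemma; elsewhere both slices are below ε/2. -/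
theorem exists_nhds_norm_semidirectSlice_sub_lt (H : IsFellAction G 𝒜) (h : 𝒜.IsBanachBundle)
    (F : BanachFamily.C0Section (semidirectBundle H).toBanachFamily) (t : G) {ε : ℝ}
    (hε : 0 < ε) : ∃ V ∈ 𝓝 t, ∀ t' ∈ V, ∀ x,
      ‖(semidirectSlice H F t').eval x - (semidirectSlice H F t).eval x‖ < ε := by
  obtain ⟨K, hK, hF⟩ := F.vanishing (ε / 2) (half_pos hε)
  have hO := h.isOpen_norm_sub_lt (Z := X × G) (f := fun z => (F.toFun z).1)
    (g := fun z => (F.toFun (z.1, t)).1) (q := Prod.fst)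
    (continuous_fst.comp F.continuous_toFun)
    (continuous_fst.comp (F.continuous_toFun.comp (continuous_fst.prodMk continuous_const)))
    (fun z => congrArg Prod.fst (F.proj_toFun z))
    (fun z => congrArg Prod.fst (F.proj_toFun (z.1, t))) ε
  obtain ⟨U, V, -, hV, hKU, htV, hUV⟩ := generalized_tube_lemma (hK.image continuous_fst)
    (isCompact_singleton (x := t)) hO (by
      rintro ⟨x, t'⟩ ⟨-, ht'⟩
      obtain rfl : t' = t := ht'
      simpa using hε)
  refine ⟨V, hV.mem_nhds (htV rfl), fun t' ht' x => ?_⟩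
  by_cases hx : x ∈ Prod.fst '' K
  · exact hUV (Set.mk_mem_prod (hKU hx) ht')
  · have h₁ (u : G) : ‖(semidirectSlice H F u).eval x‖ < ε / 2 := by
      rw [𝒜.norm_val]
      exact hF (x, u) fun h => hx ⟨_, h, rfl⟩
    linarith [norm_sub_le ((semidirectSlice H F t').eval x) ((semidirectSlice H F t).eval x),
      h₁ t, h₁ t']

theorem isSeparable_semidirectBundle [LocallyCompactSpace G]
    [SecondCountableTopology G] (H : IsFellAction G 𝒜) (h : 𝒜.IsBanachBundle)
    (hs : 𝒜.IsSeparable) : (semidirectBundle H).IsSeparable := by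
  obtain ⟨D, hDc, hD⟩ := hs
  have : Countable D := hDc
  have : Countable (TopologicalSpace.countableBasis G) :=
    TopologicalSpace.countable_countableBasis G
  let L := CompactExhaustion.choice G
  -- A class is given by an index n and a finite set of pairs of a basic open set of G and an
  -- element of D. The slices are small off the n-th compact set, the open sets cover that compact
  -- set, and over each of them the slices stay within ε/2 of the paired section.
  refine BanachFamily.isSeparable_of_countable_classes
    (ι := ℕ × Finset (TopologicalSpace.countableBasis G × D)) (fun ε F i =>
      (∀ t ∉ L i.1, ∀ x, ‖(semidirectSlice H F t).eval x‖ < ε / 2) ∧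
      (∀ t ∈ L i.1, ∃ p ∈ i.2, t ∈ p.1.1) ∧
      ∀ p ∈ i.2, ∀ t ∈ p.1.1, ∀ x, ‖(semidirectSlice H F t).eval x - p.2.1.eval x‖ < ε / 2)
    (fun ε hε F => ?_) (fun ε hε F F' i hF hF' => ?_)
  · obtain ⟨K, hK, hFK⟩ := F.vanishing (ε / 2) (half_pos hε)
    obtain ⟨n, hn⟩ := L.exists_superset_of_isCompact (hK.image continuous_snd)
    have key (t : G) : ∃ p : TopologicalSpace.countableBasis G × D, t ∈ p.1.1 ∧
        ∀ u ∈ p.1.1, ∀ x, ‖(semidirectSlice H F u).eval x - p.2.1.eval x‖ < ε / 2 := by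
      -- One quarter of ε is for approximating the slice at t, another for the variation of slices
      -- near t.
      obtain ⟨d, hd, hdt⟩ := hD (semidirectSlice H F t) (ε / 4) (by positivity)
      obtain ⟨V, hV, hVt⟩ := exists_nhds_norm_semidirectSlice_sub_lt H h F t
        (ε := ε / 4) (by positivity)
      obtain ⟨B, hB, htB, hBV⟩ :=
        (TopologicalSpace.isBasis_countableBasis G).mem_nhds_iff.1 hV
      refine ⟨(⟨B, hB⟩, ⟨d, hd⟩), htB, fun u hu x => ?_⟩
      linarith [norm_sub_le_norm_sub_add_norm_sub ((semidirectSlice H F u).eval x)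
        ((semidirectSlice H F t).eval x) (d.eval x), hVt u (hBV hu) x, hdt x]
    choose p hp hp' using key
    obtain ⟨s, -, hs⟩ := (L.isCompact n).elim_nhds_subcover (fun t => (p t).1.1) fun t _ =>
      (TopologicalSpace.isOpen_of_mem_countableBasis (p t).1.2).mem_nhds (hp t)
    classical
    refine ⟨(n, s.image p), fun t ht x => ?_, fun t ht => ?_, fun q hq => ?_⟩
    · rw [𝒜.norm_val]
      exact hFK (x, t) fun hx => ht (hn ⟨_, hx, rfl⟩)
    · obtain ⟨u, hu, htu⟩ := Set.mem_iUnion₂.1 (hs ht)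
      exact ⟨p u, Finset.mem_image_of_mem p hu, htu⟩
    · obtain ⟨u, -, rfl⟩ := Finset.mem_image.1 hq
      exact hp' u
  · rintro ⟨x, t⟩
    rw [norm_eval_sub_semidirect]
    by_cases ht : t ∈ L i.1
    · obtain ⟨p, hp, htp⟩ := hF.2.1 t ht
      have h₁ := hF.2.2 p hp t htp x
      have h₂ := hF'.2.2 p hp t htp x
      rw [norm_sub_rev] at h₂
      linarith [norm_sub_le_norm_sub_add_norm_sub ((semidirectSlice H F t).eval x)
        (p.2.1.eval x) ((semidirectSlice H F' t).eval x)]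
    · linarith [hF.1 t ht x, hF'.1 t ht x, norm_sub_le ((semidirectSlice H F t).eval x)
        ((semidirectSlice H F' t).eval x)]

end Separable

theorem isPreFellBundle_semidirectBundle [IsTopologicalGroup G] [LocallyCompactSpace G] [T2Space G]
    [SecondCountableTopology G] (H : IsFellAction G 𝒜) (h𝒜 : IsFellBundle 𝒜) :
    IsPreFellBundle (semidirectBundle H) where
  isLCGroupoid := semidirectGroupoid_isLCGroupoid H.base h𝒜.isLCGroupoid
  isBanachBundle := isBanachBundle_semidirectBundle H h𝒜.isBanachBundle
  isSeparable := isSeparable_semidirectBundle H h𝒜.isBanachBundle h𝒜.isSeparable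
  proj_mul z w h := Prod.ext ((h𝒜.proj_mul _ _ (H.comp_smul h)).trans
    (𝒳.mul_congr rfl (H.proj_smul _ _) _ _)) rfl
  proj_adj z := Prod.ext ((H.proj_smul _ _).trans (congrArg _ (h𝒜.proj_adj z.1))) rfl
  add_mul := by
    rintro ⟨a, t⟩ ⟨a', t'⟩ ⟨b, u⟩ h h₁ h₂ h₃ h₄
    obtain rfl : t = t' := congrArg Prod.snd h
    exact Prod.ext (h𝒜.add_mul a a' (t • b) _ _ _ _ _) rfl
  mul_add := by
    rintro ⟨a, t⟩ ⟨b, u⟩ ⟨b', u'⟩ h h₁ h₂ h₃ h₄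
    have hb : 𝒜.proj b = 𝒜.proj b' := congrArg Prod.fst h
    have hb' : 𝒜.proj (t • b) = 𝒜.proj (t • b') := by rw [H.proj_smul, hb, H.proj_smul]
    have h₅ : 𝒳.s (𝒜.proj a) = 𝒳.r (𝒜.proj (𝒜.add (t • b) (t • b') hb')) := by
      rw [𝒜.proj_add]; exact H.comp_smul h₃
    exact Prod.ext ((𝒜.mul_congr rfl (H.add_smul t b b' hb hb').symm (H.comp_smul h₁) h₅).trans
      (h𝒜.mul_add _ _ _ _ _ _ _ _)) rfl
  smul_mul c z w h h₁ := Prod.ext (h𝒜.smul_mul _ _ _ (H.comp_smul h) (H.comp_smul h₁)) rfl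
  mul_smul c z w h h₁ := by
    have h₂ : 𝒳.s (𝒜.proj z.1) = 𝒳.r (𝒜.proj (𝒜.smul c (z.2 • w.1))) := by
      rw [𝒜.proj_smul]; exact H.comp_smul h
    exact Prod.ext ((𝒜.mul_congr rfl (H.smul_smul z.2 c w.1).symm (H.comp_smul h₁) h₂).trans
      (h𝒜.mul_smul _ _ _ (H.comp_smul h) _)) rfl
  mul_assoc := by
    rintro ⟨a, t⟩ ⟨b, u⟩ ⟨c, v⟩ hab hbc h₁ h₂
    refine Prod.ext ?_ (mul_assoc t u v)
    have h₃ := H.comp_smul hab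
    have h₄ := H.comp_smul hbc
    have h₅ : 𝒳.s (𝒜.proj (t • b)) = 𝒳.r (𝒜.proj (t • u • c)) := by
      rw [H.proj_smul, H.base.s_smul, h₄, H.proj_smul t, H.base.r_smul]
    have h₆ : 𝒳.s (𝒜.proj (𝒜.mul a (t • b) h₃)) = 𝒳.r (𝒜.proj (t • u • c)) := by
      rw [h𝒜.proj_mul, h𝒜.isLCGroupoid.s_mul, h₅]
    have h₇ : 𝒳.s (𝒜.proj a) = 𝒳.r (𝒜.proj (𝒜.mul (t • b) (t • u • c) h₅)) := by
      rw [h𝒜.proj_mul, h𝒜.isLCGroupoid.r_mul, h₃]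
    exact (𝒜.mul_congr rfl (mul_smul t u c) (H.comp_smul h₁) h₆).trans
      ((h𝒜.mul_assoc _ _ _ _ _ _ h₇).trans
        (𝒜.mul_congr rfl (H.mul_smul t b (u • c) h₄ h₅) _ (H.comp_smul h₂)))
  adj_adj z := Prod.ext (by
    simp only [semidirectBundle_adj]
    rw [H.adj_smul, h𝒜.adj_adj, inv_inv, smul_inv_smul]) (inv_inv _)
  adj_add := by
    rintro ⟨a, t⟩ ⟨b, u⟩ h h₁
    obtain rfl : t = u := congrArg Prod.snd h
    have h₂ : 𝒜.proj a = 𝒜.proj b := congrArg Prod.fst h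
    have h₃ : 𝒜.proj (𝒜.adj a) = 𝒜.proj (𝒜.adj b) := by rw [h𝒜.proj_adj, h₂, h𝒜.proj_adj]
    have h₄ : 𝒜.proj (t⁻¹ • 𝒜.adj a) = 𝒜.proj (t⁻¹ • 𝒜.adj b) := by
      rw [H.proj_smul, h₃, H.proj_smul]
    exact Prod.ext ((congrArg (t⁻¹ • ·) (h𝒜.adj_add a b h₂ h₃)).trans
      (H.add_smul _ _ _ h₃ h₄).symm) rfl
  adj_smul c z := Prod.ext ((congrArg (z.2⁻¹ • ·) (h𝒜.adj_smul c z.1)).trans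
    (H.smul_smul _ _ _).symm) rfl
  adj_mul := by
    rintro ⟨a, t⟩ ⟨b, u⟩ h h₁
    refine Prod.ext ?_ (mul_inv_rev t u)
    have h₂ := H.comp_smul h
    have hX := h𝒜.isLCGroupoid
    have h₃ : 𝒳.s (𝒜.proj (𝒜.adj (t • b))) = 𝒳.r (𝒜.proj (𝒜.adj a)) := by
      rw [h𝒜.proj_adj, h𝒜.proj_adj, hX.s_inv, hX.r_inv, h₂]
    have h₄ : 𝒳.s (𝒜.proj ((t * u)⁻¹ • 𝒜.adj (t • b))) =
        𝒳.r (𝒜.proj ((t * u)⁻¹ • 𝒜.adj a)) := by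
      rw [H.proj_smul, H.base.s_smul, h₃, H.proj_smul, H.base.r_smul]
    refine (congrArg ((t * u)⁻¹ • ·) (h𝒜.adj_mul a (t • b) h₂ h₃)).trans
      ((H.mul_smul _ _ _ h₃ h₄).symm.trans (𝒜.mul_congr ?_ ?_ _ (H.comp_smul h₁)))
    · rw [H.adj_smul, mul_inv_rev, mul_smul, inv_smul_smul]
      rfl
    · rw [mul_inv_rev, mul_smul]
      rfl
  continuous_mul := by
    have h₁ : Continuous fun z : {z : (A × G) × (A × G) //
        (semidirectGroupoid H.base).s ((semidirectBundle H).proj z.1) =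
          (semidirectGroupoid H.base).r ((semidirectBundle H).proj z.2)} => z.1.1 :=
      continuous_fst.comp continuous_subtype_val
    have h₂ : Continuous fun z : {z : (A × G) × (A × G) //
        (semidirectGroupoid H.base).s ((semidirectBundle H).proj z.1) =
          (semidirectGroupoid H.base).r ((semidirectBundle H).proj z.2)} => z.1.2 :=
      continuous_snd.comp continuous_subtype_val
    exact (h𝒜.continuous_mul' h₁.fst (H.continuous_smul.comp (h₁.snd.prodMk h₂.fst)) _).prodMk
      (h₁.snd.mul h₂.snd)
  continuous_adj := (H.continuous_smul.comp (continuous_snd.inv.prodMk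
    (h𝒜.continuous_adj.comp continuous_fst))).prodMk continuous_snd.inv
  nrm_mul_le u hu z w hz hw h := by
    -- The estimate for arbitrary composable elements applies, so the group components over the unit
    -- need not be identified with 1 first.
    refine (h𝒜.nrm_mul_le_mul z.1 (z.2 • w.1) (H.comp_smul h)).trans_eq ?_
    rw [H.nrm_smul]
    rfl
  nrm_adj_mul_self u hu z hz h := by
    have h₁ : 𝒳.s (𝒜.proj (𝒜.adj z.1)) = 𝒳.r (𝒜.proj z.1) := by
      rw [h𝒜.proj_adj, h𝒜.isLCGroupoid.s_inv]
    refine (congrArg 𝒜.nrm (H.mul_smul z.2⁻¹ (𝒜.adj z.1) z.1 h₁ (H.comp_smul h))).trans ?_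
    rw [H.nrm_smul, h𝒜.nrm_adj_mul, sq]
    rfl

/-- The isomorphism of fibres over units given by an element of the group. -/
def semidirectUnitFibreMap (H : IsFellAction G 𝒜) (t : G) {u : X} {w : X × G}
    (hw : (t • u, 1) = w) (b : 𝒜.Fibre u) : (semidirectBundle H).Fibre w :=
  ⟨(t • b.1, 1), hw ▸ Prod.ext ((H.proj_smul t b.1).trans (congrArg (t • ·) b.2)) rfl⟩

/-- Each element of G acts by isometric *-isomorphisms between fibres over units, and adjoining the
group component 1 changes nothing. The equation for w allows the ranges and sources of arrows to be
used in the form in which they arise. -/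
theorem isCStarIso_semidirectUnitFibreMap (H : IsFellAction G 𝒜) (h𝒜 : IsPreFellBundle 𝒜)
    (hS : IsPreFellBundle (semidirectBundle H)) (t : G) {u : X} {w : X × G}
    (hw : (t • u, 1) = w) (hu : 𝒳.IsIdentity u) (hu' : (semidirectGroupoid H.base).IsIdentity w) :
    letI := h𝒜.cstar hu
    letI := hS.cstar hu'
    IsCStarIso (semidirectUnitFibreMap H t hw) := by
  let := h𝒜.cstar hu
  let := hS.cstar hu'
  subst hw
  constructor
  · rintro ⟨⟨b, v⟩, hb⟩
    obtain rfl : v = 1 := congrArg Prod.snd hb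
    have hb' : 𝒜.proj b = t • u := congrArg Prod.fst hb
    exact ⟨⟨t⁻¹ • b, by rw [H.proj_smul, hb', inv_smul_smul]⟩,
      Subtype.ext (Prod.ext (smul_inv_smul _ _) rfl)⟩
  · intro a b
    have hab : 𝒜.proj a.1 = 𝒜.proj b.1 := a.2.trans b.2.symm
    have hab' : 𝒜.proj (t • a.1) = 𝒜.proj (t • b.1) := by rw [H.proj_smul, hab, H.proj_smul]
    have hb : 𝒜.proj (t • b.1) = t • u := by rw [H.proj_smul, b.2]
    refine Subtype.ext (Prod.ext ?_ rfl)
    exact (congrArg (t • ·) (𝒜.add_val a b)).trans ((H.add_smul t a.1 b.1 hab hab').symm.trans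
      (𝒜.add_val (⟨t • a.1, hab'.trans hb⟩ : 𝒜.Fibre (t • u)) ⟨t • b.1, hb⟩).symm)
  · intro c a
    have ha : 𝒜.proj (t • a.1) = t • u := by rw [H.proj_smul, a.2]
    refine Subtype.ext (Prod.ext ?_ rfl)
    exact (congrArg (t • ·) (𝒜.smul_val c a)).trans ((H.smul_smul t c a.1).symm.trans
      (𝒜.smul_val c (⟨t • a.1, ha⟩ : 𝒜.Fibre (t • u))).symm)
  · intro a b
    refine Subtype.ext (Prod.ext ?_ (mul_one 1).symm)
    have hab : 𝒳.s (𝒜.proj a.1) = 𝒳.r (𝒜.proj b.1) := by rw [a.2, b.2, hu.1, hu.2]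
    refine (H.mul_smul t a.1 b.1 hab ?_).symm.trans (𝒜.mul_congr rfl (one_smul G _).symm _ _)
    rw [H.proj_smul, H.base.s_smul, hab, H.proj_smul, H.base.r_smul]
  · intro a
    refine Subtype.ext (Prod.ext ?_ inv_one.symm)
    refine (H.adj_smul t a.1).symm.trans ?_
    exact ((congrArg (· • 𝒜.adj (t • a.1)) inv_one).trans (one_smul G _)).symm
  · intro a
    exact ((semidirectBundle H).norm_val _).trans ((H.nrm_smul t a.1).trans (𝒜.norm_val a).symm)

theorem isFellBundle_semidirectBundle [IsTopologicalGroup G] [LocallyCompactSpace G] [T2Space G]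
    [SecondCountableTopology G] (H : IsFellAction G 𝒜) (h𝒜 : IsFellBundle 𝒜) :
    IsFellBundle (semidirectBundle H) where
  toIsPreFellBundle := isPreFellBundle_semidirectBundle H h𝒜
  fibreImprimitivity := by
    rintro ⟨x, t⟩
    have hS := isPreFellBundle_semidirectBundle H h𝒜
    have hX := h𝒜.isLCGroupoid
    let := h𝒜.cstar (hX.isIdentity_r x)
    let := h𝒜.cstar (hX.isIdentity_s x)
    let := hS.cstar (hS.isLCGroupoid.isIdentity_r (x, t))
    let := hS.cstar (hS.isLCGroupoid.isIdentity_s (x, t))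
    have h₁ : ((1 : G) • 𝒳.r x, (1 : G)) = (semidirectGroupoid H.base).r (x, t) :=
      Prod.ext (one_smul _ _) rfl
    -- The fibre over (x, t) is A(x) with label t. Its source unit is (t⁻¹·s(x), 1), so the right
    -- coefficients are translated by t⁻¹; the right action translates them back by t.
    refine IsImprimitivityBimodule.transport (h𝒜.fibreImprimitivity x)
      (φ := semidirectUnitFibreMap H 1 h₁) (χ := semidirectUnitFibreMap H t⁻¹ rfl)
      (ψ := fun e => ⟨(e.1, t), Prod.ext e.2 rfl⟩)
      (isCStarIso_semidirectUnitFibreMap H h𝒜.toIsPreFellBundle hS _ _ _ _)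
      (isCStarIso_semidirectUnitFibreMap H h𝒜.toIsPreFellBundle hS _ _ _ _) ?_ ?_ ?_ ?_ ?_ ?_ ?_ ?_
    · rintro ⟨⟨e, v⟩, he⟩
      obtain rfl : v = t := congrArg Prod.snd he
      exact ⟨⟨e, congrArg Prod.fst he⟩, rfl⟩
    · exact fun e f => rfl
    · exact fun c e => rfl
    · intro e
      exact ((semidirectBundle H).norm_val _).trans (𝒜.norm_val e).symm
    · intro b e
      refine Subtype.ext (Prod.ext ?_ (one_mul t))
      exact 𝒜.mul_congr (one_smul G _) (one_smul G _) _ _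
    · intro e c
      refine Subtype.ext (Prod.ext ?_ (mul_one t))
      exact 𝒜.mul_congr rfl (smul_inv_smul t _) _ _
    · intro e f
      refine Subtype.ext (Prod.ext ?_ (mul_inv_cancel t))
      exact (𝒜.mul_congr rfl (smul_inv_smul t _) _ _).trans (one_smul G _).symm
    · intro e f
      refine Subtype.ext (Prod.ext ?_ (inv_mul_cancel t))
      exact H.mul_smul _ _ _ _ _

end

/-! ### The orbit Fell bundle. -/

section

namespace BanachFamily

variable {A X : Type*} {ℰ : BanachFamily A X}

theorem zero_smul (a : A) : ℰ.smul 0 a = ℰ.zero (ℰ.proj a) :=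
  congrArg Subtype.val (_root_.zero_smul ℂ (ℰ.elt a))

/-- The filter axiom at zero is applied to the coarsest filter that satisfies its hypotheses, which
yields tubes of vectors of small norm as neighbourhoods inside U. -/
theorem IsBanachBundle.exists_nhds_zero [TopologicalSpace A] [TopologicalSpace X]
    (h : ℰ.IsBanachBundle) {x : X} {U : Set A} (hU : U ∈ 𝓝 (ℰ.zero x)) :
    ∃ V ∈ 𝓝 x, ∃ ε : ℝ, 0 < ε ∧ ∀ a, ℰ.proj a ∈ V → ℰ.nrm a < ε → a ∈ U := by
  have h₁ := h.tendsto_zero (comap ℰ.proj (𝓝 x) ⊓ comap ℰ.nrm (𝓝 0)) x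
    (tendsto_comap.mono_left inf_le_left) (tendsto_comap.mono_left inf_le_right) hU
  obtain ⟨⟨V, ε⟩, ⟨hV, hε⟩, hVU⟩ := (((𝓝 x).basis_sets.comap ℰ.proj).inf
    (Metric.nhds_basis_ball.comap ℰ.nrm)).mem_iff.1 h₁
  refine ⟨V, hV, ε, hε, fun a ha hn => hVU ⟨ha, ?_⟩⟩
  rw [Set.mem_preimage, mem_ball_zero_iff, Real.norm_of_nonneg (ℰ.nrm_nonneg a)]
  exact hn

end BanachFamily

variable {G X A : Type*} [Group G] [MulAction G X] [MulAction G A] [TopologicalSpace G]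
  [TopologicalSpace X] [TopologicalSpace A] {𝒳 : GroupoidOps X} {𝒜 : FellOps 𝒳 A}

theorem IsFellAction.continuousSMul (H : IsFellAction G 𝒜) : ContinuousSMul G A :=
  ⟨H.continuous_smul⟩

theorem IsFellAction.r_proj_smul (H : IsFellAction G 𝒜) (t : G) (a : A) :
    𝒳.r (𝒜.proj (t • a)) = t • 𝒳.r (𝒜.proj a) := by
  rw [H.proj_smul, H.base.r_smul]

variable [IsCancelSMul G X]

theorem exists_rep_proj (H : IsFellAction G 𝒜) {a : A} {Q : OrbitSpace G A}
    (h : (orbitBundle H).proj (OrbitSpace.mk G a) = (orbitBundle H).proj Q) :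
    ∃ b, 𝒜.proj a = 𝒜.proj b ∧ OrbitSpace.mk G b = Q := by
  obtain ⟨b, hb, hb'⟩ := exists_orbitLift (x := 𝒜.proj a) (Q := Q) H.proj_smul h
  exact ⟨b, hb.symm, hb'⟩

theorem exists_rep_comp (H : IsFellAction G 𝒜) {a : A} {Q : OrbitSpace G A}
    (h : (orbitGroupoid H.base).s ((orbitBundle H).proj (OrbitSpace.mk G a)) =
      (orbitGroupoid H.base).r ((orbitBundle H).proj Q)) :
    ∃ b, 𝒳.s (𝒜.proj a) = 𝒳.r (𝒜.proj b) ∧ OrbitSpace.mk G b = Q := by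
  obtain ⟨c, rfl⟩ := OrbitSpace.mk_surjective Q
  obtain ⟨b, hb, hb'⟩ := exists_orbitLift (π := fun b => 𝒳.r (𝒜.proj b))
    (x := 𝒳.s (𝒜.proj a)) (Q := OrbitSpace.mk G c) H.r_proj_smul h
  exact ⟨b, hb.symm, hb'⟩

theorem orbitBundle_adj_mk (H : IsFellAction G 𝒜) (a : A) :
    (orbitBundle H).adj (OrbitSpace.mk G a) = OrbitSpace.mk G (𝒜.adj a) := rfl

theorem orbitBundle_zero_mk (H : IsFellAction G 𝒜) (x : X) :
    (orbitBundle H).zero (OrbitSpace.mk G x) = OrbitSpace.mk G (𝒜.zero x) := by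
  have h₁ := 𝒜.proj_zero x
  have h₂ : (orbitBundle H).proj (OrbitSpace.mk G (𝒜.zero x)) = OrbitSpace.mk G x :=
    congrArg _ h₁
  rw [← h₂, ← BanachFamily.zero_smul, orbitBundle_smul_mk, BanachFamily.zero_smul, h₁]

theorem orbitBundle_norm_fib_sub (H : IsFellAction G 𝒜) {a b : A} {x : X} {P : OrbitSpace G X}
    (hx : OrbitSpace.mk G x = P) (ha : 𝒜.proj a = x) (hb : 𝒜.proj b = x)
    {Q R : OrbitSpace G A} (hQ : OrbitSpace.mk G a = Q) (hR : OrbitSpace.mk G b = R)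
    (hQP : (orbitBundle H).proj Q = P) (hRP : (orbitBundle H).proj R = P) :
    ‖(orbitBundle H).fib Q hQP - (orbitBundle H).fib R hRP‖ = ‖𝒜.fib a ha - 𝒜.fib b hb‖ := by
  subst hx hQ hR
  have h₁ : 𝒜.proj a = 𝒜.proj (𝒜.smul (-1) b) := by rw [𝒜.proj_smul, ha, hb]
  have h₂ := orbitBundle_smul_mk H (-1) b
  have h₃ : (orbitBundle H).proj (OrbitSpace.mk G a) =
      (orbitBundle H).proj ((orbitBundle H).smul (-1) (OrbitSpace.mk G b)) := by
    rw [h₂]; exact congrArg (OrbitSpace.mk G) h₁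
  rw [BanachFamily.norm_fib_sub_fib _ _ _ h₃, BanachFamily.norm_fib_sub_fib _ _ _ h₁,
    ← orbitBundle_nrm_mk H, ← orbitBundle_add_mk H _ _ h₁ (congrArg (OrbitSpace.mk G) h₁)]
  exact congrArg _ ((orbitBundle H).add_congr rfl h₂ _ _)

/-- The right action of the orbit bundle on `𝒜`, that is `(a, G · b) ↦ a b` when
`s(a) = r(b)`. -/
noncomputable def orbitBundleAct (H : IsFellAction G 𝒜) (a : A) (Q : OrbitSpace G A)
    (h : OrbitSpace.mk G (𝒳.s (𝒜.proj a)) =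
      (orbitGroupoid H.base).r ((orbitBundle H).proj Q)) : A :=
  have h' : OrbitSpace.mk G (𝒳.s (𝒜.proj a)) =
      OrbitSpace.map (fun b => 𝒳.r (𝒜.proj b)) H.r_proj_smul Q := by
    obtain ⟨b, rfl⟩ := OrbitSpace.mk_surjective Q
    exact h
  𝒜.mul a (orbitLift H.r_proj_smul (𝒳.s (𝒜.proj a)) Q h')
    (apply_orbitLift H.r_proj_smul h').symm

theorem orbitBundleAct_eq (H : IsFellAction G 𝒜) {a b : A} {Q : OrbitSpace G A}
    (hb : OrbitSpace.mk G b = Q) (hab : 𝒳.s (𝒜.proj a) = 𝒳.r (𝒜.proj b))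
    (h : OrbitSpace.mk G (𝒳.s (𝒜.proj a)) = (orbitGroupoid H.base).r ((orbitBundle H).proj Q)) :
    orbitBundleAct H a Q h = 𝒜.mul a b hab :=
  𝒜.mul_congr rfl (orbitLift_eq H.r_proj_smul _ hb hab.symm) _ _

theorem mk_orbitBundleAct (H : IsFellAction G 𝒜) {a : A} {Q : OrbitSpace G A}
    (h : OrbitSpace.mk G (𝒳.s (𝒜.proj a)) = (orbitGroupoid H.base).r ((orbitBundle H).proj Q)) :
    OrbitSpace.mk G (orbitBundleAct H a Q h) = (orbitBundle H).mul (OrbitSpace.mk G a) Q h := by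
  obtain ⟨b, hb, rfl⟩ := exists_rep_comp H h
  exact (congrArg _ (orbitBundleAct_eq H rfl hb h)).trans (orbitBundle_mul_mk H hb h).symm

/-- The bijection of the fibre over a point with the fibre over its orbit. -/
def orbitFibreMap (H : IsFellAction G 𝒜) {x : X} {P : OrbitSpace G X} (hP : OrbitSpace.mk G x = P)
    (a : 𝒜.Fibre x) : (orbitBundle H).Fibre P :=
  ⟨OrbitSpace.mk G a.1, (congrArg (OrbitSpace.mk G) a.2).trans hP⟩

section OrbitFibreMap

variable (H : IsFellAction G 𝒜) {x : X} {P : OrbitSpace G X} (hP : OrbitSpace.mk G x = P)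

theorem orbitFibreMap_surjective : Function.Surjective (orbitFibreMap H hP) := by
  subst hP
  rintro ⟨Q, hQ⟩
  obtain ⟨a, ha, rfl⟩ := exists_orbitLift (x := x) (Q := Q) H.proj_smul hQ.symm
  exact ⟨⟨a, ha⟩, rfl⟩

theorem orbitFibreMap_add (a b : 𝒜.Fibre x) :
    orbitFibreMap H hP (a + b) = orbitFibreMap H hP a + orbitFibreMap H hP b := by
  refine Subtype.ext ?_
  rw [(orbitBundle H).add_val]
  refine (congrArg (OrbitSpace.mk G) (𝒜.add_val a b)).trans (orbitBundle_add_mk H _ _ _ _).symm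

theorem orbitFibreMap_smul (c : ℂ) (a : 𝒜.Fibre x) :
    orbitFibreMap H hP (c • a) = c • orbitFibreMap H hP a := by
  refine Subtype.ext ?_
  rw [(orbitBundle H).smul_val]
  exact (congrArg (OrbitSpace.mk G) (𝒜.smul_val c a)).trans (orbitBundle_smul_mk H c a.1).symm

theorem norm_orbitFibreMap (a : 𝒜.Fibre x) : ‖orbitFibreMap H hP a‖ = ‖a‖ := by
  rw [(orbitBundle H).norm_val, 𝒜.norm_val]
  exact orbitBundle_nrm_mk H a.1

/-- Any composable representatives compute the product of orbits, so the same fibre map serves the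
multiplication of each unit fibre, both module actions and both inner products. -/
theorem orbitFibreMap_fmul (h𝒜 : IsPreFellBundle 𝒜) (hO : IsPreFellBundle (orbitBundle H))
    {x y z : X} {P Q R : OrbitSpace G X} (hP : OrbitSpace.mk G x = P) (hQ : OrbitSpace.mk G y = Q)
    (hR : OrbitSpace.mk G z = R) (h : 𝒳.s x = 𝒳.r y) (hz : 𝒳.mul x y h = z)
    (h' : (orbitGroupoid H.base).s P = (orbitGroupoid H.base).r Q)
    (hz' : (orbitGroupoid H.base).mul P Q h' = R) (a : 𝒜.Fibre x) (b : 𝒜.Fibre y) :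
    hO.fmul h' hz' (orbitFibreMap H hP a) (orbitFibreMap H hQ b) =
      orbitFibreMap H hR (h𝒜.fmul h hz a b) := by
  have hab : 𝒳.s (𝒜.proj a.1) = 𝒳.r (𝒜.proj b.1) := by rw [a.2, b.2, h]
  exact Subtype.ext (orbitBundle_mul_mk H hab (congrArg (OrbitSpace.mk G) hab))

theorem isCStarIso_orbitFibreMap (h𝒜 : IsPreFellBundle 𝒜)
    (hO : IsPreFellBundle (orbitBundle H)) (hx : 𝒳.IsIdentity x)
    (hP' : (orbitGroupoid H.base).IsIdentity P) :
    letI := h𝒜.cstar hx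
    letI := hO.cstar hP'
    IsCStarIso (orbitFibreMap H hP) := by
  let := h𝒜.cstar hx
  let := hO.cstar hP'
  refine ⟨orbitFibreMap_surjective H hP, orbitFibreMap_add H hP, orbitFibreMap_smul H hP,
    fun a b => (orbitFibreMap_fmul H h𝒜 hO _ _ _ _ _ _ _ a b).symm, fun a => rfl,
    norm_orbitFibreMap H hP⟩

end OrbitFibreMap

variable [ProperSMul G X]

theorem isBanachBundle_orbitBundle (H : IsFellAction G 𝒜) (h : 𝒜.IsBanachBundle) :
    (orbitBundle H).IsBanachBundle where
  continuous_proj := OrbitSpace.continuous_map H.proj_smul h.continuous_proj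
  isOpenMap_proj := OrbitSpace.isOpenMap_map H.proj_smul h.isOpenMap_proj
  upperSemicontinuous_nrm := by
    refine upperSemicontinuous_iff_isOpen_preimage.2 fun c => ?_
    have h₁ : IsOpen (OrbitSpace.mk G ⁻¹' ((orbitBundle H).nrm ⁻¹' Set.Iio c)) := by
      rw [← Set.preimage_comp]
      have h₂ : (orbitBundle H).nrm ∘ OrbitSpace.mk G = 𝒜.nrm :=
        funext fun a => orbitBundle_nrm_mk H a
      rw [h₂]
      exact upperSemicontinuous_iff_isOpen_preimage.1 h.upperSemicontinuous_nrm c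
    exact h₁
  continuous_add := by
    have := H.continuousSMul
    -- As for the groupoid product, the first summand becomes a vector a, and the second orbit is
    -- lifted continuously into the fibre of a.
    refine ((OrbitSpace.isOpenQuotientMap_mk (G := G) (X := A)).prodMap
      IsOpenQuotientMap.id).continuous_of_comp_subtype (S := fun p =>
        (orbitBundle H).proj p.1 = (orbitBundle H).proj p.2) ?_
    set Z := {z : A × OrbitSpace G A //
      (orbitBundle H).proj (OrbitSpace.mk G z.1) = (orbitBundle H).proj z.2}
    have h₁ : Continuous fun z : Z => z.1.1 := continuous_fst.comp continuous_subtype_val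
    have h₂ : Continuous fun z : Z => orbitLift H.proj_smul (𝒜.proj z.1.1) z.1.2 z.2 :=
      continuous_orbitLift H.proj_smul h.continuous_proj (h.continuous_proj.comp h₁)
        (continuous_snd.comp continuous_subtype_val) fun z => z.2
    have h₃ (z : Z) : 𝒜.proj z.1.1 =
        𝒜.proj (orbitLift H.proj_smul (𝒜.proj z.1.1) z.1.2 z.2) :=
      (apply_orbitLift H.proj_smul z.2).symm
    refine (OrbitSpace.continuous_mk.comp (h.continuous_add' h₁ h₂ h₃)).congr fun z => ?_
    refine (orbitBundle_add_mk H _ _ (h₃ z) (congrArg (OrbitSpace.mk G) (h₃ z))).symm.trans ?_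
    exact (orbitBundle H).add_congr rfl (mk_orbitLift H.proj_smul z.2) _ _
  continuous_smul c :=
    continuous_coinduced_dom.2 ((OrbitSpace.continuous_mk.comp (h.continuous_smul c)).congr
      fun a => (orbitBundle_smul_mk H c a).symm)
  tendsto_zero l P hl hn := by
    obtain ⟨x, rfl⟩ := OrbitSpace.mk_surjective P
    rw [orbitBundle_zero_mk]
    intro U hU
    obtain ⟨V, hV, ε, hε, hVU⟩ := h.exists_nhds_zero (OrbitSpace.continuous_mk.tendsto _ hU)
    filter_upwards [hl ((OrbitSpace.isOpenQuotientMap_mk (G := G)).isOpenMap.image_mem_nhds hV),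
      hn (Iio_mem_nhds hε)] with Q hQ hQε
    obtain ⟨b, rfl⟩ := OrbitSpace.mk_surjective Q
    obtain ⟨v, hv, hvb⟩ := hQ
    obtain ⟨t, ht⟩ := OrbitSpace.mk_eq_mk.1 hvb
    -- A translate of b lies over V and has the same norm, so the neighbourhood of zero found in 𝒜
    -- captures it.
    have h₁ : t • b ∈ OrbitSpace.mk G ⁻¹' U := by
      refine hVU _ (by rw [H.proj_smul, ht]; exact hv) ?_
      rw [H.nrm_smul, ← orbitBundle_nrm_mk H]
      exact hQε
    rwa [Set.mem_preimage, OrbitSpace.mk_smul] at h₁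

/-- The equivariant section of `𝒜` that corresponds to a section of the orbit bundle, multiplied
by a function of compact support. -/
noncomputable def orbitSectionCutoff (H : IsFellAction G 𝒜) (h : 𝒜.IsBanachBundle)
    (F : BanachFamily.C0Section (orbitBundle H).toBanachFamily) (φ : C(X, ℝ))
    (hφ : HasCompactSupport φ) : BanachFamily.C0Section 𝒜.toBanachFamily where
  toFun x := 𝒜.smul (φ x) (orbitLift H.proj_smul x (F.toFun (OrbitSpace.mk G x))
    (F.proj_toFun _).symm)
  proj_toFun x := (𝒜.proj_smul _ _).trans (apply_orbitLift H.proj_smul _)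
  continuous_toFun := by
    have := H.continuousSMul
    exact h.continuous_smul'.comp ((Complex.continuous_ofReal.comp φ.continuous).prodMk
      (continuous_orbitLift H.proj_smul h.continuous_proj continuous_id
        (F.continuous_toFun.comp OrbitSpace.continuous_mk)
        fun x => (F.proj_toFun _).symm))
  vanishing ε hε := by
    refine ⟨tsupport φ, hφ, fun x hx => ?_⟩
    rw [𝒜.nrm_smul, image_eq_zero_of_notMem_tsupport hx]
    simpa using hε

theorem norm_eval_sub_orbit (H : IsFellAction G 𝒜) (h : 𝒜.IsBanachBundle)
    (F F' : BanachFamily.C0Section (orbitBundle H).toBanachFamily) (φ : C(X, ℝ))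
    (hφ : HasCompactSupport φ) {x : X} (hx : φ x = 1) :
    ‖F.eval (OrbitSpace.mk G x) - F'.eval (OrbitSpace.mk G x)‖ =
      ‖(orbitSectionCutoff H h F φ hφ).eval x - (orbitSectionCutoff H h F' φ hφ).eval x‖ := by
  have h₁ (a : A) : 𝒜.smul (φ x) a = a := by
    rw [hx, Complex.ofReal_one]
    exact congrArg Subtype.val (one_smul ℂ (𝒜.elt a))
  refine orbitBundle_norm_fib_sub H rfl ((orbitSectionCutoff H h F φ hφ).proj_toFun x)
    ((orbitSectionCutoff H h F' φ hφ).proj_toFun x) ?_ ?_ (F.proj_toFun _) (F'.proj_toFun _)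
  · exact (congrArg _ (h₁ _)).trans (mk_orbitLift H.proj_smul _)
  · exact (congrArg _ (h₁ _)).trans (mk_orbitLift H.proj_smul _)

theorem isSeparable_orbitBundle [LocallyCompactSpace X] [T2Space X] [SecondCountableTopology X]
    (H : IsFellAction G 𝒜) (h : 𝒜.IsBanachBundle) (hs : 𝒜.IsSeparable) :
    (orbitBundle H).IsSeparable := by
  obtain ⟨D, hDc, hD⟩ := hs
  have : Countable D := hDc
  let L := CompactExhaustion.choice (OrbitSpace G X)
  -- The equivariant lift of a section does not vanish at infinity in general, so it is cut off. The
  -- function φ n equals 1 on a compact set whose image contains the n-th compact set of orbits;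
  -- there the cut-off lifts determine the sections and their distances.
  choose K hK hLK using fun n => OrbitSpace.exists_isCompact_image (L.isCompact n)
  choose φ hφ₁ hφ using fun n => exists_continuousMap_one_of_isCompact_subset_isOpen (hK n)
    isOpen_univ (Set.subset_univ _)
  refine BanachFamily.isSeparable_of_countable_classes (ι := ℕ × D) (fun ε F i =>
      (∀ P ∉ L i.1, ‖F.eval P‖ < ε / 2) ∧ ∀ x,
        ‖(orbitSectionCutoff H h F (φ i.1) (hφ i.1).1).eval x - i.2.1.eval x‖ < ε / 2)
    (fun ε hε F => ?_) (fun ε hε F F' i hF hF' P => ?_)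
  · obtain ⟨C, hC, hFC⟩ := F.vanishing (ε / 2) (half_pos hε)
    obtain ⟨n, hn⟩ := L.exists_superset_of_isCompact hC
    obtain ⟨d, hd, hFd⟩ := hD (orbitSectionCutoff H h F (φ n) (hφ n).1) (ε / 2) (half_pos hε)
    refine ⟨(n, ⟨d, hd⟩), fun P hP => ?_, hFd⟩
    rw [(orbitBundle H).norm_val]
    exact hFC P fun hx => hP (hn hx)
  · by_cases hP : P ∈ L i.1
    · obtain ⟨x, hx, rfl⟩ := hLK _ hP
      rw [norm_eval_sub_orbit H h F F' (φ i.1) (hφ i.1).1 (hφ₁ i.1 hx)]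
      have h₁ := hF.2 x
      have h₂ := hF'.2 x
      rw [norm_sub_rev] at h₂
      linarith [norm_sub_le_norm_sub_add_norm_sub
        ((orbitSectionCutoff H h F (φ i.1) (hφ i.1).1).eval x) (i.2.1.eval x)
        ((orbitSectionCutoff H h F' (φ i.1) (hφ i.1).1).eval x)]
    · linarith [hF.1 P hP, hF'.1 P hP, norm_sub_le (F.eval P) (F'.eval P)]

theorem continuous_orbitBundleAct (H : IsFellAction G 𝒜) (h : IsPreFellBundle 𝒜) :
    Continuous fun p : {p : A × OrbitSpace G A // OrbitSpace.mk G (𝒳.s (𝒜.proj p.1)) =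
      (orbitGroupoid H.base).r ((orbitBundle H).proj p.2)} =>
        orbitBundleAct H p.1.1 p.1.2 p.2 := by
  have := H.continuousSMul
  have h₁ : Continuous fun p : {p : A × OrbitSpace G A // OrbitSpace.mk G (𝒳.s (𝒜.proj p.1)) =
      (orbitGroupoid H.base).r ((orbitBundle H).proj p.2)} => p.1.1 :=
    continuous_fst.comp continuous_subtype_val
  have hp := h.isBanachBundle.continuous_proj
  exact h.continuous_mul' h₁ (continuous_orbitLift H.r_proj_smul
    (h.isLCGroupoid.continuous_r.comp hp) (h.isLCGroupoid.continuous_s.comp (hp.comp h₁))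
    (continuous_snd.comp continuous_subtype_val) _) _

theorem isPreFellBundle_orbitBundle (H : IsFellAction G 𝒜) (h𝒜 : IsFellBundle 𝒜) :
    IsPreFellBundle (orbitBundle H) where
  isLCGroupoid := orbitGroupoid_isLCGroupoid H.base h𝒜.isLCGroupoid
  isBanachBundle := isBanachBundle_orbitBundle H h𝒜.isBanachBundle
  isSeparable :=
    have := h𝒜.isLCGroupoid.locallyCompact
    have := h𝒜.isLCGroupoid.hausdorff
    have := h𝒜.isLCGroupoid.secondCountable
    isSeparable_orbitBundle H h𝒜.isBanachBundle h𝒜.isSeparable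
  proj_mul P Q h := by
    obtain ⟨a, rfl⟩ := OrbitSpace.mk_surjective P
    obtain ⟨b, hb, rfl⟩ := exists_rep_comp H h
    rw [orbitBundle_mul_mk H hb]
    exact (congrArg _ (h𝒜.proj_mul a b hb)).trans (orbitGroupoid_mul_mk H.base hb h).symm
  proj_adj P := by
    obtain ⟨a, rfl⟩ := OrbitSpace.mk_surjective P
    exact congrArg _ (h𝒜.proj_adj a)
  add_mul P P' Q h h₁ h₂ h₃ h₄ := by
    obtain ⟨a, rfl⟩ := OrbitSpace.mk_surjective P
    obtain ⟨a', ha', rfl⟩ := exists_rep_proj H h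
    obtain ⟨b, hb, rfl⟩ := exists_rep_comp H h₂
    have h₅ : 𝒳.s (𝒜.proj a') = 𝒳.r (𝒜.proj b) := by rw [← ha', hb]
    have h₆ : 𝒳.s (𝒜.proj (𝒜.add a a' ha')) = 𝒳.r (𝒜.proj b) := by rw [𝒜.proj_add, h₅]
    have h₇ : 𝒜.proj (𝒜.mul a b hb) = 𝒜.proj (𝒜.mul a' b h₅) := by
      rw [h𝒜.proj_mul, h𝒜.proj_mul]; exact 𝒳.mul_congr ha' rfl _ _
    simp only [orbitBundle_add_mk H _ _ ha', orbitBundle_mul_mk H hb, orbitBundle_mul_mk H h₅,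
      orbitBundle_mul_mk H h₆, orbitBundle_add_mk H _ _ h₇, h𝒜.add_mul a a' b ha' h₆ hb h₅ h₇]
  mul_add P Q Q' h h₁ h₂ h₃ h₄ := by
    obtain ⟨a, rfl⟩ := OrbitSpace.mk_surjective P
    obtain ⟨b, hb, rfl⟩ := exists_rep_comp H h₂
    obtain ⟨b', hb', rfl⟩ := exists_rep_proj H h
    have h₅ : 𝒳.s (𝒜.proj a) = 𝒳.r (𝒜.proj b') := by rw [← hb', hb]
    have h₆ : 𝒳.s (𝒜.proj a) = 𝒳.r (𝒜.proj (𝒜.add b b' hb')) := by rw [𝒜.proj_add, h₅]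
    have h₇ : 𝒜.proj (𝒜.mul a b hb) = 𝒜.proj (𝒜.mul a b' h₅) := by
      rw [h𝒜.proj_mul, h𝒜.proj_mul]; exact 𝒳.mul_congr rfl hb' _ _
    simp only [orbitBundle_add_mk H _ _ hb', orbitBundle_mul_mk H hb, orbitBundle_mul_mk H h₅,
      orbitBundle_mul_mk H h₆, orbitBundle_add_mk H _ _ h₇, h𝒜.mul_add a b b' hb' h₆ hb h₅ h₇]
  smul_mul c P Q h h₁ := by
    obtain ⟨a, rfl⟩ := OrbitSpace.mk_surjective P
    obtain ⟨b, hb, rfl⟩ := exists_rep_comp H h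
    have h₂ : 𝒳.s (𝒜.proj (𝒜.smul c a)) = 𝒳.r (𝒜.proj b) := by rw [𝒜.proj_smul, hb]
    simp only [orbitBundle_smul_mk, orbitBundle_mul_mk H hb, orbitBundle_mul_mk H h₂,
      h𝒜.smul_mul c a b hb h₂]
  mul_smul c P Q h h₁ := by
    obtain ⟨a, rfl⟩ := OrbitSpace.mk_surjective P
    obtain ⟨b, hb, rfl⟩ := exists_rep_comp H h
    have h₂ : 𝒳.s (𝒜.proj a) = 𝒳.r (𝒜.proj (𝒜.smul c b)) := by rw [𝒜.proj_smul, hb]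
    simp only [orbitBundle_smul_mk, orbitBundle_mul_mk H hb, orbitBundle_mul_mk H h₂,
      h𝒜.mul_smul c a b hb h₂]
  mul_assoc P Q R hPQ hQR h₁ h₂ := by
    obtain ⟨a, rfl⟩ := OrbitSpace.mk_surjective P
    obtain ⟨b, hab, rfl⟩ := exists_rep_comp H hPQ
    obtain ⟨c, hbc, rfl⟩ := exists_rep_comp H hQR
    have h₃ : 𝒳.s (𝒜.proj (𝒜.mul a b hab)) = 𝒳.r (𝒜.proj c) := by
      rw [h𝒜.proj_mul, h𝒜.isLCGroupoid.s_mul, hbc]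
    have h₄ : 𝒳.s (𝒜.proj a) = 𝒳.r (𝒜.proj (𝒜.mul b c hbc)) := by
      rw [h𝒜.proj_mul, h𝒜.isLCGroupoid.r_mul, hab]
    simp only [orbitBundle_mul_mk H hab, orbitBundle_mul_mk H hbc, orbitBundle_mul_mk H h₃,
      orbitBundle_mul_mk H h₄, h𝒜.mul_assoc a b c hab hbc h₃ h₄]
  adj_adj P := by
    obtain ⟨a, rfl⟩ := OrbitSpace.mk_surjective P
    exact congrArg _ (h𝒜.adj_adj a)
  adj_add P Q h h₁ := by
    obtain ⟨a, rfl⟩ := OrbitSpace.mk_surjective P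
    obtain ⟨b, hb, rfl⟩ := exists_rep_proj H h
    have h₂ : 𝒜.proj (𝒜.adj a) = 𝒜.proj (𝒜.adj b) := by rw [h𝒜.proj_adj, hb, h𝒜.proj_adj]
    simp only [orbitBundle_add_mk H _ _ hb, orbitBundle_adj_mk, orbitBundle_add_mk H _ _ h₂,
      h𝒜.adj_add a b hb h₂]
  adj_smul c P := by
    obtain ⟨a, rfl⟩ := OrbitSpace.mk_surjective P
    simp only [orbitBundle_smul_mk, orbitBundle_adj_mk, h𝒜.adj_smul]
  adj_mul P Q h h₁ := by
    obtain ⟨a, rfl⟩ := OrbitSpace.mk_surjective P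
    obtain ⟨b, hb, rfl⟩ := exists_rep_comp H h
    have h₂ : 𝒳.s (𝒜.proj (𝒜.adj b)) = 𝒳.r (𝒜.proj (𝒜.adj a)) := by
      rw [h𝒜.proj_adj, h𝒜.proj_adj, h𝒜.isLCGroupoid.s_inv, h𝒜.isLCGroupoid.r_inv, hb]
    simp only [orbitBundle_adj_mk, orbitBundle_mul_mk H hb, orbitBundle_mul_mk H h₂,
      h𝒜.adj_mul a b hb h₂]
  continuous_mul := by
    have := H.continuousSMul
    refine ((OrbitSpace.isOpenQuotientMap_mk (G := G) (X := A)).prodMap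
      IsOpenQuotientMap.id).continuous_of_comp_subtype (S := fun p =>
        (orbitGroupoid H.base).s ((orbitBundle H).proj p.1) =
          (orbitGroupoid H.base).r ((orbitBundle H).proj p.2)) ?_
    exact (OrbitSpace.continuous_mk.comp
      (continuous_orbitBundleAct H h𝒜.toIsPreFellBundle)).congr fun z => mk_orbitBundleAct H z.2
  continuous_adj := OrbitSpace.continuous_map H.adj_smul h𝒜.continuous_adj
  nrm_mul_le u hu P Q hP hQ h := by
    obtain ⟨a, rfl⟩ := OrbitSpace.mk_surjective P
    obtain ⟨b, hb, rfl⟩ := exists_rep_comp H h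
    rw [orbitBundle_mul_mk H hb]
    simp only [orbitBundle_nrm_mk]
    exact h𝒜.nrm_mul_le_mul a b hb
  nrm_adj_mul_self u hu P hP h := by
    obtain ⟨a, rfl⟩ := OrbitSpace.mk_surjective P
    have h₁ : 𝒳.s (𝒜.proj (𝒜.adj a)) = 𝒳.r (𝒜.proj a) := by
      rw [h𝒜.proj_adj, h𝒜.isLCGroupoid.s_inv]
    refine (congrArg _ (orbitBundle_mul_mk H h₁ h)).trans ?_
    rw [orbitBundle_nrm_mk, orbitBundle_nrm_mk, h𝒜.nrm_adj_mul, sq]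

theorem isFellBundle_orbitBundle (H : IsFellAction G 𝒜) (h𝒜 : IsFellBundle 𝒜) :
    IsFellBundle (orbitBundle H) where
  toIsPreFellBundle := isPreFellBundle_orbitBundle H h𝒜
  fibreImprimitivity P := by
    obtain ⟨x, rfl⟩ := OrbitSpace.mk_surjective P
    have hO := isPreFellBundle_orbitBundle H h𝒜
    have hX := h𝒜.isLCGroupoid
    let := h𝒜.cstar (hX.isIdentity_r x)
    let := h𝒜.cstar (hX.isIdentity_s x)
    let := hO.cstar (hO.isLCGroupoid.isIdentity_r (OrbitSpace.mk G x))
    let := hO.cstar (hO.isLCGroupoid.isIdentity_s (OrbitSpace.mk G x))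
    refine IsImprimitivityBimodule.transport (h𝒜.fibreImprimitivity x)
      (φ := orbitFibreMap H rfl) (χ := orbitFibreMap H rfl) (ψ := orbitFibreMap H rfl)
      (isCStarIso_orbitFibreMap H _ h𝒜.toIsPreFellBundle hO _ _)
      (isCStarIso_orbitFibreMap H _ h𝒜.toIsPreFellBundle hO _ _)
      (orbitFibreMap_surjective H _) (orbitFibreMap_add H _) (orbitFibreMap_smul H _)
      (norm_orbitFibreMap H _) ?_ ?_ ?_ ?_
    · exact fun b e => orbitFibreMap_fmul H h𝒜.toIsPreFellBundle hO _ _ _ _ _ _ _ b e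
    · exact fun e c => orbitFibreMap_fmul H h𝒜.toIsPreFellBundle hO _ _ _ _ _ _ _ e c
    · exact fun e f => orbitFibreMap_fmul H h𝒜.toIsPreFellBundle hO rfl rfl rfl _ _ _ _ e
        (h𝒜.fadj rfl f)
    · exact fun e f => orbitFibreMap_fmul H h𝒜.toIsPreFellBundle hO rfl rfl rfl _ _ _ _
        (h𝒜.fadj rfl e) f

end

/-! ### The equivalence of the two Fell bundles. -/

section

namespace IsFellBundle

variable {X A : Type*} [TopologicalSpace X] [TopologicalSpace A] {𝒳 : GroupoidOps X}
  {𝒜 : FellOps 𝒳 A}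

theorem s_proj_adj (h𝒜 : IsFellBundle 𝒜) (a : A) :
    𝒳.s (𝒜.proj (𝒜.adj a)) = 𝒳.r (𝒜.proj a) := by
  rw [h𝒜.proj_adj, h𝒜.isLCGroupoid.s_inv]

theorem r_proj_adj (h𝒜 : IsFellBundle 𝒜) (a : A) :
    𝒳.r (𝒜.proj (𝒜.adj a)) = 𝒳.s (𝒜.proj a) := by
  rw [h𝒜.proj_adj, h𝒜.isLCGroupoid.r_inv]

theorem s_proj_mul (h𝒜 : IsFellBundle 𝒜) (a b : A) (h) :
    𝒳.s (𝒜.proj (𝒜.mul a b h)) = 𝒳.s (𝒜.proj b) := by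
  rw [h𝒜.proj_mul, h𝒜.isLCGroupoid.s_mul]

theorem r_proj_mul (h𝒜 : IsFellBundle 𝒜) (a b : A) (h) :
    𝒳.r (𝒜.proj (𝒜.mul a b h)) = 𝒳.r (𝒜.proj a) := by
  rw [h𝒜.proj_mul, h𝒜.isLCGroupoid.r_mul]

end IsFellBundle

variable {G X A : Type*} [Group G] [MulAction G X] [MulAction G A] [TopologicalSpace G]
  [TopologicalSpace X] [TopologicalSpace A] {𝒳 : GroupoidOps X} {𝒜 : FellOps 𝒳 A}

theorem IsFellAction.comp_smul_adj (H : IsFellAction G 𝒜) (h𝒜 : IsFellBundle 𝒜) {a b : A} {t : G}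
    (ht : t • 𝒳.s (𝒜.proj b) = 𝒳.s (𝒜.proj a)) :
    𝒳.s (𝒜.proj a) = 𝒳.r (𝒜.proj (t • 𝒜.adj b)) := by
  rw [H.r_proj_smul, h𝒜.r_proj_adj, ht]

variable [IsCancelSMul G X]

/-- The operations that make `𝒜` an equivalence between the semidirect product and the orbit
bundle. -/
noncomputable def semidirectOrbitOps (H : IsFellAction G 𝒜) (h𝒜 : IsFellBundle 𝒜) :
    FellEquivOps (semidirectBundle H) (orbitBundle H) 𝒜.toBanachFamily where
  left := semidirectActionOps H.base
  right := orbitActionOps H.base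
  -- The range of (b, 1) in the semidirect product is ρ of b, so composability with z is the proof
  -- obligation for z and (b, 1).
  smulL z b h := 𝒜.mul z.1 (z.2 • b) (H.comp_smul (z := z) (w := (b, 1)) h)
  smulR a Q h := orbitBundleAct H a Q h
  innerL a b h := (𝒜.mul a (orbitDiv (𝒳.s (𝒜.proj a)) (𝒳.s (𝒜.proj b)) h • 𝒜.adj b)
    (H.comp_smul_adj h𝒜 (orbitDiv_smul _ _ h)), orbitDiv (𝒳.s (𝒜.proj a)) (𝒳.s (𝒜.proj b)) h)
  innerR a b h := OrbitSpace.mk G (𝒜.mul (𝒜.adj a) b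
    ((h𝒜.s_proj_adj a).trans (congrArg Prod.fst h)))

theorem comp_of_semidirectOrbitOps_ρ_eq (H : IsFellAction G 𝒜) (h𝒜 : IsFellBundle 𝒜) {a b : A}
    (h : (semidirectOrbitOps H h𝒜).left.ρ (𝒜.proj a) =
      (semidirectOrbitOps H h𝒜).left.ρ (𝒜.proj b)) :
    𝒳.s (𝒜.proj (𝒜.adj a)) = 𝒳.r (𝒜.proj b) :=
  (h𝒜.s_proj_adj a).trans (congrArg Prod.fst h)

theorem semidirectOrbitOps_innerL (H : IsFellAction G 𝒜) (h𝒜 : IsFellBundle 𝒜) {a b : A} {t : G}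
    (ht : t • 𝒳.s (𝒜.proj b) = 𝒳.s (𝒜.proj a)) (h) :
    (semidirectOrbitOps H h𝒜).innerL a b h =
      (𝒜.mul a (t • 𝒜.adj b) (H.comp_smul_adj h𝒜 ht), t) := by
  have h₁ := orbitDiv_eq h ht
  exact Prod.ext (𝒜.mul_congr rfl (congrArg (· • 𝒜.adj b) h₁) _ _) h₁

variable [IsTopologicalGroup G] [LocallyCompactSpace G] [T2Space G] [SecondCountableTopology G]

/-- The action of z on b is the first component of the product z(b, 1), so its algebraic laws are
first components of Fell bundle laws in 𝒜 ⋊ G. -/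
theorem isLeftAction_semidirectOrbitOps (H : IsFellAction G 𝒜) (h𝒜 : IsFellBundle 𝒜) :
    (semidirectOrbitOps H h𝒜).IsLeftAction where
  proj_smul z b h := (h𝒜.proj_mul _ _ (H.comp_smul (z := z) (w := (b, 1)) h)).trans
    (𝒳.mul_congr rfl (H.proj_smul _ _) _ _)
  mul_smul z w b hzw h h₁ h₂ := congrArg Prod.fst
    ((isPreFellBundle_semidirectBundle H h𝒜).mul_assoc z w (b, 1) hzw h h₁ h₂)
  nrm_smul_le z b h := (h𝒜.nrm_mul_le_mul _ _ _).trans_eq (by rw [H.nrm_smul]; rfl)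
  add_smul z z' b h h₁ h₂ h₃ h₄ := congrArg Prod.fst
    ((isPreFellBundle_semidirectBundle H h𝒜).add_mul z z' (b, 1) h h₁ h₂ h₃
      (Prod.ext h₄ (congrArg (fun w : X × G => w.2 * 1)
        (show (𝒜.proj z.1, z.2) = (𝒜.proj z'.1, z'.2) from h))))
  smul_add z b b' h h₁ h₂ h₃ h₄ := congrArg Prod.fst
    ((isPreFellBundle_semidirectBundle H h𝒜).mul_add z (b, 1) (b', 1) (Prod.ext h rfl) h₁ h₂ h₃
      (Prod.ext h₄ rfl))
  smul_smulL c z b h h₁ := congrArg Prod.fst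
    ((isPreFellBundle_semidirectBundle H h𝒜).smul_mul c z (b, 1) h h₁)
  smulL_smul c z b h h₁ := congrArg Prod.fst
    ((isPreFellBundle_semidirectBundle H h𝒜).mul_smul c z (b, 1) h h₁)
  continuous_smul := by
    have h₁ : Continuous fun p : {p : (A × G) × A //
        (semidirectGroupoid H.base).s ((semidirectBundle H).proj p.1) =
          (semidirectOrbitOps H h𝒜).left.ρ (𝒜.proj p.2)} => p.1.1 :=
      continuous_fst.comp continuous_subtype_val
    have h₂ : Continuous fun p : {p : (A × G) × A //
        (semidirectGroupoid H.base).s ((semidirectBundle H).proj p.1) =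
          (semidirectOrbitOps H h𝒜).left.ρ (𝒜.proj p.2)} => p.1.2 :=
      continuous_snd.comp continuous_subtype_val
    exact h𝒜.continuous_mul' h₁.fst (H.continuous_smul.comp (h₁.snd.prodMk h₂)) _

omit [IsTopologicalGroup G] [LocallyCompactSpace G] [T2Space G] [SecondCountableTopology G] in
theorem isRightAction_semidirectOrbitOps [ProperSMul G X] (H : IsFellAction G 𝒜)
    (h𝒜 : IsFellBundle 𝒜) : (semidirectOrbitOps H h𝒜).IsRightAction where
  proj_smul a Q h := by
    obtain ⟨b, hb, rfl⟩ := exists_rep_comp H h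
    exact (congrArg 𝒜.proj (orbitBundleAct_eq H rfl hb h)).trans
      ((h𝒜.proj_mul _ _ _).trans (orbitAct_eq H.base rfl hb h).symm)
  smul_mul a P Q hPQ h h₁ h₂ := by
    obtain ⟨b, hb, rfl⟩ := exists_rep_comp H h
    obtain ⟨c, hc, rfl⟩ := exists_rep_comp H hPQ
    have h₃ : 𝒳.s (𝒜.proj a) = 𝒳.r (𝒜.proj (𝒜.mul b c hc)) := by rw [h𝒜.r_proj_mul, hb]
    have h₄ : (semidirectOrbitOps H h𝒜).smulR a (OrbitSpace.mk G b) h = 𝒜.mul a b hb :=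
      orbitBundleAct_eq H rfl hb h
    have h₅ : 𝒳.s (𝒜.proj (𝒜.mul a b hb)) = 𝒳.r (𝒜.proj c) := by rw [h𝒜.s_proj_mul, hc]
    have h₆ : 𝒳.s (𝒜.proj ((semidirectOrbitOps H h𝒜).smulR a (OrbitSpace.mk G b) h)) =
      𝒳.r (𝒜.proj c) := by rw [h₄, h₅]
    exact (orbitBundleAct_eq H (orbitBundle_mul_mk H hc hPQ).symm h₃ h₁).trans
      ((h𝒜.mul_assoc a b c hb hc h₅ h₃).symm.trans ((𝒜.mul_congr h₄.symm rfl h₅ h₆).trans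
        (orbitBundleAct_eq H rfl h₆ h₂).symm))
  nrm_smul_le a Q h := by
    obtain ⟨b, hb, rfl⟩ := exists_rep_comp H h
    rw [orbitBundle_nrm_mk]
    exact (congrArg 𝒜.nrm (orbitBundleAct_eq H rfl hb h)).trans_le (h𝒜.nrm_mul_le_mul a b hb)
  smul_add a P Q h h₁ h₂ h₃ h₄ := by
    obtain ⟨b, hb, rfl⟩ := exists_rep_comp H h₂
    obtain ⟨c, hc, rfl⟩ := exists_rep_proj H h
    have h₅ : 𝒳.s (𝒜.proj a) = 𝒳.r (𝒜.proj c) := by rw [← hc, hb]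
    have h₆ : 𝒳.s (𝒜.proj a) = 𝒳.r (𝒜.proj (𝒜.add b c hc)) := by rw [𝒜.proj_add, h₅]
    have h₇ : 𝒜.proj (𝒜.mul a b hb) = 𝒜.proj (𝒜.mul a c h₅) := by
      rw [h𝒜.proj_mul, h𝒜.proj_mul]; exact 𝒳.mul_congr rfl hc _ _
    exact (orbitBundleAct_eq H (orbitBundle_add_mk H _ _ hc _).symm h₆ h₁).trans
      ((h𝒜.mul_add a b c hc h₆ hb h₅ h₇).trans (𝒜.add_congr (orbitBundleAct_eq H rfl hb h₂).symm
        (orbitBundleAct_eq H rfl h₅ h₃).symm _ _))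
  add_smul a a' Q h h₁ h₂ h₃ h₄ := by
    obtain ⟨b, hb, rfl⟩ := exists_rep_comp H h₂
    have h₅ : 𝒳.s (𝒜.proj a') = 𝒳.r (𝒜.proj b) := by rw [← h, hb]
    have h₆ : 𝒳.s (𝒜.proj (𝒜.add a a' h)) = 𝒳.r (𝒜.proj b) := by rw [𝒜.proj_add, h₅]
    have h₇ : 𝒜.proj (𝒜.mul a b hb) = 𝒜.proj (𝒜.mul a' b h₅) := by
      rw [h𝒜.proj_mul, h𝒜.proj_mul]; exact 𝒳.mul_congr h rfl _ _
    exact (orbitBundleAct_eq H rfl h₆ h₁).trans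
      ((h𝒜.add_mul a a' b h h₆ hb h₅ h₇).trans (𝒜.add_congr (orbitBundleAct_eq H rfl hb h₂).symm
        (orbitBundleAct_eq H rfl h₅ h₃).symm _ _))
  smulR_smul c a Q h h₁ := by
    obtain ⟨b, hb, rfl⟩ := exists_rep_comp H h
    have h₂ : 𝒳.s (𝒜.proj a) = 𝒳.r (𝒜.proj (𝒜.smul c b)) := by rw [𝒜.proj_smul, hb]
    exact (orbitBundleAct_eq H (orbitBundle_smul_mk H c b).symm h₂ h₁).trans
      ((h𝒜.mul_smul c a b hb h₂).trans
        (congrArg (𝒜.smul c) (orbitBundleAct_eq H rfl hb h).symm))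
  smul_smulR c a Q h h₁ := by
    obtain ⟨b, hb, rfl⟩ := exists_rep_comp H h
    have h₂ : 𝒳.s (𝒜.proj (𝒜.smul c a)) = 𝒳.r (𝒜.proj b) := by rw [𝒜.proj_smul, hb]
    exact (orbitBundleAct_eq H rfl h₂ h₁).trans
      ((h𝒜.smul_mul c a b hb h₂).trans
        (congrArg (𝒜.smul c) (orbitBundleAct_eq H rfl hb h).symm))
  continuous_smul := continuous_orbitBundleAct H h𝒜.toIsPreFellBundle

omit [IsTopologicalGroup G] [LocallyCompactSpace G] [T2Space G] [SecondCountableTopology G] in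
/-- The left inner product, in terms of the operations of the semidirect product. -/
theorem semidirectOrbitOps_innerL_eq_mul_adj (H : IsFellAction G 𝒜) (h𝒜 : IsFellBundle 𝒜) {a b : A}
    {t : G} (ht : t • 𝒳.s (𝒜.proj b) = 𝒳.s (𝒜.proj a)) (h) :
    ∃ h', (semidirectOrbitOps H h𝒜).innerL a b h =
      (semidirectBundle H).mul (a, t) ((semidirectBundle H).adj (b, 1)) h' := by
  have h₁ : (1 : G)⁻¹ • 𝒜.adj b = 𝒜.adj b := by rw [inv_one, one_smul]
  refine ⟨Prod.ext ?_ rfl, (semidirectOrbitOps_innerL H h𝒜 ht h).trans (Prod.ext ?_ ?_)⟩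
  · change t⁻¹ • 𝒳.s (𝒜.proj a) = 𝒳.r (𝒜.proj ((1 : G)⁻¹ • 𝒜.adj b))
    rw [h₁, h𝒜.r_proj_adj, ← ht, inv_smul_smul]
  · exact 𝒜.mul_congr rfl (congrArg (t • ·) h₁.symm) _ _
  · exact (mul_one t).symm.trans (congrArg (t * ·) inv_one.symm)

theorem isPreEquivalence_semidirectOrbitOps [ProperSMul G X] (H : IsFellAction G 𝒜)
    (h𝒜 : IsFellBundle 𝒜) (hr : IsOpenMap h𝒜.isLCGroupoid.rUnit) :
    (semidirectOrbitOps H h𝒜).IsPreEquivalence where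
  left_isFellBundle := isFellBundle_semidirectBundle H h𝒜
  right_isFellBundle := isFellBundle_orbitBundle H h𝒜
  isBanachBundle := h𝒜.isBanachBundle
  isSeparable := h𝒜.isSeparable
  base := isGroupoidEquivalence_semidirect_orbit H.base h𝒜.isLCGroupoid hr
  isLeftAction := isLeftAction_semidirectOrbitOps H h𝒜
  isRightAction := isRightAction_semidirectOrbitOps H h𝒜
  commute z e Q hl hr h₁ h₂ := by
    obtain ⟨c, hc, rfl⟩ := exists_rep_comp H hr
    have h₃ := H.comp_smul (z := z) (w := (e, 1)) hl
    have h₄ : 𝒳.s (𝒜.proj (z.2 • e)) = 𝒳.r (𝒜.proj (z.2 • c)) := by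
      rw [H.r_proj_smul, H.proj_smul, H.base.s_smul, hc]
    have h₅ : 𝒳.s (𝒜.proj (𝒜.mul z.1 (z.2 • e) h₃)) = 𝒳.r (𝒜.proj (z.2 • c)) := by
      rw [h𝒜.s_proj_mul, h₄]
    have h₆ : 𝒳.s (𝒜.proj z.1) = 𝒳.r (𝒜.proj (𝒜.mul (z.2 • e) (z.2 • c) h₄)) := by
      rw [h𝒜.r_proj_mul, h₃]
    -- After acting by z, the orbit of c must be represented by z.2·c; the rest is associativity.
    refine (orbitBundleAct_eq H (OrbitSpace.mk_smul z.2 c) h₅ h₁).trans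
      ((h𝒜.mul_assoc _ _ _ h₃ h₄ h₅ h₆).trans (𝒜.mul_congr rfl ?_ _ _))
    rw [H.mul_smul _ _ _ hc]
    exact congrArg _ (orbitBundleAct_eq H rfl hc hr).symm
  add_innerL e e' f h h₁ h₂ h₃ h₄ := by
    -- One t serves all three inner products, since e and e' have the same source; additivity is
    -- then distributivity for products with (f, 1)*.
    obtain ⟨t, ht⟩ := OrbitSpace.mk_eq_mk.1 h₂
    obtain ⟨k₁, e₁⟩ := semidirectOrbitOps_innerL_eq_mul_adj H h𝒜 (t := t) (a := 𝒜.add e e' h)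
      (b := f) (by rw [𝒜.proj_add, ← h, ht]) h₁
    obtain ⟨k₂, e₂⟩ := semidirectOrbitOps_innerL_eq_mul_adj H h𝒜 ht h₂
    obtain ⟨k₃, e₃⟩ := semidirectOrbitOps_innerL_eq_mul_adj H h𝒜 (t := t) (a := e') (b := f)
      (by rw [← h, ht]) h₃
    simp only [e₁, e₂, e₃] at h₄ ⊢
    exact (isPreFellBundle_semidirectBundle H h𝒜).add_mul (e, t) (e', t) _ (Prod.ext h rfl)
      k₁ k₂ k₃ h₄
  innerL_add e f f' h h₁ h₂ h₃ h₄ := by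
    have hS := isPreFellBundle_semidirectBundle H h𝒜
    obtain ⟨t, ht⟩ := OrbitSpace.mk_eq_mk.1 h₂
    obtain ⟨k₁, e₁⟩ := semidirectOrbitOps_innerL_eq_mul_adj H h𝒜 (t := t) (a := e)
      (b := 𝒜.add f f' h) (by rw [𝒜.proj_add, ← h, ht]) h₁
    obtain ⟨k₂, e₂⟩ := semidirectOrbitOps_innerL_eq_mul_adj H h𝒜 ht h₂
    obtain ⟨k₃, e₃⟩ := semidirectOrbitOps_innerL_eq_mul_adj H h𝒜 (t := t) (a := e) (b := f')
      (by rw [← h, ht]) h₃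
    simp only [e₁, e₂, e₃] at h₄ ⊢
    have h₅ : (semidirectBundle H).proj (f, 1) = (semidirectBundle H).proj (f', 1) :=
      Prod.ext h rfl
    have h₆ : (semidirectBundle H).proj ((semidirectBundle H).adj (f, 1)) =
        (semidirectBundle H).proj ((semidirectBundle H).adj (f', 1)) := by
      rw [hS.proj_adj, h₅, hS.proj_adj]
    have h₇ := hS.adj_add (f, 1) (f', 1) h₅ h₆
    exact ((semidirectBundle H).mul_congr rfl h₇ k₁ (by rw [← h₇]; exact k₁)).trans
      (hS.mul_add (e, t) _ _ h₆ _ k₂ k₃ h₄)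
  smul_innerL c e f h h₁ := by
    obtain ⟨t, ht⟩ := OrbitSpace.mk_eq_mk.1 h
    obtain ⟨k₁, e₁⟩ := semidirectOrbitOps_innerL_eq_mul_adj H h𝒜 (t := t) (a := 𝒜.smul c e)
      (b := f) (by rw [𝒜.proj_smul, ht]) h₁
    obtain ⟨k₂, e₂⟩ := semidirectOrbitOps_innerL_eq_mul_adj H h𝒜 ht h
    rw [e₁, e₂]
    exact (isPreFellBundle_semidirectBundle H h𝒜).smul_mul c (e, t) _ k₂ k₁
  innerL_smul c e f h h₁ := by
    have hS := isPreFellBundle_semidirectBundle H h𝒜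
    obtain ⟨t, ht⟩ := OrbitSpace.mk_eq_mk.1 h
    obtain ⟨k₁, e₁⟩ := semidirectOrbitOps_innerL_eq_mul_adj H h𝒜 (t := t) (a := e)
      (b := 𝒜.smul c f) (by rw [𝒜.proj_smul, ht]) h₁
    obtain ⟨k₂, e₂⟩ := semidirectOrbitOps_innerL_eq_mul_adj H h𝒜 ht h
    rw [e₁, e₂]
    have h₂ := hS.adj_smul c (f, 1)
    exact ((semidirectBundle H).mul_congr rfl h₂ k₁ (by rw [← h₂]; exact k₁)).trans
      (hS.mul_smul (star c) (e, t) _ k₂ _)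
  add_innerR e e' f h h₁ h₂ h₃ h₄ := by
    have k₂ := comp_of_semidirectOrbitOps_ρ_eq H h𝒜 h₂
    have k₃ := comp_of_semidirectOrbitOps_ρ_eq H h𝒜 h₃
    have k₁ := comp_of_semidirectOrbitOps_ρ_eq H h𝒜 h₁
    have h₅ : 𝒜.proj (𝒜.adj e) = 𝒜.proj (𝒜.adj e') := by rw [h𝒜.proj_adj, h, h𝒜.proj_adj]
    have h₆ := h𝒜.adj_add e e' h h₅
    have h₇ : 𝒜.proj (𝒜.mul (𝒜.adj e) f k₂) = 𝒜.proj (𝒜.mul (𝒜.adj e') f k₃) := by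
      rw [h𝒜.proj_mul, h𝒜.proj_mul]; exact 𝒳.mul_congr h₅ rfl _ _
    exact (congrArg (OrbitSpace.mk G) ((𝒜.mul_congr h₆ rfl k₁ (by rw [← h₆]; exact k₁)).trans
      (h𝒜.add_mul _ _ f h₅ _ k₂ k₃ h₇))).trans (orbitBundle_add_mk H _ _ h₇ h₄).symm
  innerR_add e f f' h h₁ h₂ h₃ h₄ := by
    have k₂ := comp_of_semidirectOrbitOps_ρ_eq H h𝒜 h₂
    have k₃ := comp_of_semidirectOrbitOps_ρ_eq H h𝒜 h₃
    have h₇ : 𝒜.proj (𝒜.mul (𝒜.adj e) f k₂) = 𝒜.proj (𝒜.mul (𝒜.adj e) f' k₃) := by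
      rw [h𝒜.proj_mul, h𝒜.proj_mul]; exact 𝒳.mul_congr rfl h _ _
    exact (congrArg (OrbitSpace.mk G) (h𝒜.mul_add (𝒜.adj e) f f' h _ k₂ k₃ h₇)).trans
      (orbitBundle_add_mk H _ _ h₇ h₄).symm
  smul_innerR c e f h h₁ := by
    have k := comp_of_semidirectOrbitOps_ρ_eq H h𝒜 h
    have k₁ := comp_of_semidirectOrbitOps_ρ_eq H h𝒜 h₁
    have h₂ := h𝒜.adj_smul c e
    exact (congrArg (OrbitSpace.mk G) ((𝒜.mul_congr h₂ rfl k₁ (by rw [← h₂]; exact k₁)).trans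
      (h𝒜.smul_mul _ _ f k _))).trans (orbitBundle_smul_mk H _ _).symm
  innerR_smul c e f h h₁ := by
    have k := comp_of_semidirectOrbitOps_ρ_eq H h𝒜 h
    exact (congrArg (OrbitSpace.mk G) (h𝒜.mul_smul c (𝒜.adj e) f k _)).trans
      (orbitBundle_smul_mk H _ _).symm
  continuous_innerL := by
    have h₁ : Continuous fun p : {p : A × A // (semidirectOrbitOps H h𝒜).right.σ (𝒜.proj p.1) =
        (semidirectOrbitOps H h𝒜).right.σ (𝒜.proj p.2)} => p.1.1 :=
      continuous_fst.comp continuous_subtype_val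
    have h₂ : Continuous fun p : {p : A × A // (semidirectOrbitOps H h𝒜).right.σ (𝒜.proj p.1) =
        (semidirectOrbitOps H h𝒜).right.σ (𝒜.proj p.2)} => p.1.2 :=
      continuous_snd.comp continuous_subtype_val
    have hp := h𝒜.isLCGroupoid.continuous_s.comp h𝒜.isBanachBundle.continuous_proj
    have h₃ := continuous_orbitDiv (G := G) (hp.comp h₁) (hp.comp h₂) fun p => p.2
    exact (h𝒜.continuous_mul' h₁ (H.continuous_smul.comp (h₃.prodMk
      (h𝒜.continuous_adj.comp h₂))) _).prodMk h₃
  continuous_innerR := by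
    have h₁ : Continuous fun p : {p : A × A // (semidirectOrbitOps H h𝒜).left.ρ (𝒜.proj p.1) =
        (semidirectOrbitOps H h𝒜).left.ρ (𝒜.proj p.2)} => p.1.1 :=
      continuous_fst.comp continuous_subtype_val
    have h₂ : Continuous fun p : {p : A × A // (semidirectOrbitOps H h𝒜).left.ρ (𝒜.proj p.1) =
        (semidirectOrbitOps H h𝒜).left.ρ (𝒜.proj p.2)} => p.1.2 :=
      continuous_snd.comp continuous_subtype_val
    exact OrbitSpace.continuous_mk.comp
      (h𝒜.continuous_mul' (h𝒜.continuous_adj.comp h₁) h₂ _)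
  act_proj_innerL e f h := by
    obtain ⟨t, ht⟩ := OrbitSpace.mk_eq_mk.1 h
    have hX := h𝒜.isLCGroupoid
    have h₀ : 𝒜.proj (t • 𝒜.adj f) = 𝒳.inv (t • 𝒜.proj f) := by
      rw [H.proj_smul, h𝒜.proj_adj, H.base.inv_smul]
    have h₁ := H.comp_smul_adj h𝒜 ht
    have h₂ : 𝒳.s (𝒜.proj e) = 𝒳.r (𝒳.inv (t • 𝒜.proj f)) := by rw [← h₀, h₁]
    have h₃ : 𝒜.proj (𝒜.mul e (t • 𝒜.adj f) h₁) = 𝒳.mul (𝒜.proj e) (𝒳.inv (t • 𝒜.proj f)) h₂ :=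
      (h𝒜.proj_mul _ _ _).trans (𝒳.mul_congr rfl h₀ _ _)
    have h₄ : 𝒳.s (𝒜.proj (𝒜.mul e (t • 𝒜.adj f) h₁)) = t • 𝒳.r (𝒜.proj f) := by
      rw [h₃, hX.s_mul, hX.s_inv, H.base.r_smul]
    have h₅ : 𝒳.s (𝒳.mul (𝒜.proj e) (𝒳.inv (t • 𝒜.proj f)) h₂) = 𝒳.r (t • 𝒜.proj f) := by
      rw [hX.s_mul, hX.s_inv]
    rw [semidirectOrbitOps_innerL H h𝒜 ht h]
    refine ⟨Prod.ext ?_ rfl, ?_⟩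
    · change t⁻¹ • 𝒳.s (𝒜.proj (𝒜.mul e (t • 𝒜.adj f) h₁)) = 𝒳.r (𝒜.proj f)
      rw [h₄, inv_smul_smul]
    · exact (𝒳.mul_congr h₃ rfl _ h₅).trans (hX.inv_mul_cancel_right h₂ h₅)
  act_proj_innerR e f h := by
    have hX := h𝒜.isLCGroupoid
    have k := comp_of_semidirectOrbitOps_ρ_eq H h𝒜 h
    have h₀ := h𝒜.proj_adj e
    have h₁ : 𝒳.s (𝒳.inv (𝒜.proj e)) = 𝒳.r (𝒜.proj f) := by rw [← h₀, k]
    have h₂ : 𝒜.proj (𝒜.mul (𝒜.adj e) f k) = 𝒳.mul (𝒳.inv (𝒜.proj e)) (𝒜.proj f) h₁ :=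
      (h𝒜.proj_mul _ _ _).trans (𝒳.mul_congr h₀ rfl _ _)
    have h₃ : 𝒳.s (𝒜.proj e) = 𝒳.r (𝒳.mul (𝒳.inv (𝒜.proj e)) (𝒜.proj f) h₁) := by
      rw [hX.r_mul, hX.r_inv]
    have h₄ : 𝒳.s (𝒜.proj e) = 𝒳.r (𝒜.proj (𝒜.mul (𝒜.adj e) f k)) := by rw [h₂, h₃]
    exact ⟨congrArg (OrbitSpace.mk G) h₄, (orbitAct_eq H.base rfl h₄ _).trans
      ((𝒳.mul_congr rfl h₂ _ h₃).trans (hX.mul_inv_cancel_left h₁ h₃))⟩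
  adj_innerL e f h := by
    obtain ⟨t, ht⟩ := OrbitSpace.mk_eq_mk.1 h
    -- Interchanging e and f inverts the group element, in agreement with the involution of 𝒜 ⋊ G.
    have ht' : t⁻¹ • 𝒳.s (𝒜.proj e) = 𝒳.s (𝒜.proj f) := by rw [← ht, inv_smul_smul]
    rw [semidirectOrbitOps_innerL H h𝒜 ht h, semidirectOrbitOps_innerL H h𝒜 ht' h.symm]
    refine Prod.ext ?_ rfl
    have h₁ : 𝒳.s (𝒜.proj (𝒜.adj (t • 𝒜.adj f))) = 𝒳.r (𝒜.proj (𝒜.adj e)) := by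
      rw [h𝒜.s_proj_adj, h𝒜.r_proj_adj, H.comp_smul_adj h𝒜 ht]
    have h₂ : t⁻¹ • 𝒜.adj (t • 𝒜.adj f) = f := by
      rw [H.adj_smul, h𝒜.adj_adj, inv_smul_smul]
    have h₃ : 𝒳.s (𝒜.proj (t⁻¹ • 𝒜.adj (t • 𝒜.adj f))) = 𝒳.r (𝒜.proj (t⁻¹ • 𝒜.adj e)) := by
      rw [h₂, ← H.comp_smul_adj h𝒜 ht']
    exact (congrArg (t⁻¹ • ·) (h𝒜.adj_mul e (t • 𝒜.adj f) _ h₁)).trans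
      ((H.mul_smul t⁻¹ _ _ h₁ h₃).symm.trans (𝒜.mul_congr h₂ rfl _ _))
  adj_innerR e f h := by
    have k := comp_of_semidirectOrbitOps_ρ_eq H h𝒜 h
    have h₁ : 𝒳.s (𝒜.proj (𝒜.adj f)) = 𝒳.r (𝒜.proj (𝒜.adj (𝒜.adj e))) := by
      rw [h𝒜.s_proj_adj, h𝒜.adj_adj]; exact (congrArg Prod.fst h).symm
    exact congrArg (OrbitSpace.mk G) ((h𝒜.adj_mul (𝒜.adj e) f k h₁).trans
      (𝒜.mul_congr rfl (h𝒜.adj_adj e) _ _))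
  mul_innerL z e f hz h := by
    have hS := isFellBundle_semidirectBundle H h𝒜
    obtain ⟨t, ht⟩ := OrbitSpace.mk_eq_mk.1 h
    have h₀ := H.comp_smul (z := z) (w := (e, 1)) hz
    -- Acting by z multiplies the group component by z.2, so the claim is the associativity of z (e,
    -- t) (f, 1)*.
    have ht' : (z.2 * t) • 𝒳.s (𝒜.proj f) = 𝒳.s (𝒜.proj (𝒜.mul z.1 (z.2 • e) h₀)) := by
      rw [h𝒜.s_proj_mul, H.proj_smul, H.base.s_smul, ← ht, mul_smul]
    have h₁ : OrbitSpace.mk G (𝒳.s (𝒜.proj (𝒜.mul z.1 (z.2 • e) h₀))) =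
      OrbitSpace.mk G (𝒳.s (𝒜.proj f)) := OrbitSpace.mk_eq_mk.2 ⟨_, ht'⟩
    obtain ⟨k₁, e₁⟩ := semidirectOrbitOps_innerL_eq_mul_adj H h𝒜 ht h
    obtain ⟨k₂, e₂⟩ := semidirectOrbitOps_innerL_eq_mul_adj H h𝒜 ht' h₁
    have hz' : (semidirectGroupoid H.base).s ((semidirectBundle H).proj z) =
        (semidirectGroupoid H.base).r ((semidirectBundle H).proj (e, t)) := hz
    have h₂ : (semidirectGroupoid H.base).s ((semidirectBundle H).proj z) =
        (semidirectGroupoid H.base).r ((semidirectBundle H).proj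
          ((semidirectBundle H).mul (e, t) ((semidirectBundle H).adj (f, 1)) k₁)) := by
      rw [hS.r_proj_mul, hz']
    have h₃ : (semidirectGroupoid H.base).s ((semidirectBundle H).proj z) =
        (semidirectGroupoid H.base).r ((semidirectBundle H).proj
          ((semidirectOrbitOps H h𝒜).innerL e f h)) := by
      rw [e₁, h₂]
    refine ⟨h₁, h₃, e₂.trans (Eq.trans ?_ ((semidirectBundle H).mul_congr rfl e₁ h₃ h₂).symm)⟩
    exact hS.mul_assoc z (e, t) _ hz' k₁ k₂ h₂
  innerR_mul e f Q hQ h := by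
    obtain ⟨c, hc, rfl⟩ := exists_rep_comp H hQ
    have k := comp_of_semidirectOrbitOps_ρ_eq H h𝒜 h
    have e₁ : (semidirectOrbitOps H h𝒜).smulR f (OrbitSpace.mk G c) hQ = 𝒜.mul f c hc :=
      orbitBundleAct_eq H rfl hc hQ
    have h₁ : 𝒳.s (𝒜.proj (𝒜.mul (𝒜.adj e) f k)) = 𝒳.r (𝒜.proj c) := by
      rw [h𝒜.s_proj_mul, hc]
    have h₂ : 𝒳.s (𝒜.proj (𝒜.adj e)) = 𝒳.r (𝒜.proj (𝒜.mul f c hc)) := by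
      rw [h𝒜.r_proj_mul, k]
    rw [e₁]
    refine ⟨Prod.ext ?_ rfl, congrArg (OrbitSpace.mk G) h₁, ?_⟩
    · exact (congrArg Prod.fst h).trans (h𝒜.r_proj_mul f c hc).symm
    · exact (congrArg (OrbitSpace.mk G) (h𝒜.mul_assoc _ _ _ k hc h₁ h₂).symm).trans
        (orbitBundle_mul_mk H h₁ _).symm
  compat e f g hef hfg := by
    obtain ⟨t, ht⟩ := OrbitSpace.mk_eq_mk.1 hef
    have k := comp_of_semidirectOrbitOps_ρ_eq H h𝒜 hfg
    have h₁ := H.comp_smul_adj h𝒜 ht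
    have h₂ : 𝒳.s (𝒜.proj (t • 𝒜.adj f)) = 𝒳.r (𝒜.proj (t • g)) := by
      rw [H.r_proj_smul, H.proj_smul, H.base.s_smul, k]
    have h₃ : 𝒳.s (𝒜.proj (𝒜.mul e (t • 𝒜.adj f) h₁)) = 𝒳.r (𝒜.proj (t • g)) := by
      rw [h𝒜.s_proj_mul, h₂]
    have h₄ : 𝒳.s (𝒜.proj e) = 𝒳.r (𝒜.proj (𝒜.mul (t • 𝒜.adj f) (t • g) h₂)) := by
      rw [h𝒜.r_proj_mul, h₁]
    -- The product (t·f*)(t·g) equals t·(f*g), which is the representative of the right inner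
    -- product of f and g that is composable with e.
    have e₁ := H.mul_smul t (𝒜.adj f) g k h₂
    have h₅ : 𝒳.s (𝒜.proj e) = 𝒳.r (𝒜.proj (t • 𝒜.mul (𝒜.adj f) g k)) := by rw [← e₁, h₄]
    have h₆ : OrbitSpace.mk G (𝒳.s (𝒜.proj e)) =
        OrbitSpace.mk G (𝒳.r (𝒜.proj (𝒜.mul (𝒜.adj f) g k))) := by
      rw [h₅, H.r_proj_smul, OrbitSpace.mk_smul]
    rw [semidirectOrbitOps_innerL H h𝒜 ht hef]
    refine ⟨Prod.ext ?_ rfl, h₆, ?_⟩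
    · change t⁻¹ • 𝒳.s (𝒜.proj (𝒜.mul e (t • 𝒜.adj f) h₁)) = 𝒳.r (𝒜.proj g)
      rw [h₃, H.r_proj_smul, inv_smul_smul]
    · exact (h𝒜.mul_assoc _ _ _ h₁ h₂ h₃ h₄).trans ((𝒜.mul_congr rfl e₁ h₄ h₅).trans
        (orbitBundleAct_eq H (OrbitSpace.mk_smul t _) h₅ h₆).symm)

theorem isFellEquivalence_semidirectOrbitOps [ProperSMul G X] (H : IsFellAction G 𝒜)
    (h𝒜 : IsFellBundle 𝒜) (hr : IsOpenMap h𝒜.isLCGroupoid.rUnit) :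
    (semidirectOrbitOps H h𝒜).IsFellEquivalence where
  toIsPreEquivalence := isPreEquivalence_semidirectOrbitOps H h𝒜 hr
  fibreImprimitivity x := by
    have hW := isPreEquivalence_semidirectOrbitOps H h𝒜 hr
    have hX := h𝒜.isLCGroupoid
    have hS := isPreFellBundle_semidirectBundle H h𝒜
    have hO := isPreFellBundle_orbitBundle H h𝒜
    let := h𝒜.cstar (hX.isIdentity_r x)
    let := h𝒜.cstar (hX.isIdentity_s x)
    let := hW.left_isFellBundle.cstar (hW.base.left.isIdentity_ρ x)
    let := hW.right_isFellBundle.cstar (hW.base.right.isIdentity_σ x)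
    have h₁ : ((1 : G) • 𝒳.r x, (1 : G)) = (semidirectOrbitOps H h𝒜).left.ρ x :=
      Prod.ext (one_smul _ _) rfl
    -- The module A(x) itself is unchanged; only A(r(x)) is renamed as the fibre over (r(x), 1), and
    -- A(s(x)) as the fibre over the orbit of s(x).
    refine IsImprimitivityBimodule.transport (h𝒜.fibreImprimitivity x)
      (φ := semidirectUnitFibreMap H 1 h₁) (χ := orbitFibreMap H rfl) (ψ := id)
      (isCStarIso_semidirectUnitFibreMap H h𝒜.toIsPreFellBundle hS _ _ _ _)
      (isCStarIso_orbitFibreMap H _ h𝒜.toIsPreFellBundle hO _ _)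
      Function.surjective_id (fun _ _ => rfl) (fun _ _ => rfl) (fun _ => rfl) ?_ ?_ ?_ ?_
    · intro b e
      exact Subtype.ext (𝒜.mul_congr (one_smul G _) (one_smul G _) _ _)
    · intro e c
      have hec : 𝒳.s (𝒜.proj e.1) = 𝒳.r (𝒜.proj c.1) := by rw [e.2, c.2, hX.r_s]
      exact Subtype.ext (orbitBundleAct_eq H rfl hec (congrArg (OrbitSpace.mk G) hec))
    · intro e f
      have hef : (1 : G) • 𝒳.s (𝒜.proj f.1) = 𝒳.s (𝒜.proj e.1) := by rw [one_smul, e.2, f.2]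
      refine Subtype.ext ((semidirectOrbitOps_innerL H h𝒜 hef _).trans (Prod.ext ?_ rfl))
      exact (𝒜.mul_congr rfl (one_smul G _) _ _).trans (one_smul G _).symm
    · intro e f
      rfl

end

section

/-! ### Haar systems -/

/-- Orbit maps and left translations extended by a constant need not be proper. It is enough to
control preimages of compact sets on the range fibre that carries the measure, hence the
almost-everywhere condition. -/
theorem _root_.MeasureTheory.Measure.isFiniteMeasureOnCompacts_map {X Y : Type*}
    [TopologicalSpace X] [MeasurableSpace X] [TopologicalSpace Y] [T2Space Y] [MeasurableSpace Y]
    [OpensMeasurableSpace Y] {μ : Measure X} [IsFiniteMeasureOnCompacts μ] {f : X → Y}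
    (hf : Measurable f)
    (h : ∀ K, IsCompact K → ∃ L, IsCompact L ∧ ∀ᵐ x ∂μ, f x ∈ K → x ∈ L) :
    IsFiniteMeasureOnCompacts (μ.map f) := by
  refine ⟨fun K hK => ?_⟩
  obtain ⟨L, hL, hKL⟩ := h K hK
  rw [Measure.map_apply hf hK.measurableSet]
  exact (measure_mono_ae hKL).trans_lt hL.measure_lt_top

theorem _root_.MeasureTheory.Measure.ext_of_integral_eq_of_hasCompactSupport {X : Type*}
    [TopologicalSpace X] [MeasurableSpace X] [BorelSpace X] [LocallyCompactSpace X] [T2Space X]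
    [SecondCountableTopology X] {μ ν : Measure X} [IsFiniteMeasureOnCompacts μ]
    [IsFiniteMeasureOnCompacts ν]
    (h : ∀ f : X → ℝ, Continuous f → HasCompactSupport f → ∫ x, f x ∂μ = ∫ x, f x ∂ν) : μ = ν :=
  Measure.ext_of_integral_eq_on_compactlySupported fun f =>
    h f f.continuous f.hasCompactSupport

namespace GroupoidOps

variable {X : Type*} {𝒳 : GroupoidOps X}

open Classical in
/-- Left multiplication by `x`, with value `x` outside its domain. -/
noncomputable def leftMul (𝒳 : GroupoidOps X) (x y : X) : X :=
  if h : 𝒳.s x = 𝒳.r y then 𝒳.mul x y h else x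

theorem leftMul_eq {x y : X} (h : 𝒳.s x = 𝒳.r y) : 𝒳.leftMul x y = 𝒳.mul x y h := dif_pos h

variable [TopologicalSpace X]

theorem IsLCGroupoid.isClosed_r_eq (h : 𝒳.IsLCGroupoid) (u : X) : IsClosed {x | 𝒳.r x = u} := by
  have := h.hausdorff
  exact isClosed_eq h.continuous_r continuous_const

theorem IsLCGroupoid.continuousOn_leftMul (h : 𝒳.IsLCGroupoid) (x : X) :
    ContinuousOn (𝒳.leftMul x) {y | 𝒳.r y = 𝒳.s x} := by
  rw [continuousOn_iff_continuous_domRestrict]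
  exact (h.continuous_mul' (continuous_const (y := x)) continuous_subtype_val
    fun y => y.2.symm).congr fun y => (leftMul_eq y.2.symm).symm

variable [MeasurableSpace X] [BorelSpace X] {lam : X → Measure X}

/-- Translation is continuous on the closed set of arrows with range s(x) and takes a constant value
elsewhere. -/
theorem IsLCGroupoid.measurable_leftMul (h : 𝒳.IsLCGroupoid) (x : X) :
    Measurable (𝒳.leftMul x) := by
  refine measurable_of_restrict_of_restrict_compl (h.isClosed_r_eq (𝒳.s x)).measurableSet
    (continuousOn_iff_continuous_domRestrict.1 (h.continuousOn_leftMul x)).measurable ?_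
  convert measurable_const (a := x) using 1
  exact funext fun y => dif_neg fun hy => y.2 hy.symm

/-- This is the way back from image measures to the integral form of left invariance. The default
value 0 occurs only on a null set. -/
theorem integral_dite_mul_eq_of_map_leftMul (h : 𝒳.IsLCGroupoid) {x : X}
    (h₁ : ∀ᵐ y ∂(lam (𝒳.s x)), 𝒳.r y = 𝒳.s x)
    (h₂ : (lam (𝒳.s x)).map (𝒳.leftMul x) = lam (𝒳.r x)) {f : X → ℝ} (hf : Continuous f) :
    (open Classical in
      ∫ y, (if h : 𝒳.s x = 𝒳.r y then f (𝒳.mul x y h) else 0) ∂(lam (𝒳.s x))) =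
      ∫ y, f y ∂(lam (𝒳.r x)) := by
  have := h.secondCountable
  rw [← h₂, integral_map (h.measurable_leftMul x).aemeasurable hf.aestronglyMeasurable]
  refine integral_congr_ae ?_
  filter_upwards [h₁] with y hy
  rw [dif_pos hy.symm, leftMul_eq hy.symm]

namespace IsHaarSystem

variable (hlam : 𝒳.IsHaarSystem lam)
include hlam

omit [BorelSpace X] in
theorem ae_r_eq {u : X} (hu : 𝒳.IsIdentity u) : ∀ᵐ x ∂(lam u), 𝒳.r x = u := hlam.null_compl u hu

/-- Both sides give the same integrals on functions of compact support, and such integrals determine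
a measure that is finite on compact sets. -/
theorem map_leftMul (h : 𝒳.IsLCGroupoid) (x : X) :
    (lam (𝒳.s x)).map (𝒳.leftMul x) = lam (𝒳.r x) := by
  have := h.locallyCompact
  have := h.hausdorff
  have := h.secondCountable
  have := hlam.finite_of_compact _ (h.isIdentity_s x)
  have := hlam.finite_of_compact _ (h.isIdentity_r x)
  have hae := hlam.ae_r_eq (h.isIdentity_s x)
  have hm := h.measurable_leftMul x
  have : IsFiniteMeasureOnCompacts ((lam (𝒳.s x)).map (𝒳.leftMul x)) := by
    -- On arrows with range s(x), the preimage of K under translation by x is the translate by x⁻¹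
    -- of the part of K with range r(x), which is compact.
    refine Measure.isFiniteMeasureOnCompacts_map hm fun K hK =>
      ⟨𝒳.leftMul (𝒳.inv x) '' (K ∩ {y | 𝒳.r y = 𝒳.s (𝒳.inv x)}),
        (hK.inter_right (h.isClosed_r_eq _)).image_of_continuousOn
          ((h.continuousOn_leftMul _).mono Set.inter_subset_right), ?_⟩
    filter_upwards [hae] with y hy hyK
    rw [leftMul_eq hy.symm] at hyK
    have h₁ : 𝒳.s (𝒳.inv x) = 𝒳.r (𝒳.mul x y hy.symm) := by rw [h.s_inv, h.r_mul]
    exact ⟨_, ⟨hyK, h₁.symm⟩, (leftMul_eq h₁).trans (h.inv_mul_cancel_left _ h₁)⟩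
  refine Measure.ext_of_integral_eq_of_hasCompactSupport fun f hf hfc => ?_
  rw [integral_map hm.aemeasurable hf.aestronglyMeasurable, ← hlam.left_invariant f hf hfc x]
  refine integral_congr_ae ?_
  filter_upwards [hae] with y hy
  rw [dif_pos hy.symm, leftMul_eq hy.symm]

end IsHaarSystem

end GroupoidOps

section

variable {G X : Type*} [Group G] [MulAction G X] [TopologicalSpace G] [TopologicalSpace X]
  [MeasurableSpace X] [BorelSpace X] {𝒳 : GroupoidOps X} {lam : X → Measure X}

/-- Invariance of a Haar system under a group action, in terms of measures. -/
theorem GroupoidOps.IsHaarSystem.map_smul [ContinuousConstSMul G X] (hlam : 𝒳.IsHaarSystem lam)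
    (h : 𝒳.IsLCGroupoid) (H : IsGroupoidAction G 𝒳)
    (hinv : ∀ f : X → ℝ, Continuous f → HasCompactSupport f → ∀ (t : G) u, 𝒳.IsIdentity u →
      ∫ x, f (t • x) ∂(lam u) = ∫ x, f x ∂(lam (t • u))) (t : G) {u : X} (hu : 𝒳.IsIdentity u) :
    (lam u).map (t • ·) = lam (t • u) := by
  have := h.locallyCompact
  have := h.hausdorff
  have := h.secondCountable
  have := hlam.finite_of_compact _ hu
  have := hlam.finite_of_compact _ (H.isIdentity_smul t hu)
  have hm : Measurable fun x : X => t • x := (continuous_const_smul t).measurable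
  have : IsFiniteMeasureOnCompacts ((lam u).map (t • ·)) :=
    Measure.isFiniteMeasureOnCompacts_map hm fun K hK =>
      ⟨(t • ·) ⁻¹' K, (Homeomorph.smul t).isCompact_preimage.2 hK, ae_of_all _ fun _ => id⟩
  refine Measure.ext_of_integral_eq_of_hasCompactSupport fun f hf hfc => ?_
  rw [integral_map hm.aemeasurable hf.aestronglyMeasurable, hinv f hf hfc t u hu]

theorem isHaarSystem_semidirectGroupoid [IsTopologicalGroup G] [LocallyCompactSpace G] [T2Space G]
    [SecondCountableTopology G] [MeasurableSpace G] [BorelSpace G] [ContinuousConstSMul G X]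
    (hlam : 𝒳.IsHaarSystem lam) (h : 𝒳.IsLCGroupoid) (H : IsGroupoidAction G 𝒳)
    (hinv : ∀ (t : G) {u : X}, 𝒳.IsIdentity u → (lam u).map (t • ·) = lam (t • u))
    (μ : Measure G) [μ.IsHaarMeasure] :
    (semidirectGroupoid H).IsHaarSystem fun z => (lam z.1).prod μ := by
  have := h.locallyCompact
  have := h.hausdorff
  have := h.secondCountable
  have hS := semidirectGroupoid_isLCGroupoid H h
  have hnull : ∀ z, (semidirectGroupoid H).IsIdentity z →
      ∀ᵐ w ∂((lam z.1).prod μ), (semidirectGroupoid H).r w = z := by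
    intro z hz
    obtain ⟨hu, h1⟩ := (semidirectGroupoid_isIdentity H).1 hz
    filter_upwards [Measure.quasiMeasurePreserving_fst.ae (hlam.ae_r_eq hu)] with w hw
    exact Prod.ext hw h1.symm
  refine ⟨fun z hz => ?_, hnull, ?_, ?_, ?_⟩
  · have := hlam.finite_of_compact _ ((semidirectGroupoid_isIdentity H).1 hz).1
    infer_instance
  · rintro z hz U hU ⟨⟨x, t⟩, hxU, hx⟩
    obtain ⟨V, W, hV, hW, hxV, htW, hVW⟩ := isOpen_prod_iff.1 hU x t hxU
    refine lt_of_lt_of_le ?_ (measure_mono hVW)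
    rw [Measure.prod_prod]
    exact ENNReal.mul_pos (hlam.pos_of_open _ ((semidirectGroupoid_isIdentity H).1 hz).1 V hV
      ⟨x, hxV, congrArg Prod.fst hx⟩).ne' (hW.measure_pos μ ⟨t, htW⟩).ne'
  · intro f hf hfc
    -- Integrating out G first leaves a continuous function of compact support on X, to which the
    -- continuity axiom for the given system applies.
    have hF : Continuous fun x => ∫ t, f (x, t) ∂μ := by
      rw [← continuousOn_univ]
      refine continuousOn_integral_of_compact_support (k := Prod.snd '' tsupport f)
        (hfc.isCompact.image continuous_snd) (f := fun x t => f (x, t)) hf.continuousOn ?_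
      intro x t _ ht
      exact image_eq_zero_of_notMem_tsupport fun hxt => ht ⟨_, hxt, rfl⟩
    have hFc : HasCompactSupport fun x => ∫ t, f (x, t) ∂μ := by
      refine HasCompactSupport.intro (hfc.isCompact.image continuous_fst) fun x hx => ?_
      refine integral_eq_zero_of_ae (ae_of_all _ fun t => ?_)
      exact image_eq_zero_of_notMem_tsupport fun hxt => hx ⟨_, hxt, rfl⟩
    refine ((hlam.continuous_integral _ hF hFc).comp
      (semidirectUnitHomeomorph H).symm.continuous).congr fun z => ?_
    have := hlam.finite_of_compact _ ((semidirectGroupoid_isIdentity H).1 z.2).1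
    have hint : Integrable f ((lam z.1.1).prod μ) := hf.integrable_of_hasCompactSupport hfc
    exact (integral_prod f hint).symm
  · rintro f hf hfc ⟨x, t⟩
    refine GroupoidOps.integral_dite_mul_eq_of_map_leftMul (lam := fun z => (lam z.1).prod μ) hS
      (hnull _ (hS.isIdentity_s (x, t))) ?_ hf
    have hu := H.isIdentity_smul t⁻¹ (h.isIdentity_s x)
    have := hlam.finite_of_compact _ hu
    have hm : Measurable fun y : X => 𝒳.leftMul x (t • y) :=
      (h.measurable_leftMul x).comp (continuous_const_smul t).measurable
    -- Invariance under t carries the measure at t⁻¹·s(x) to the one at s(x), and left translation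
    -- by x carries that to the measure at r(x).
    have h₁ : (lam (t⁻¹ • 𝒳.s x)).map (fun y => 𝒳.leftMul x (t • y)) = lam (𝒳.r x) := by
      rw [← hlam.map_leftMul h x, ← smul_inv_smul t (𝒳.s x), ← hinv t hu,
        Measure.map_map (h.measurable_leftMul x) (continuous_const_smul t).measurable]
      rw [smul_inv_smul]
      rfl
    have h₂ : ((lam (t⁻¹ • 𝒳.s x)).prod μ).map
        (Prod.map (fun y => 𝒳.leftMul x (t • y)) (t * ·)) = (lam (𝒳.r x)).prod μ := by
      rw [← Measure.map_prod_map _ _ hm (measurable_const_mul t), h₁, map_mul_left_eq_self]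
    refine Eq.trans (Measure.map_congr ?_) h₂
    filter_upwards [hnull _ (hS.isIdentity_s (x, t))] with w hw
    refine (GroupoidOps.leftMul_eq hw.symm).trans (Prod.ext ?_ rfl)
    exact (GroupoidOps.leftMul_eq (H.comp_smul hw.symm)).symm

end

section

variable {G X Y : Type*} [Group G] [MulAction G X] [MulAction G Y] [TopologicalSpace G]
  [TopologicalSpace X] [TopologicalSpace Y] [IsCancelSMul G X] [ProperSMul G X]

/-- A point of Y is recovered continuously from its image in X and its orbit. The admissible pairs
form a closed set, as the orbit space of X is Hausdorff, so those in N × K form a compact set, and L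
is its image under lifting. -/
theorem exists_isCompact_of_apply_mem_of_mk_mem [ContinuousSMul G Y] {π : Y → X}
    (hπ : ∀ (t : G) y, π (t • y) = t • π y) (hc : Continuous π) {N : Set X} (hN : IsCompact N)
    {K : Set (OrbitSpace G Y)} (hK : IsCompact K) :
    ∃ L : Set Y, IsCompact L ∧ ∀ y, π y ∈ N → OrbitSpace.mk G y ∈ K → y ∈ L := by
  have hcl : IsClosed {p : X × OrbitSpace G Y | OrbitSpace.mk G p.1 = OrbitSpace.map π hπ p.2} :=
    isClosed_eq (OrbitSpace.continuous_mk.comp continuous_fst)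
      ((OrbitSpace.continuous_map hπ hc).comp continuous_snd)
  refine ⟨(fun p : {p : X × OrbitSpace G Y // OrbitSpace.mk G p.1 = OrbitSpace.map π hπ p.2} =>
    orbitLift hπ p.1.1 p.1.2 p.2) '' (Subtype.val ⁻¹' (N ×ˢ K)),
    (hcl.isClosedEmbedding_subtypeVal.isCompact_preimage (hN.prod hK)).image
      (continuous_orbitLift hπ hc (continuous_fst.comp continuous_subtype_val)
        (continuous_snd.comp continuous_subtype_val) fun p => p.2),
    fun y hyN hyK => ⟨⟨(π y, OrbitSpace.mk G y), rfl⟩, ⟨hyN, hyK⟩, orbitLift_eq hπ _ rfl rfl⟩⟩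

variable [MeasurableSpace X] [BorelSpace X] {𝒳 : GroupoidOps X} {lam : X → Measure X}

theorem exists_isHaarSystem_orbitGroupoid (hlam : 𝒳.IsHaarSystem lam) (h : 𝒳.IsLCGroupoid)
    (H : IsGroupoidAction G 𝒳)
    (hinv : ∀ (t : G) {u : X}, 𝒳.IsIdentity u → (lam u).map (t • ·) = lam (t • u)) :
    ∃ lam' : OrbitSpace G X → Measure (OrbitSpace G X), (orbitGroupoid H).IsHaarSystem lam' ∧
      ∀ u, 𝒳.IsIdentity u → lam' (OrbitSpace.mk G u) = (lam u).map (OrbitSpace.mk G) := by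
  have := h.locallyCompact
  have := h.hausdorff
  have := h.secondCountable
  have hO := orbitGroupoid_isLCGroupoid H h
  have hmk : Measurable (OrbitSpace.mk G : X → _) := OrbitSpace.continuous_mk.measurable
  -- The chosen representative of the orbit of u is some t·u. The measure there is the t-translate
  -- of the measure at u, and the orbit map does not see t.
  have hlam' : ∀ u, 𝒳.IsIdentity u →
      (lam (OrbitSpace.mk G u).out).map (OrbitSpace.mk G) = (lam u).map (OrbitSpace.mk G) := by
    intro u hu
    obtain ⟨t, ht⟩ := OrbitSpace.mk_eq_mk.1 (OrbitSpace.mk_out (OrbitSpace.mk G u))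
    rw [← ht, ← hinv t hu, Measure.map_map hmk (continuous_const_smul t).measurable]
    exact congrArg (Measure.map · _) (funext fun x => OrbitSpace.mk_smul t x)
  have hunit : ∀ P, (orbitGroupoid H).IsIdentity P → ∃ u, 𝒳.IsIdentity u ∧ OrbitSpace.mk G u = P :=
    fun P hP => by
      obtain ⟨u, rfl⟩ := OrbitSpace.mk_surjective P
      exact ⟨u, (orbitGroupoid_isIdentity_mk H h).1 hP, rfl⟩
  have hae : ∀ u, 𝒳.IsIdentity u → ∀ᵐ P ∂((lam u).map (OrbitSpace.mk G)),
      (orbitGroupoid H).r P = OrbitSpace.mk G u := fun u hu => by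
    refine (ae_map_iff hmk.aemeasurable (hO.isClosed_r_eq _).measurableSet).2 ?_
    filter_upwards [hlam.ae_r_eq hu] with x hx
    exact congrArg (OrbitSpace.mk G) hx
  refine ⟨fun P => (lam P.out).map (OrbitSpace.mk G), ⟨?_, ?_, ?_, ?_, ?_⟩, hlam'⟩
  · intro P hP
    obtain ⟨u, hu, rfl⟩ := hunit P hP
    rw [hlam' u hu]
    have := hlam.finite_of_compact u hu
    refine Measure.isFiniteMeasureOnCompacts_map hmk fun K hK => ?_
    obtain ⟨L, hL, hKL⟩ := exists_isCompact_of_apply_mem_of_mk_mem H.r_smul h.continuous_r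
      (isCompact_singleton (x := u)) hK
    refine ⟨L, hL, ?_⟩
    filter_upwards [hlam.ae_r_eq hu] with x hx using hKL x hx
  · intro P hP
    obtain ⟨u, hu, rfl⟩ := hunit P hP
    rw [hlam' u hu]
    exact hae u hu
  · rintro P hP U hU ⟨Q, hQU, hQ⟩
    obtain ⟨u, hu, rfl⟩ := hunit P hP
    obtain ⟨x, hx, rfl⟩ := exists_orbitLift H.r_smul hQ.symm
    rw [hlam' u hu, Measure.map_apply hmk hU.measurableSet]
    exact hlam.pos_of_open u hu _ (hU.preimage OrbitSpace.continuous_mk) ⟨x, hQU, hx⟩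
  · intro f hf hfc
    rw [(isOpenQuotientMap_orbitUnit H h).continuous_comp_iff.symm, continuous_iff_continuousAt]
    intro u₀
    -- The pullback of f to X need not have compact support. For units u in the compact
    -- neighbourhood N of u₀, only arrows in the compact set L matter, so multiplying by a function
    -- φ equal to 1 on L changes no integral near u₀.
    obtain ⟨N, hN, hN'⟩ := exists_compact_mem_nhds u₀.1
    obtain ⟨L, hL, hKL⟩ := exists_isCompact_of_apply_mem_of_mk_mem H.r_smul h.continuous_r
      hN hfc.isCompact
    obtain ⟨φ, hφ₁, hφc, -, -⟩ := exists_continuousMap_one_of_isCompact_subset_isOpen hL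
      isOpen_univ (Set.subset_univ L)
    have hcont := hlam.continuous_integral (fun x => φ x * f (OrbitSpace.mk G x))
      (φ.continuous.mul (hf.comp OrbitSpace.continuous_mk)) (HasCompactSupport.mul_right hφc)
    refine hcont.continuousAt.congr ?_
    filter_upwards [continuous_subtype_val.continuousAt.preimage_mem_nhds hN'] with u huN
    refine Eq.trans ?_ (congrArg (fun ν => ∫ P, f P ∂ν) (hlam' u.1 u.2)).symm
    rw [integral_map hmk.aemeasurable hf.aestronglyMeasurable]
    refine integral_congr_ae ?_
    filter_upwards [hlam.ae_r_eq u.2] with x hx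
    by_cases hxf : OrbitSpace.mk G x ∈ tsupport f
    · have hxN : 𝒳.r x ∈ N := by rw [hx]; exact huN
      rw [hφ₁ (hKL x hxN hxf), Pi.one_apply, one_mul]
    · rw [image_eq_zero_of_notMem_tsupport hxf, mul_zero]
  · intro f hf hfc P
    obtain ⟨x, rfl⟩ := OrbitSpace.mk_surjective P
    have hs := hlam' (𝒳.s x) (h.isIdentity_s x)
    have hr := hlam' (𝒳.r x) (h.isIdentity_r x)
    refine GroupoidOps.integral_dite_mul_eq_of_map_leftMul
      (lam := fun P => (lam P.out).map (OrbitSpace.mk G)) hO (x := OrbitSpace.mk G x) ?_ ?_ hf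
    · exact (congrArg (fun ν => ∀ᵐ Q ∂ν, (orbitGroupoid H).r Q = OrbitSpace.mk G (𝒳.s x)) hs).mpr
        (hae _ (h.isIdentity_s x))
    · refine ((congrArg (Measure.map _) hs).trans ?_).trans hr.symm
      rw [Measure.map_map (hO.measurable_leftMul _) hmk, ← hlam.map_leftMul h x,
        Measure.map_map hmk (h.measurable_leftMul x)]
      -- Translating by G·x after passing to orbits agrees with passing to orbits after translating
      -- by x, on the arrows that carry the measure at s(x).
      refine Measure.map_congr ?_
      filter_upwards [hlam.ae_r_eq (h.isIdentity_s x)] with y hy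
      exact ((GroupoidOps.leftMul_eq (congrArg (OrbitSpace.mk G) hy.symm)).trans
        (orbitGroupoid_mul_mk H hy.symm _)).trans
        (congrArg (OrbitSpace.mk G) (GroupoidOps.leftMul_eq hy.symm).symm)

end

end

end FellBundles

open FellBundles MeasureTheory in
theorem mainTheorem4 {G X A : Type*}
    [Group G] [TopologicalSpace G] [IsTopologicalGroup G] [LocallyCompactSpace G] [T2Space G]
    [SecondCountableTopology G]
    [TopologicalSpace X] [MeasurableSpace X] [BorelSpace X] [TopologicalSpace A]
    {𝒳 : GroupoidOps X} {lam : X → Measure X} (hlam : 𝒳.IsHaarSystem lam)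
    {𝒜 : FellOps 𝒳 A} (h𝒜 : IsFellBundle 𝒜)
    [MulAction G X] [MulAction G A] (H : IsFellAction G 𝒜)
    [IsCancelSMul G X] [ProperSMul G X] :
    -- `𝒜` is an equivalence between `𝒜 ⋊ G` and `G \ 𝒜` ...
    (∃ W : FellEquivOps (semidirectBundle H) (orbitBundle H) 𝒜.toBanachFamily,
      W.IsFellEquivalence ∧
      -- ... over the following actions of the base groupoids on the space `X` ...
      (∀ x, W.left.ρ x = (𝒳.r x, 1)) ∧
      (∀ x (t : G) y, 𝒳.s x = t • 𝒳.r y →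
        ∃ h h', W.left.act (x, t) y h = 𝒳.mul x (t • y) h') ∧
      (∀ x, W.right.σ x = OrbitSpace.mk G (𝒳.s x)) ∧
      (∀ x y, 𝒳.s x = 𝒳.r y →
        ∃ h h', W.right.act x (OrbitSpace.mk G y) h = 𝒳.mul x y h') ∧
      -- ... with the following actions and inner products.
      (∀ a (t : G) b, 𝒳.s (𝒜.proj a) = t • 𝒳.r (𝒜.proj b) →
        ∃ h h', W.smulL (a, t) b h = 𝒜.mul a (t • b) h') ∧
      (∀ a b, OrbitSpace.mk G (𝒳.s (𝒜.proj a)) = OrbitSpace.mk G (𝒳.s (𝒜.proj b)) →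
        ∃ t : G, 𝒳.s (𝒜.proj a) = t • 𝒳.s (𝒜.proj b) ∧
          (∀ t' : G, 𝒳.s (𝒜.proj a) = t' • 𝒳.s (𝒜.proj b) → t' = t) ∧
          ∃ h h', W.innerL a b h = (𝒜.mul a (t • 𝒜.adj b) h', t)) ∧
      (∀ a b, 𝒳.s (𝒜.proj a) = 𝒳.r (𝒜.proj b) →
        ∃ h h', W.smulR a (OrbitSpace.mk G b) h = 𝒜.mul a b h') ∧
      (∀ a b, 𝒳.r (𝒜.proj a) = 𝒳.r (𝒜.proj b) →
        ∃ h h', W.innerR a b h = OrbitSpace.mk G (𝒜.mul (𝒜.adj a) b h'))) ∧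
    -- If the Haar system of `𝒳` is `G`-invariant, `𝒳 ⋊ G` and `G \ 𝒳` have Haar systems.
    ((∀ f : X → ℝ, Continuous f → HasCompactSupport f → ∀ (t : G) u, 𝒳.IsIdentity u →
        ∫ x, f (t • x) ∂(lam u) = ∫ x, f x ∂(lam (t • u))) →
      (∀ [MeasurableSpace G] [BorelSpace G] (μ : Measure G) [μ.IsHaarMeasure],
        (semidirectGroupoid H.base).IsHaarSystem fun z => (lam z.1).prod μ) ∧
      ∃ lam' : OrbitSpace G X → Measure (OrbitSpace G X),
        (orbitGroupoid H.base).IsHaarSystem lam' ∧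
        ∀ u, 𝒳.IsIdentity u → lam' (OrbitSpace.mk G u) = (lam u).map (OrbitSpace.mk G)) := by
  have h := h𝒜.isLCGroupoid
  refine ⟨⟨semidirectOrbitOps H h𝒜,
    isFellEquivalence_semidirectOrbitOps H h𝒜 (h.isOpenMap_rUnit hlam), fun _ => rfl, ?_,
    fun _ => rfl, ?_, ?_, ?_, ?_, ?_⟩, fun hinv => ?_⟩
  · intro x t y hxy
    have h₁ : (semidirectGroupoid H.base).s (x, t) = (𝒳.r y, 1) :=
      Prod.ext (by simp [semidirectGroupoid, hxy]) rfl
    exact ⟨h₁, H.base.comp_smul h₁, rfl⟩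
  · intro x y hxy
    have h₁ := congrArg (OrbitSpace.mk G) hxy
    exact ⟨h₁, hxy, orbitAct_eq H.base rfl hxy h₁⟩
  · intro a t b hab
    have h₁ : (semidirectGroupoid H.base).s (𝒜.proj a, t) = (𝒳.r (𝒜.proj b), 1) :=
      Prod.ext (by simp [semidirectGroupoid, hab]) rfl
    exact ⟨h₁, H.comp_smul (z := (a, t)) (w := (b, 1)) h₁, rfl⟩
  · intro a b hab
    obtain ⟨t, ht⟩ := OrbitSpace.mk_eq_mk.1 hab
    exact ⟨t, ht.symm, fun t' ht' => IsCancelSMul.right_cancel _ _ _ (ht'.symm.trans ht.symm),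
      hab, H.comp_smul_adj h𝒜 ht, semidirectOrbitOps_innerL H h𝒜 ht hab⟩
  · intro a b hab
    have h₁ := congrArg (OrbitSpace.mk G) hab
    exact ⟨h₁, hab, orbitBundleAct_eq H rfl hab h₁⟩
  · intro a b hab
    have h₁ : (𝒳.r (𝒜.proj a), (1 : G)) = (𝒳.r (𝒜.proj b), 1) := Prod.ext hab rfl
    exact ⟨h₁, (h𝒜.s_proj_adj a).trans hab, rfl⟩
  · have hinv' := fun (t : G) {u : X} (hu : 𝒳.IsIdentity u) =>
      hlam.map_smul h H.base hinv t hu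
    exact ⟨fun μ _ => isHaarSystem_semidirectGroupoid hlam h H.base hinv' μ,
      exists_isHaarSystem_orbitGroupoid hlam h H.base hinv'⟩
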